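/- Let $M$ be a compact smooth oriented Riemannian manifold without boundary, of dimension $m\ge 4$, with volume form $\nu_M$, and let $E$ be a smooth Hermitian vector bundle over $M$. For a smooth Hermitian connection $D_A$ on $E$ let $F_A\in\Omega^2(M,\mathrm{ad}(E))$ be its curvature, where $\mathrm{ad}(E)=\mathfrak u(E)$ is the bundle of skew-Hermitian endomorphisms of $E$ with the inner product $\langle S,T\rangle=-\mathrm{tr}(ST)$, and let $$|F_A|^2=\sum_{i<j}\langle F_A(e_i,e_j),F_A(e_i,e_j)\rangle\quad(e_1,\dots,e_m\text{ an orthonormal frame}),\qquad YM(D_A)=\int_M|F_A|^2\,\nu_M .$$ For $\Phi\in\Omega^{m-4}(M)$ let $q_\Phi(\varphi)=(\varphi\wedge\varphi\wedge\Phi)/\nu_M$ for real two-forms $\varphi$, and extend $q_\Phi$ to $\mathrm{ad}(E)$-valued two-forms by means of the inner product on $\mathrm{ad}(E)$, so that $q_\Phi(F_A)=-\mathrm{tr}(F_A\wedge F_A)\wedge\Phi/\nu_M$. A smooth form $\Phi\in\Omega^{m-4}(M)$ is a Yang–Mills calibrating form if $d\Phi=0$ and $q_\Phi(\varphi)\le|\varphi|^2$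 for all $\varphi\in\Omega^2(M)$, where $|\varphi|^2=\sum_{i<j}\varphi(e_i,e_j)^2$. A Hermitian connection $D_A$ is $\Phi$-calibrated if $q_\Phi(F_A)=|F_A|^2$ at every point of $M$. Lemma. Let $\Phi$ be a Yang–Mills calibrating form on $M$ and let $D_A$ be a $\Phi$-calibrated Hermitian connection on $E$. Then every Hermitian connection $D_{A'}$ on $E$ satisfies $YM(D_{A'})\ge YM(D_A)$. Moreover, if $YM(D_{A'})=YM(D_A)$, then $D_{A'}$ is also $\Phi$-calibrated. -/

import Mathlib

open Bundle Set MeasureTheory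
open scoped Manifold ContDiff Topology

attribute [local instance] InnerProductSpace.complexToReal

noncomputable section

namespace YMCalib

/-! ### Linear algebra: wedge products, the quadratic form of a top-minus-four form -/

section LinearAlgebra

variable {V : Type*} [AddCommGroup V] [Module ℝ V]
  {W₁ W₂ W : Type*} [AddCommGroup W₁] [Module ℝ W₁] [AddCommGroup W₂] [Module ℝ W₂]
  [AddCommGroup W] [Module ℝ W]

/-- The wedge product of two vector-valued forms, with values multiplied through the bilinear map
`β` (sum over shuffles, so that `(e¹ ∧ e²)(e₁, e₂) = 1`). -/
def wedge {p q : ℕ} (β : W₁ →ₗ[ℝ] W₂ →ₗ[ℝ] W)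
    (a : V [⋀^Fin p]→ₗ[ℝ] W₁) (b : V [⋀^Fin q]→ₗ[ℝ] W₂) : V [⋀^Fin (p + q)]→ₗ[ℝ] W :=
  ((TensorProduct.lift β).compAlternatingMap (a.domCoprod b)).domDomCongr finSumFinEquiv

/-- The quotient `η / ν` of two top-degree forms (`ν ≠ 0`): the number `c` with `η = c ν`. -/
def topQuotient {n : ℕ} [hn : Fact (Module.finrank ℝ V = n)] [Module.Finite ℝ V]
    (η ν : V [⋀^Fin n]→ₗ[ℝ] ℝ) : ℝ :=
  η (Module.finBasisOfFinrankEq ℝ V hn.out) / ν (Module.finBasisOfFinrankEq ℝ V hn.out)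

/-- The quadratic form `q_Φ(φ) = φ ∧ φ ∧ Φ / ν` on two-forms with values in a space `W` with the
symmetric bilinear form `β`, which multiplies the values in `φ ∧ φ`. -/
def qForm {k : ℕ} [Fact (Module.finrank ℝ V = k + 4)] [Module.Finite ℝ V]
    (β : W →ₗ[ℝ] W →ₗ[ℝ] ℝ) (ν : V [⋀^Fin (k + 4)]→ₗ[ℝ] ℝ) (Φ : V [⋀^Fin k]→ₗ[ℝ] ℝ)
    (φ : V [⋀^Fin 2]→ₗ[ℝ] W) : ℝ :=
  topQuotient ((wedge (LinearMap.mul ℝ ℝ) (wedge β φ φ) Φ).domDomCongr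
    (finCongr (by omega : 2 + 2 + k = k + 4))) ν

end LinearAlgebra

/-- The squared norm `|φ|² = ∑_{i < j} |φ(eᵢ, eⱼ)|²` (`e` an orthonormal basis) of a two-form on a
Euclidean space with values in a space `W` with the symmetric bilinear form `β`. -/
def normSqForm {V : Type*} [NormedAddCommGroup V] [InnerProductSpace ℝ V] [Module.Finite ℝ V]
    {W : Type*} [AddCommGroup W] [Module ℝ W]
    (β : W →ₗ[ℝ] W →ₗ[ℝ] ℝ) (φ : V [⋀^Fin 2]→ₗ[ℝ] W) : ℝ :=
  ∑ i, ∑ j ∈ Finset.Ioi i,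
    β (φ ![stdOrthonormalBasis ℝ V i, stdOrthonormalBasis ℝ V j])
      (φ ![stdOrthonormalBasis ℝ V i, stdOrthonormalBasis ℝ V j])

/-- The bilinear form `⟨A, B⟩ = -Re tr(AB)` on endomorphisms of a complex vector space. On the
skew-Hermitian endomorphisms of a Hermitian space, `tr(AB)` is real and this is the usual positive
definite invariant inner product `tr(A* B)`. -/
def tracePairing (V : Type*) [AddCommGroup V] [Module ℂ V] :
    (V →ₗ[ℂ] V) →ₗ[ℝ] (V →ₗ[ℂ] V) →ₗ[ℝ] ℝ :=
  LinearMap.mk₂ ℝ (fun A B ↦ -(LinearMap.trace ℂ V (A ∘ₗ B)).re)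
    (fun A A' B ↦ by simp [LinearMap.add_comp]; ring)
    (fun c A B ↦ by
      have : (c • A) ∘ₗ B = (c : ℂ) • (A ∘ₗ B) := by ext; simp
      rw [this]; simp)
    (fun A B B' ↦ by simp [LinearMap.comp_add]; ring)
    (fun c A B ↦ by
      have : A ∘ₗ (c • B) = (c : ℂ) • (A ∘ₗ B) := by ext; simp
      rw [this]; simp)

/-! ### Differential forms, orientations and volume on a manifold -/

section Manifold

variable {n : ℕ} {M : Type*} [TopologicalSpace M] [ChartedSpace (EuclideanSpace ℝ (Fin n)) M]

instance (x : M) : Fact (Module.finrank ℝ (TangentSpace (𝓡 n) x) = n) :=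
  ⟨finrank_euclideanSpace_fin (𝕜 := ℝ) (n := n)⟩

instance (x : M) : Module.Finite ℝ (TangentSpace (𝓡 n) x) :=
  inferInstanceAs (Module.Finite ℝ (EuclideanSpace ℝ (Fin n)))

variable (n M) in
/-- Differential `k`-forms on `M`, without regularity. -/
abbrev DForm (k : ℕ) : Type _ := ∀ x : M, TangentSpace (𝓡 n) x [⋀^Fin k]→L[ℝ] ℝ

/-- The differential of the inverse of the chart at `x₀`, at the point with coordinates `y`: it
sends the standard basis vectors to the coordinate vector fields. -/
def coordTangent (x₀ : M) (y : EuclideanSpace ℝ (Fin n)) :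
    EuclideanSpace ℝ (Fin n) →L[ℝ] TangentSpace (𝓡 n) ((extChartAt (𝓡 n) x₀).symm y) :=
  mfderiv (𝓡 n) (𝓡 n) (extChartAt (𝓡 n) x₀).symm y

/-- A differential form read in the chart at `x₀` (its pull-back by the inverse of the chart). -/
def DForm.inChart {k : ℕ} (η : DForm n M k) (x₀ : M) (y : EuclideanSpace ℝ (Fin n)) :
    EuclideanSpace ℝ (Fin n) [⋀^Fin k]→L[ℝ] ℝ :=
  (η ((extChartAt (𝓡 n) x₀).symm y)).compContinuousLinearMap (coordTangent x₀ y)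

/-- A differential form is smooth if it is so in charts. -/
def DForm.IsSmooth {k : ℕ} (η : DForm n M k) : Prop :=
  ∀ x₀ : M, ContDiffOn ℝ ∞ (η.inChart x₀) (extChartAt (𝓡 n) x₀).target

/-- A differential form is closed if its exterior derivative, computed in charts, vanishes. -/
def DForm.IsClosed {k : ℕ} (η : DForm n M k) : Prop :=
  ∀ x₀ : M, ∀ y ∈ (extChartAt (𝓡 n) x₀).target, extDeriv (η.inChart x₀) y = 0

variable (n M) in
/-- An orientation of `M`: an orientation of each tangent space, locally constant in the local
trivializations of the tangent bundle. -/
structure ManifoldOrientation [IsManifold (𝓡 n) ∞ M] where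
  /-- The orientation of each tangent space. -/
  at' : ∀ x : M, Orientation ℝ (TangentSpace (𝓡 n) x) (Fin n)
  locallyConstant : ∀ x₀ : M, ∃ o₀ : Orientation ℝ (EuclideanSpace ℝ (Fin n)) (Fin n),
    ∀ᶠ x in 𝓝 x₀,
      ∀ hx : x ∈ (trivializationAt (EuclideanSpace ℝ (Fin n)) (TangentSpace (𝓡 n)) x₀).baseSet,
        Orientation.map (Fin n)
          ((trivializationAt (EuclideanSpace ℝ (Fin n)) (TangentSpace (𝓡 n)) x₀).linearEquivAt
            ℝ x hx) (at' x) = o₀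

variable [RiemannianBundle (fun x : M ↦ TangentSpace (𝓡 n) x)]

/-- The volume density `√det(gᵢⱼ)` of the metric in the chart at `x₀`. -/
def chartDensity (x₀ : M) (y : EuclideanSpace ℝ (Fin n)) : ℝ :=
  Real.sqrt (Matrix.det (Matrix.of fun i j : Fin n ↦
    inner ℝ (coordTangent x₀ y (EuclideanSpace.single i 1))
      (coordTangent x₀ y (EuclideanSpace.single j 1))))

/-- The Riemannian volume of the domain of the chart at `x₀`: the image of `√det(gᵢⱼ) dy`. -/
def chartVolume [MeasurableSpace M] (x₀ : M) : Measure M :=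
  Measure.map (extChartAt (𝓡 n) x₀).symm
    ((volume.restrict (extChartAt (𝓡 n) x₀).target).withDensity
      fun y ↦ ENNReal.ofReal (chartDensity x₀ y))

variable (n M) in
/-- The Riemannian volume measure: the least measure which dominates the volume of each chart
domain. As the latter agree on overlaps, it restricts to each of them. -/
def riemannianVolume [MeasurableSpace M] : Measure M := ⨆ x₀ : M, chartVolume (n := n) x₀

/-- The Riemannian volume form `ν_M` of an oriented Riemannian manifold. -/
def ManifoldOrientation.volumeForm [IsManifold (𝓡 n) ∞ M] (o : ManifoldOrientation n M) (x : M) :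
    TangentSpace (𝓡 n) x [⋀^Fin n]→ₗ[ℝ] ℝ :=
  (o.at' x).volumeForm

end Manifold

/-! ### Hermitian connections and curvature -/

section Connection

variable {n : ℕ} {M : Type*} [TopologicalSpace M] [ChartedSpace (EuclideanSpace ℝ (Fin n)) M]
  [IsManifold (𝓡 n) ∞ M]
  (F : Type*) [NormedAddCommGroup F] [NormedSpace ℂ F] [FiniteDimensional ℂ F]
  (E : M → Type*) [TopologicalSpace (TotalSpace F E)]
  [∀ x, NormedAddCommGroup (E x)] [∀ x, InnerProductSpace ℂ (E x)]
  [FiberBundle F E] [VectorBundle ℂ F E] [VectorBundle ℝ F E]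
  [ContMDiffVectorBundle ∞ F E (𝓡 n)] [IsContMDiffRiemannianBundle (𝓡 n) ∞ F E]

variable (n) in
/-- A Hermitian connection on a Hermitian vector bundle `E`: a smooth covariant derivative on
sections of `E` which is complex linear and compatible with the metric. (A complex linear
connection is compatible with the Hermitian metric iff it is so with its real part.)
As in `CovariantDerivative`, `D σ x v` is `∇_v σ` at `x`. -/
structure HermitianConnection extends CovariantDerivative (𝓡 n) F E where
  smooth : toCovariantDerivative.ContMDiffCovariantDerivative ∞
  complexLinear : ∀ (c : ℂ) (σ : ∀ x, E x) (x : M),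
    MDifferentiableAt (𝓡 n) ((𝓡 n).prod 𝓘(ℝ, F)) (fun y ↦ TotalSpace.mk' F y (σ y)) x →
    ∀ v : TangentSpace (𝓡 n) x, toFun (fun y ↦ c • σ y) x v = c • toFun σ x v
  metric : toCovariantDerivative.IsMetricCompatible

variable {F E}

namespace HermitianConnection

variable (D : HermitianConnection n F E)

/-- `∇_X ∇_Y σ - ∇_Y ∇_X σ - ∇_[X, Y] σ` at the point `x`. -/
def curvatureOp (X Y : ∀ x : M, TangentSpace (𝓡 n) x) (σ : ∀ x, E x) (x : M) : E x :=
  D.toFun (fun y ↦ D.toFun σ y (Y y)) x (X x) - D.toFun (fun y ↦ D.toFun σ y (X y)) x (Y x)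
    - D.toFun σ x (VectorField.mlieBracket (𝓡 n) X Y x)

/-- The derivative of the local extension of a vector `e` is differentiable. -/
lemma mdifferentiableAt_cov_extend [T2Space M] {x : M} (e : E x) :
    MDifferentiableAt (𝓡 n) ((𝓡 n).prod 𝓘(ℝ, EuclideanSpace ℝ (Fin n) →L[ℝ] F))
      (fun y ↦ TotalSpace.mk' (EuclideanSpace ℝ (Fin n) →L[ℝ] F)
        (E := fun y ↦ TangentSpace (𝓡 n) y →L[ℝ] E y) y (D.toFun (FiberBundle.extend F e) y)) x := by
  obtain ⟨s, hs, hσ⟩ := FiberBundle.exists_contMDiffOn_extend (k := ∞) (𝓡 n) F e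
  obtain ⟨u, hus, hu, hxu⟩ := mem_nhds_iff.1 hs
  obtain ⟨f, hf, -⟩ := (SmoothBumpFunction.nhds_basis_support (I := 𝓡 n)
    (hu.mem_nhds hxu)).mem_iff.1 (hu.mem_nhds hxu)
  have hσu := hσ.mono hus
  have hglob := ContMDiffOn.smul_section_of_tsupport (n := ∞) (ψ := f)
    f.contMDiff.contMDiffOn hu hf hσu
  have hD := D.smooth.contMDiff.contMDiff (σ := (f : M → ℝ) • FiberBundle.extend F e)
    (by simpa using hglob.contMDiffOn)
  have hDx := (hD.contMDiffAt Filter.univ_mem).mdifferentiableAt (x := x) (by simp)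
  refine hDx.congr_of_eventuallyEq ?_
  have h1 : ∀ᶠ y in 𝓝 x, f =ᶠ[𝓝 y] 1 := eventually_eventually_nhds.2 f.eventuallyEq_one
  filter_upwards [hu.mem_nhds hxu, h1] with y hy hfy
  congr 1
  refine D.isCovariantDerivativeOnUniv.congr_of_eventuallyEq (s := univ)
    ((hσu.contMDiffAt (hu.mem_nhds hy)).mdifferentiableAt (by simp))
    (hglob.contMDiffAt.mdifferentiableAt (by simp)) Filter.univ_mem ?_
  filter_upwards [hfy] with z hz
  simp [hz]

lemma curvatureOp_tensorial₁ [T2Space M] {x : M} (e : E x) {Y : ∀ x : M, TangentSpace (𝓡 n) x}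
    (hY : MDifferentiableAt (𝓡 n) ((𝓡 n).prod 𝓘(ℝ, EuclideanSpace ℝ (Fin n)))
      (fun y ↦ TotalSpace.mk' (EuclideanSpace ℝ (Fin n)) y (Y y)) x) :
    TensorialAt (𝓡 n) (EuclideanSpace ℝ (Fin n))
      (fun X ↦ D.curvatureOp X Y (FiberBundle.extend F e) x) x where
  smul {f X} hf hX := by
    have h := (D.mdifferentiableAt_cov_extend e).clm_bundle_apply hX
    have h2 := D.isCovariantDerivativeOnUniv.leibniz h hf
    have h3 : (fun y ↦ D.toFun (FiberBundle.extend F e) y ((f • X) y)) =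
      f • fun y ↦ D.toFun (FiberBundle.extend F e) y (X y) := by ext y; simp
    simp only [curvatureOp, h3, h2, VectorField.mlieBracket_smul_left hf hX]
    simp
    module
  add {X X'} hX hX' := by
    have h := (D.mdifferentiableAt_cov_extend e).clm_bundle_apply hX
    have h' := (D.mdifferentiableAt_cov_extend e).clm_bundle_apply hX'
    have h2 := D.isCovariantDerivativeOnUniv.add h h'
    have h3 : (fun y ↦ D.toFun (FiberBundle.extend F e) y ((X + X') y)) =
      (fun y ↦ D.toFun (FiberBundle.extend F e) y (X y)) + fun y ↦ D.toFun (FiberBundle.extend F e) y (X' y) := by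
        ext y; simp
    simp only [curvatureOp, h3, h2, VectorField.mlieBracket_add_left hX hX']
    simp
    abel

lemma curvatureOp_swap (X Y : ∀ x : M, TangentSpace (𝓡 n) x) (σ : ∀ x, E x) (x : M) :
    D.curvatureOp X Y σ x = -D.curvatureOp Y X σ x := by
  simp only [curvatureOp]
  rw [VectorField.mlieBracket_swap]
  simp
  abel

lemma curvatureOp_tensorial₂ [T2Space M] {x : M} (e : E x) {X : ∀ x : M, TangentSpace (𝓡 n) x}
    (hX : MDifferentiableAt (𝓡 n) ((𝓡 n).prod 𝓘(ℝ, EuclideanSpace ℝ (Fin n)))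
      (fun y ↦ TotalSpace.mk' (EuclideanSpace ℝ (Fin n)) y (X y)) x) :
    TensorialAt (𝓡 n) (EuclideanSpace ℝ (Fin n))
      (fun Y ↦ D.curvatureOp X Y (FiberBundle.extend F e) x) x where
  smul {f Y} hf hY := by
    have := (D.curvatureOp_tensorial₁ e hX).smul hf hY
    simp only [D.curvatureOp_swap X, this, smul_neg]
  add {Y Y'} hY hY' := by
    have := (D.curvatureOp_tensorial₁ e hX).add hY hY'
    simp only [D.curvatureOp_swap X, this, neg_add]

/-- `F(u, v) e` as a bilinear map in `u, v`. -/
def curvatureBilin [T2Space M] (x : M) (e : E x) :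
    TangentSpace (𝓡 n) x →L[ℝ] TangentSpace (𝓡 n) x →L[ℝ] E x :=
  TensorialAt.mkHom₂ (fun X Y ↦ D.curvatureOp X Y (FiberBundle.extend F e) x) x
    (fun _ hY ↦ D.curvatureOp_tensorial₁ e hY) (fun _ hX ↦ D.curvatureOp_tensorial₂ e hX)

/-- Multiplication by a complex constant preserves differentiability of sections. -/
lemma mdifferentiableAt_complex_smul {σ : ∀ x, E x} {x : M} (c : ℂ)
    (hσ : MDifferentiableAt (𝓡 n) ((𝓡 n).prod 𝓘(ℝ, F)) (fun y ↦ TotalSpace.mk' F y (σ y)) x) :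
    MDifferentiableAt (𝓡 n) ((𝓡 n).prod 𝓘(ℝ, F))
      (fun y ↦ TotalSpace.mk' F y ((c • σ) y)) x := by
  rw [mdifferentiableAt_section] at hσ ⊢
  have h : MDifferentiableAt (𝓡 n) 𝓘(ℝ, F)
      (fun y ↦ (c • ContinuousLinearMap.id ℝ F) (trivializationAt F E x ⟨y, σ y⟩).2) x :=
    (c • ContinuousLinearMap.id ℝ F).differentiableAt.mdifferentiableAt.comp x hσ
  refine h.congr_of_eventuallyEq ?_
  filter_upwards [(trivializationAt F E x).open_baseSet.mem_nhds
    (FiberBundle.mem_baseSet_trivializationAt' (F := F) (E := E) x)] with y hy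
  have := map_smul ((trivializationAt F E x).linearEquivAt ℂ y hy) c (σ y)
  simp only [Trivialization.linearEquivAt_apply] at this
  exact this

lemma toFun_linear {σ σ' τ : ∀ x, E x} {x : M} (a b : ℂ)
    (hσ : MDifferentiableAt (𝓡 n) ((𝓡 n).prod 𝓘(ℝ, F)) (fun y ↦ TotalSpace.mk' F y (σ y)) x)
    (hσ' : MDifferentiableAt (𝓡 n) ((𝓡 n).prod 𝓘(ℝ, F)) (fun y ↦ TotalSpace.mk' F y (σ' y)) x)
    (hτ : ∀ᶠ y in 𝓝 x, τ y = a • σ y + b • σ' y) (v : TangentSpace (𝓡 n) x) :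
    D.toFun τ x v = a • D.toFun σ x v + b • D.toFun σ' x v := by
  have h := mdifferentiableAt_complex_smul (n := n) a hσ
  have h' := mdifferentiableAt_complex_smul (n := n) b hσ'
  have hadd := mdifferentiableAt_add_section h h'
  have hτ' : MDifferentiableAt (𝓡 n) ((𝓡 n).prod 𝓘(ℝ, F)) (fun y ↦ TotalSpace.mk' F y (τ y)) x :=
    hadd.congr_of_eventuallyEq (by filter_upwards [hτ] with y hy; simp [hy])
  rw [D.isCovariantDerivativeOnUniv.congr_of_eventuallyEq hτ' hadd Filter.univ_mem hτ,
    D.isCovariantDerivativeOnUniv.add h h']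
  have h1 := D.complexLinear a σ x hσ v
  have h2 := D.complexLinear b σ' x hσ' v
  rw [← h1, ← h2]
  rfl

lemma extend_linear {x y : M} (hy : y ∈ (trivializationAt F E x).baseSet) (a b : ℂ) (e e' : E x) :
    FiberBundle.extend F (a • e + b • e') y =
      a • FiberBundle.extend F e y + b • FiberBundle.extend F e' y := by
  have hx := FiberBundle.mem_baseSet_trivializationAt' (F := F) (E := E) x
  simp only [FiberBundle.extend]
  simp only [← Trivialization.symmₗ_apply (R := ℂ) _ hy,
      ← Trivialization.linearEquivAt_apply (R := ℂ) _ x hx, map_add, map_smul]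

lemma curvatureOp_linear [T2Space M] (X Y : ∀ x : M, TangentSpace (𝓡 n) x) {x : M}
    (hX : MDifferentiableAt (𝓡 n) ((𝓡 n).prod 𝓘(ℝ, EuclideanSpace ℝ (Fin n)))
      (fun y ↦ TotalSpace.mk' (EuclideanSpace ℝ (Fin n)) y (X y)) x)
    (hY : MDifferentiableAt (𝓡 n) ((𝓡 n).prod 𝓘(ℝ, EuclideanSpace ℝ (Fin n)))
      (fun y ↦ TotalSpace.mk' (EuclideanSpace ℝ (Fin n)) y (Y y)) x) (a b : ℂ) (e e' : E x) :
    D.curvatureOp X Y (FiberBundle.extend F (a • e + b • e')) x =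
      a • D.curvatureOp X Y (FiberBundle.extend F e) x +
        b • D.curvatureOp X Y (FiberBundle.extend F e') x := by
  have hlin : ∀ᶠ y in 𝓝 x, FiberBundle.extend F (a • e + b • e') y =
      a • FiberBundle.extend F e y + b • FiberBundle.extend F e' y := by
    filter_upwards [(trivializationAt F E x).open_baseSet.mem_nhds
      (FiberBundle.mem_baseSet_trivializationAt' (F := F) (E := E) x)] with y hy
    exact extend_linear hy a b e e'
  have hd (e : E x) : ∀ᶠ y in 𝓝 x, MDifferentiableAt (𝓡 n) ((𝓡 n).prod 𝓘(ℝ, F))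
      (fun y ↦ TotalSpace.mk' F y (FiberBundle.extend F e y)) y := by
    obtain ⟨s, hs, h⟩ := FiberBundle.exists_mdifferentiableOn_extend (𝓡 n) F e
    filter_upwards [eventually_mem_nhds_iff.2 hs] with y hy using h.mdifferentiableAt hy
  have h1 : ∀ᶠ y in 𝓝 x, ∀ v, D.toFun (FiberBundle.extend F (a • e + b • e')) y v =
      a • D.toFun (FiberBundle.extend F e) y v + b • D.toFun (FiberBundle.extend F e') y v := by
    filter_upwards [eventually_eventually_nhds.2 hlin, hd e, hd e'] with y hy he he' v
    exact D.toFun_linear a b he he' hy v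
  have h2 {Z : ∀ x : M, TangentSpace (𝓡 n) x}
      (hZ : MDifferentiableAt (𝓡 n) ((𝓡 n).prod 𝓘(ℝ, EuclideanSpace ℝ (Fin n)))
        (fun y ↦ TotalSpace.mk' (EuclideanSpace ℝ (Fin n)) y (Z y)) x)
      (v : TangentSpace (𝓡 n) x) :=
    D.toFun_linear (τ := fun y ↦ D.toFun (FiberBundle.extend F (a • e + b • e')) y (Z y)) a b
      ((D.mdifferentiableAt_cov_extend e).clm_bundle_apply hZ)
      ((D.mdifferentiableAt_cov_extend e').clm_bundle_apply hZ)
      (h1.mono fun y hy ↦ hy (Z y)) v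
  simp only [curvatureOp, h2 hX, h2 hY, h1.self_of_nhds]
  module

/-- The curvature `F_A` of a Hermitian connection at `x`, as a two-form with values in the
endomorphisms of the fiber: `F_A(X, Y) σ = ∇_X ∇_Y σ - ∇_Y ∇_X σ - ∇_[X, Y] σ`, computed with any
extension of the vectors. -/
def curvature [T2Space M] (x : M) : TangentSpace (𝓡 n) x [⋀^Fin 2]→ₗ[ℝ] (E x →ₗ[ℂ] E x) where
  toFun v :=
    { toFun := fun e ↦ D.curvatureBilin x e (v 0) (v 1)
      map_add' := fun e e' ↦ by
        have := D.curvatureOp_linear _ _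
          (FiberBundle.mdifferentiableAt_extend (𝓡 n) (EuclideanSpace ℝ (Fin n)) (v 0))
          (FiberBundle.mdifferentiableAt_extend (𝓡 n) (EuclideanSpace ℝ (Fin n)) (v 1)) 1 1 e e'
        simpa [curvatureBilin, TensorialAt.mkHom₂_apply_eq_extend] using this
      map_smul' := fun c e ↦ by
        have := D.curvatureOp_linear _ _
          (FiberBundle.mdifferentiableAt_extend (𝓡 n) (EuclideanSpace ℝ (Fin n)) (v 0))
          (FiberBundle.mdifferentiableAt_extend (𝓡 n) (EuclideanSpace ℝ (Fin n)) (v 1)) c 0 e e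
        simpa [curvatureBilin, TensorialAt.mkHom₂_apply_eq_extend] using this }
  map_update_add' v i u w := by
    ext e
    fin_cases i <;> simp
  map_update_smul' v i c u := by
    ext e
    fin_cases i <;> simp
  map_eq_zero_of_eq' v i j hv hij := by
    ext e
    have h : v 0 = v 1 := by fin_cases i <;> fin_cases j <;> simp_all
    have h2 := D.curvatureOp_swap (FiberBundle.extend (EuclideanSpace ℝ (Fin n)) (v 0))
      (FiberBundle.extend (EuclideanSpace ℝ (Fin n)) (v 0)) (FiberBundle.extend F e) x
    have h3 := eq_neg_iff_add_eq_zero.1 h2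
    rw [← two_smul ℝ] at h3
    simpa [curvatureBilin, TensorialAt.mkHom₂_apply_eq_extend, h] using h3

variable [RiemannianBundle (fun x : M ↦ TangentSpace (𝓡 n) x)]

/-- The pointwise squared norm `|F_A|²` of the curvature. -/
def curvatureNormSq [T2Space M] (x : M) : ℝ := normSqForm (tracePairing (E x)) (D.curvature x)

/-- The Yang-Mills energy `∫_M |F_A|² ν_M`. -/
def yangMills [T2Space M] [MeasurableSpace M] : ℝ :=
  ∫ x, D.curvatureNormSq x ∂(riemannianVolume n M)

end HermitianConnection

end Connection

/-! ### Yang-Mills calibrations -/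

section Calibration

variable {k : ℕ} {M : Type*} [TopologicalSpace M]
  [ChartedSpace (EuclideanSpace ℝ (Fin (k + 4))) M] [IsManifold (𝓡 (k + 4)) ∞ M]
  [RiemannianBundle (fun x : M ↦ TangentSpace (𝓡 (k + 4)) x)]

/-- A form `Φ` of degree `m - 4` on an oriented Riemannian manifold of dimension `m = k + 4` is a
Yang-Mills calibrating form if it is (smooth and) closed and `q_Φ(φ) ≤ |φ|²` for all real
two-forms `φ`. -/
structure IsYangMillsCalibratingForm (o : ManifoldOrientation (k + 4) M) (Φ : DForm (k + 4) M k) :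
    Prop where
  smooth : Φ.IsSmooth
  closed : Φ.IsClosed
  le_normSq : ∀ (x : M) (φ : TangentSpace (𝓡 (k + 4)) x [⋀^Fin 2]→ₗ[ℝ] ℝ),
    qForm (LinearMap.mul ℝ ℝ) (o.volumeForm x) (Φ x).toAlternatingMap φ ≤
      normSqForm (LinearMap.mul ℝ ℝ) φ

variable
  {F : Type*} [NormedAddCommGroup F] [NormedSpace ℂ F] [FiniteDimensional ℂ F]
  {E : M → Type*} [TopologicalSpace (TotalSpace F E)]
  [∀ x, NormedAddCommGroup (E x)] [∀ x, InnerProductSpace ℂ (E x)]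
  [FiberBundle F E] [VectorBundle ℂ F E] [VectorBundle ℝ F E]
  [ContMDiffVectorBundle ∞ F E (𝓡 (k + 4))] [IsContMDiffRiemannianBundle (𝓡 (k + 4)) ∞ F E]

/-- A Hermitian connection is `Φ`-calibrated if its curvature satisfies `q_Φ(F_A) = |F_A|²`. -/
def HermitianConnection.IsCalibrated [T2Space M] (D : HermitianConnection (k + 4) F E)
    (o : ManifoldOrientation (k + 4) M) (Φ : DForm (k + 4) M k) : Prop :=
  ∀ x : M, qForm (tracePairing (E x)) (o.volumeForm x) (Φ x).toAlternatingMap (D.curvature x) =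
    D.curvatureNormSq x

end Calibration

end YMCalib

end

/-! Write `a = A' - A`. The form `T = tr(a ∧ (F + F')) - tr(a ∧ a ∧ a) / 3` is globally defined and
is, in every local frame, the difference of the Chern-Simons forms of `A'` and `A` up to an exact
form, so that `dT = tr(F' ∧ F') - tr(F ∧ F)`. As `Φ` is closed, Stokes' theorem in charts gives, for
each function `ρ_κ` of a partition of unity, `∫ ρ_κ dT ∧ Φ = -∫ dρ_κ ∧ T ∧ Φ`; summing over `κ` and
using `∑ dρ_κ = 0` shows that `∫ q_Φ(F)` is the same for all Hermitian connections. On the other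
hand, `q_Φ(F) ≤ |F|²` pointwise, by the calibration inequality applied to the matrix entries of `F`
in an orthonormal frame. Hence `YM(D) = ∫ q_Φ(F) = ∫ q_Φ(F') ≤ YM(D')`, and equality forces
`q_Φ(F') = |F'|²` almost everywhere, hence everywhere by continuity. -/

noncomputable section

namespace YMCalib

/-! ### Wedge products as alternating sums -/

section LinearAlgebra

variable {V : Type*} [AddCommGroup V] [Module ℝ V]
  {W₁ W₂ W : Type*} [AddCommGroup W₁] [Module ℝ W₁] [AddCommGroup W₂] [Module ℝ W₂]
  [AddCommGroup W] [Module ℝ W]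

lemma alternatization_domDomCongr {R V W ι ι' : Type*} [Semiring R] [AddCommMonoid V] [Module R V]
    [AddCommGroup W] [Module R W] [Fintype ι] [DecidableEq ι] [Fintype ι'] [DecidableEq ι']
    (e : ι ≃ ι') (m : MultilinearMap R (fun _ : ι ↦ V) W) :
    MultilinearMap.alternatization (m.domDomCongr e) =
      (MultilinearMap.alternatization m).domDomCongr e := by
  ext v
  simp only [MultilinearMap.alternatization_apply, AlternatingMap.domDomCongr_apply,
    MultilinearMap.domDomCongr_apply]
  refine (Fintype.sum_equiv (Equiv.permCongr e) _ _ fun σ ↦ ?_).symm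
  simp [Equiv.Perm.sign_permCongr]

lemma eq_inv_factorial_smul_alternatization {p : ℕ} (a : V [⋀^Fin p]→ₗ[ℝ] W) :
    a = (p.factorial : ℝ)⁻¹ • MultilinearMap.alternatization a.toMultilinearMap := by
  have h : MultilinearMap.alternatization a.toMultilinearMap =
      (Fintype.card (Fin p)).factorial • a :=
    AlternatingMap.coe_alternatization a
  rw [h, Fintype.card_fin, ← Nat.cast_smul_eq_nsmul ℝ, smul_smul, inv_mul_cancel₀, one_smul]
  exact_mod_cast p.factorial_ne_zero

/-- The product of two multilinear maps, with values multiplied through `β`. Its alternatization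
is the wedge product up to a factorial factor. -/
def mulTensor {p q : ℕ} (β : W₁ →ₗ[ℝ] W₂ →ₗ[ℝ] W)
    (a : MultilinearMap ℝ (fun _ : Fin p ↦ V) W₁) (b : MultilinearMap ℝ (fun _ : Fin q ↦ V) W₂) :
    MultilinearMap ℝ (fun _ : Fin (p + q) ↦ V) W :=
  ((TensorProduct.lift β).compMultilinearMap (a.domCoprod b)).domDomCongr finSumFinEquiv

lemma mulTensor_apply {p q : ℕ} (β : W₁ →ₗ[ℝ] W₂ →ₗ[ℝ] W)
    (a : MultilinearMap ℝ (fun _ : Fin p ↦ V) W₁) (b : MultilinearMap ℝ (fun _ : Fin q ↦ V) W₂)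
    (v : Fin (p + q) → V) :
    mulTensor β a b v = β (a fun i ↦ v (Fin.castAdd q i)) (b fun i ↦ v (Fin.natAdd p i)) := by
  simp [mulTensor]

lemma wedge_alternatization {p q : ℕ} (β : W₁ →ₗ[ℝ] W₂ →ₗ[ℝ] W)
    (a : MultilinearMap ℝ (fun _ : Fin p ↦ V) W₁) (b : MultilinearMap ℝ (fun _ : Fin q ↦ V) W₂) :
    wedge β (MultilinearMap.alternatization a) (MultilinearMap.alternatization b) =
      MultilinearMap.alternatization (mulTensor β a b) := by
  rw [wedge, mulTensor, alternatization_domDomCongr,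
    LinearMap.compMultilinearMap_alternatization, MultilinearMap.domCoprod_alternization]

lemma wedge_smul_smul {p q : ℕ} (β : W₁ →ₗ[ℝ] W₂ →ₗ[ℝ] W) (c d : ℝ)
    (a : V [⋀^Fin p]→ₗ[ℝ] W₁) (b : V [⋀^Fin q]→ₗ[ℝ] W₂) :
    wedge β (c • a) (d • b) = (c * d) • wedge β a b := by
  rw [wedge, wedge, ← AlternatingMap.domCoprod'_apply, ← AlternatingMap.domCoprod'_apply,
    TensorProduct.smul_tmul_smul, map_smul]
  ext v
  simp

lemma wedge_wedge_eq_smul_alternatization {k : ℕ} (β : W →ₗ[ℝ] W →ₗ[ℝ] ℝ)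
    (φ : V [⋀^Fin 2]→ₗ[ℝ] W) (Φ : V [⋀^Fin k]→ₗ[ℝ] ℝ) :
    wedge (LinearMap.mul ℝ ℝ) (wedge β φ φ) Φ = (4 * (k.factorial : ℝ))⁻¹ •
      MultilinearMap.alternatization (mulTensor (LinearMap.mul ℝ ℝ)
        (mulTensor β φ.toMultilinearMap φ.toMultilinearMap) Φ.toMultilinearMap) := by
  conv_lhs => rw [eq_inv_factorial_smul_alternatization φ, eq_inv_factorial_smul_alternatization Φ]
  rw [wedge_smul_smul, wedge_smul_smul, wedge_alternatization, wedge_alternatization]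
  congr 1
  rw [Nat.factorial_two, Nat.cast_ofNat]
  ring

lemma topQuotient_eq {n : ℕ} [hn : Fact (Module.finrank ℝ V = n)] [Module.Finite ℝ V]
    (η ν : V [⋀^Fin n]→ₗ[ℝ] ℝ) (v : Module.Basis (Fin n) ℝ V) :
    topQuotient η ν = η v / ν v := by
  set b := Module.finBasisOfFinrankEq ℝ V hn.out
  have h (ζ : V [⋀^Fin n]→ₗ[ℝ] ℝ) : ζ b = ζ v * v.det b := by
    conv_lhs => rw [AlternatingMap.eq_smul_basis_det v ζ]
    simp
  have hd : v.det b ≠ 0 := (v.isUnit_det b).ne_zero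
  rw [topQuotient, h η, h ν, mul_div_mul_right _ _ hd]

/-- The signed sum over all permutations of `k + 4` arguments of a four-tensor `g` times a
`k`-tensor `f`: the component of `g ∧ f` along `v` up to a factorial factor, with `g` and `f` given
by arbitrary, possibly not alternating, functions of the indices. -/
def altSum {ι : Type*} {k : ℕ} (v : Fin (k + 4) → ι) (g : ι → ι → ι → ι → ℝ)
    (f : (Fin k → ι) → ℝ) : ℝ :=
  ∑ σ : Equiv.Perm (Fin (k + 4)), ((Equiv.Perm.sign σ : ℤ) : ℝ) *
    (g (v (σ 0)) (v (σ 1)) (v (σ 2)) (v (σ 3)) * f fun i ↦ v (σ (i.addNat 4)))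

/-- The product of a four-tensor and a `k`-tensor, with the index type `Fin (k + 4)` of top forms
in place of `Fin (4 + k)`. -/
def mulTensorFour {k : ℕ} (g : MultilinearMap ℝ (fun _ : Fin 4 ↦ V) ℝ)
    (f : MultilinearMap ℝ (fun _ : Fin k ↦ V) ℝ) :
    MultilinearMap ℝ (fun _ : Fin (k + 4) ↦ V) ℝ :=
  (mulTensor (LinearMap.mul ℝ ℝ) g f).domDomCongr (finCongr (by omega : 4 + k = k + 4))

lemma alternatization_mulTensorFour_apply {k : ℕ} (g : MultilinearMap ℝ (fun _ : Fin 4 ↦ V) ℝ)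
    (f : MultilinearMap ℝ (fun _ : Fin k ↦ V) ℝ) (v : Fin (k + 4) → V) :
    MultilinearMap.alternatization (mulTensorFour g f) v =
      altSum v (fun a b c d ↦ g ![a, b, c, d]) f := by
  rw [MultilinearMap.alternatization_apply, altSum]
  refine Finset.sum_congr rfl fun σ _ ↦ ?_
  rw [MultilinearMap.domDomCongr_apply, mulTensorFour, MultilinearMap.domDomCongr_apply,
    mulTensor_apply, LinearMap.mul_apply', Units.smul_def, zsmul_eq_mul]
  congr 3
  · ext i
    fin_cases i <;> rfl
  · ext i
    congr 2
    ext
    simp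

lemma topQuotient_alternatization_mulTensorFour {k : ℕ} [Fact (Module.finrank ℝ V = k + 4)]
    [Module.Finite ℝ V] (g : MultilinearMap ℝ (fun _ : Fin 4 ↦ V) ℝ)
    (f : MultilinearMap ℝ (fun _ : Fin k ↦ V) ℝ) (ν : V [⋀^Fin (k + 4)]→ₗ[ℝ] ℝ)
    (v : Module.Basis (Fin (k + 4)) ℝ V) :
    topQuotient (MultilinearMap.alternatization (mulTensorFour g f)) ν =
      altSum v (fun a b c d ↦ g ![a, b, c, d]) f / ν v := by
  rw [topQuotient_eq _ _ v, alternatization_mulTensorFour_apply]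

lemma qForm_eq_altSum {k : ℕ} [Fact (Module.finrank ℝ V = k + 4)] [Module.Finite ℝ V]
    (β : W →ₗ[ℝ] W →ₗ[ℝ] ℝ) (ν : V [⋀^Fin (k + 4)]→ₗ[ℝ] ℝ) (Φ : V [⋀^Fin k]→ₗ[ℝ] ℝ)
    (φ : V [⋀^Fin 2]→ₗ[ℝ] W) (v : Module.Basis (Fin (k + 4)) ℝ V) :
    qForm β ν Φ φ = (4 * (k.factorial : ℝ))⁻¹ *
      (altSum v (fun a b c d ↦ β (φ ![a, b]) (φ ![c, d])) Φ / ν v) := by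
  set g := mulTensor β φ.toMultilinearMap φ.toMultilinearMap
  have hwedge : (wedge (LinearMap.mul ℝ ℝ) (wedge β φ φ) Φ).domDomCongr
      (finCongr (by omega : 2 + 2 + k = k + 4)) = (4 * (k.factorial : ℝ))⁻¹ •
      MultilinearMap.alternatization (mulTensorFour g Φ.toMultilinearMap) := by
    rw [wedge_wedge_eq_smul_alternatization, mulTensorFour, alternatization_domDomCongr]
    rfl
  have hg (a b c d : V) : g ![a, b, c, d] = β (φ ![a, b]) (φ ![c, d]) := by
    rw [mulTensor_apply]
    change β (φ _) (φ _) = _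
    congr 3 <;> ext i <;> fin_cases i <;> rfl
  rw [qForm, hwedge, topQuotient_eq _ _ v, AlternatingMap.smul_apply,
    alternatization_mulTensorFour_apply, smul_eq_mul, mul_div_assoc]
  simp only [hg, AlternatingMap.coe_multilinearMap]

lemma alternatingMap_two_swap (φ : V [⋀^Fin 2]→ₗ[ℝ] W) (a b : V) : φ ![a, b] = -φ ![b, a] := by
  rw [← φ.map_swap ![b, a] (show (0 : Fin 2) ≠ 1 by decide)]
  congr 1
  ext i
  fin_cases i <;> rfl

/-- A two-form as a bilinear map of its two arguments. -/
def twoFormBilin (φ : V [⋀^Fin 2]→ₗ[ℝ] W) : V →ₗ[ℝ] V →ₗ[ℝ] W :=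
  LinearMap.mk₂ ℝ (fun a b ↦ φ ![a, b])
    (fun a a' b ↦ by simpa using φ.map_vecCons_add ![b] a a')
    (fun c a b ↦ by simpa using φ.map_vecCons_smul ![b] c a)
    (fun a b b' ↦ by
      rw [alternatingMap_two_swap, alternatingMap_two_swap φ a b, alternatingMap_two_swap φ a b',
        φ.map_vecCons_add ![a] b b', neg_add])
    (fun c a b ↦ by
      rw [alternatingMap_two_swap, alternatingMap_two_swap φ a b, φ.map_vecCons_smul ![a] c b,
        smul_neg])

end LinearAlgebra

section AltSum

variable {ι : Type*} {k : ℕ} (v : Fin (k + 4) → ι) (g h : ι → ι → ι → ι → ℝ)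
  (f : (Fin k → ι) → ℝ)

lemma altSum_congr {v : Fin (k + 4) → ι} {g h : ι → ι → ι → ι → ℝ} {f : (Fin k → ι) → ℝ}
    (H : ∀ a b c d, g a b c d = h a b c d) : altSum v g f = altSum v h f := by
  simp only [altSum, H]

lemma altSum_add : altSum v (fun a b c d ↦ g a b c d + h a b c d) f =
    altSum v g f + altSum v h f := by
  simp only [altSum, add_mul, mul_add, Finset.sum_add_distrib]

lemma altSum_sub : altSum v (fun a b c d ↦ g a b c d - h a b c d) f =
    altSum v g f - altSum v h f := by
  simp only [altSum, sub_mul, mul_sub, Finset.sum_sub_distrib]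

lemma altSum_mul (r : ℝ) : altSum v (fun a b c d ↦ r * g a b c d) f = r * altSum v g f := by
  simp only [altSum, Finset.mul_sum, mul_assoc, mul_left_comm r]

lemma altSum_sum {κ : Type*} [Fintype κ] (g : κ → ι → ι → ι → ι → ℝ) :
    altSum v (fun a b c d ↦ ∑ s, g s a b c d) f = ∑ s, altSum v (g s) f := by
  simp only [altSum, Finset.mul_sum, Finset.sum_mul]
  exact Finset.sum_comm

lemma sum_sign_mul_comp_mul_right {α R : Type*} [Fintype α] [DecidableEq α] [Ring R]
    (p : Equiv.Perm α) (H : Equiv.Perm α → R) :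
    ∑ σ : Equiv.Perm α, ((Equiv.Perm.sign σ : ℤ) : R) * H (σ * p) =
      ((Equiv.Perm.sign p : ℤ) : R) * ∑ σ : Equiv.Perm α, ((Equiv.Perm.sign σ : ℤ) : R) * H σ := by
  rw [Finset.mul_sum]
  refine Fintype.sum_equiv (Equiv.mulRight p) _ _ fun σ ↦ ?_
  rw [Equiv.coe_mulRight, Equiv.Perm.sign_mul, mul_comm (Equiv.Perm.sign σ), Units.val_mul,
    Int.cast_mul, ← mul_assoc, ← mul_assoc, ← Int.cast_mul, Int.units_coe_mul_self, Int.cast_one,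
    one_mul]

lemma altSum_perm (p : Equiv.Perm (Fin 4)) :
    altSum v (fun a b c d ↦ g (![a, b, c, d] (p 0)) (![a, b, c, d] (p 1)) (![a, b, c, d] (p 2))
      (![a, b, c, d] (p 3))) f = ((Equiv.Perm.sign p : ℤ) : ℝ) * altSum v g f := by
  let φ : Fin 4 ↪ Fin (k + 4) := Fin.castLEEmb (by omega)
  have hφ (σ : Equiv.Perm (Fin (k + 4))) (i : Fin 4) :
      ![v (σ 0), v (σ 1), v (σ 2), v (σ 3)] i = v (σ (φ i)) := by
    fin_cases i <;> rfl
  have htail (i : Fin k) : p.viaFintypeEmbedding φ (i.addNat 4) = i.addNat 4 := by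
    refine Equiv.Perm.viaFintypeEmbedding_apply_notMem_range _ _ ?_
    rintro ⟨j, hj⟩
    have := congrArg Fin.val hj
    simp only [φ, Fin.castLEEmb_apply, Fin.val_castLE, Fin.val_addNat] at this
    omega
  rw [← Equiv.Perm.viaFintypeEmbedding_sign p φ, altSum, altSum, ← sum_sign_mul_comp_mul_right]
  refine Finset.sum_congr rfl fun σ _ ↦ ?_
  simp only [hφ, Equiv.Perm.mul_apply, htail]
  simp only [← Equiv.Perm.viaFintypeEmbedding_apply_image]
  rfl

lemma altSum_swap₀₁ : altSum v (fun a b c d ↦ g b a c d) f = -altSum v g f :=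
  (altSum_perm v g f (Equiv.swap 0 1)).trans (by simp)

lemma altSum_swap₁₂ : altSum v (fun a b c d ↦ g a c b d) f = -altSum v g f :=
  (altSum_perm v g f (Equiv.swap 1 2)).trans (by simp)

lemma altSum_swap₁₃ : altSum v (fun a b c d ↦ g a d c b) f = -altSum v g f :=
  (altSum_perm v g f (Equiv.swap 1 3)).trans (by simp)

lemma altSum_swap₂₃ : altSum v (fun a b c d ↦ g a b d c) f = -altSum v g f :=
  (altSum_perm v g f (Equiv.swap 2 3)).trans (by simp)

lemma altSum_rotate₁₂₃ : altSum v (fun a b c d ↦ g a c d b) f = altSum v g f :=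
  (altSum_perm v g f ((Equiv.swap 1 2).trans (Equiv.swap 1 3))).trans (by simp)

lemma altSum_rotate₁₃₂ : altSum v (fun a b c d ↦ g a d b c) f = altSum v g f :=
  (altSum_perm v g f ((Equiv.swap 1 3).trans (Equiv.swap 1 2))).trans (by simp)

lemma altSum_swap_pairs : altSum v (fun a b c d ↦ g c d a b) f = altSum v g f :=
  (altSum_perm v g f ((Equiv.swap 0 2).trans (Equiv.swap 1 3))).trans (by simp)

lemma altSum_rotate : altSum v (fun a b c d ↦ g d a b c) f = -altSum v g f :=
  (altSum_perm v g f (finRotate 4).symm).trans (by simp)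

variable {g}

lemma altSum_eq_zero_of_symm (hg : ∀ a b c d, g b a c d = g a b c d) : altSum v g f = 0 :=
  self_eq_neg.1 <| (altSum_congr fun a b c d ↦ (hg a b c d).symm).trans (altSum_swap₀₁ v g f)

lemma altSum_eq_zero_of_cyclic (hg : ∀ a b c d, g d a b c = g a b c d) : altSum v g f = 0 :=
  self_eq_neg.1 <| (altSum_congr fun a b c d ↦ (hg a b c d).symm).trans (altSum_rotate v g f)

end AltSum

/-! ### Trace pairings and calibrations -/

section Metric

variable {V : Type*} [NormedAddCommGroup V] [InnerProductSpace ℝ V]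
  {W : Type*} [AddCommGroup W] [Module ℝ W]

lemma inv_gram_eq {ι κ : Type*} [Fintype ι] [DecidableEq ι] [Fintype κ]
    (e : OrthonormalBasis κ ℝ V) (v : Module.Basis ι ℝ V) :
    (Matrix.gram ℝ v)⁻¹ = v.toMatrix e * (v.toMatrix e).transpose := by
  classical
  refine Matrix.inv_eq_right_inv ?_
  have hgram : Matrix.gram ℝ v = (e.toBasis.toMatrix v).transpose * e.toBasis.toMatrix v :=
    Matrix.gram_eq_conjTranspose_mul e v
  have hve : v.toMatrix e * e.toBasis.toMatrix v = 1 := by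
    simpa using v.toMatrix_mul_toMatrix_flip e.toBasis
  have hev : e.toBasis.toMatrix v * v.toMatrix e = 1 := by
    simpa using e.toBasis.toMatrix_mul_toMatrix_flip v
  rw [hgram, Matrix.mul_assoc, ← Matrix.mul_assoc _ (v.toMatrix e), hev, Matrix.one_mul,
    ← Matrix.transpose_mul, hve, Matrix.transpose_one]

lemma sum_orthonormalBasis_eq_sum_inv_gram {ι κ : Type*} [Fintype ι] [DecidableEq ι] [Fintype κ]
    (e : OrthonormalBasis κ ℝ V) (v : Module.Basis ι ℝ V) (B : V →ₗ[ℝ] V →ₗ[ℝ] ℝ) :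
    ∑ a, B (e a) (e a) = ∑ i, ∑ j, (Matrix.gram ℝ v)⁻¹ i j * B (v i) (v j) := by
  have hB (a : κ) : B (e a) (e a) =
      ∑ i, ∑ j, v.toMatrix e i a * v.toMatrix e j a * B (v i) (v j) := by
    have he : e a = ∑ i, v.toMatrix e i a • v i := (v.sum_repr (e a)).symm
    conv_lhs => rw [he]
    simp only [map_sum, LinearMap.sum_apply, map_smul, LinearMap.smul_apply, smul_eq_mul,
      Finset.mul_sum, mul_assoc]
    rw [Finset.sum_comm]
    exact Finset.sum_congr rfl fun i _ ↦ Finset.sum_congr rfl fun j _ ↦ mul_left_comm _ _ _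
  simp only [hB, inv_gram_eq e v, Matrix.mul_apply, Matrix.transpose_apply, Finset.sum_mul]
  rw [Finset.sum_comm]
  exact Finset.sum_congr rfl fun i _ ↦ Finset.sum_comm

lemma sum_sum_Ioi_eq_half {ι : Type*} [Fintype ι] [LinearOrder ι] [LocallyFiniteOrderTop ι]
    [LocallyFiniteOrderBot ι] (f : ι → ι → ℝ) (hs : ∀ i j, f i j = f j i) (h0 : ∀ i, f i i = 0) :
    ∑ i, ∑ j ∈ Finset.Ioi i, f i j = (1 / 2) * ∑ i, ∑ j, f i j := by
  have htwo : ∑ i, ∑ j ∈ Finset.Ioi i, (f j i + f i j) = ∑ i, ∑ j, f i j := by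
    rw [Finset.sum_sum_Ioi_add_eq_sum_sum_off_diag]
    refine Finset.sum_congr rfl fun i _ ↦ ?_
    rw [← Finset.sum_compl_add_sum {i} (f i), Finset.sum_singleton, h0, add_zero]
    exact Finset.sum_congr rfl fun j _ ↦ hs j i
  rw [← htwo, Finset.mul_sum]
  refine Finset.sum_congr rfl fun i _ ↦ ?_
  rw [Finset.mul_sum]
  exact Finset.sum_congr rfl fun j _ ↦ by rw [hs j i]; ring

variable [Module.Finite ℝ V]

lemma normSqForm_eq_half_sum (β : W →ₗ[ℝ] W →ₗ[ℝ] ℝ) (φ : V [⋀^Fin 2]→ₗ[ℝ] W) :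
    normSqForm β φ = (1 / 2) * ∑ i, ∑ j,
      β (φ ![stdOrthonormalBasis ℝ V i, stdOrthonormalBasis ℝ V j])
        (φ ![stdOrthonormalBasis ℝ V i, stdOrthonormalBasis ℝ V j]) := by
  refine sum_sum_Ioi_eq_half _ (fun i j ↦ ?_) fun i ↦ ?_
  · rw [alternatingMap_two_swap]
    simp
  · have : φ ![stdOrthonormalBasis ℝ V i, stdOrthonormalBasis ℝ V i] = 0 :=
      φ.map_eq_zero_of_eq _ (i := 0) (j := 1) rfl (by decide)
    simp [this]

lemma normSqForm_eq_sum_inv_gram {ι : Type*} [Fintype ι] [DecidableEq ι]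
    (β : W →ₗ[ℝ] W →ₗ[ℝ] ℝ) (φ : V [⋀^Fin 2]→ₗ[ℝ] W) (v : Module.Basis ι ℝ V) :
    normSqForm β φ = (1 / 2) * ∑ i, ∑ j, ∑ p, ∑ q, (Matrix.gram ℝ v)⁻¹ i j *
      ((Matrix.gram ℝ v)⁻¹ p q * β (φ ![v i, v p]) (φ ![v j, v q])) := by
  set e := stdOrthonormalBasis ℝ V
  set G := (Matrix.gram ℝ v)⁻¹
  have hfst (p q) : ∑ a, β (φ ![e a, v p]) (φ ![e a, v q]) =
      ∑ i, ∑ j, G i j * β (φ ![v i, v p]) (φ ![v j, v q]) :=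
    sum_orthonormalBasis_eq_sum_inv_gram e v
      (β.compl₁₂ ((twoFormBilin φ).flip (v p)) ((twoFormBilin φ).flip (v q)))
  have hsnd (a) : ∑ b, β (φ ![e a, e b]) (φ ![e a, e b]) =
      ∑ p, ∑ q, G p q * β (φ ![e a, v p]) (φ ![e a, v q]) :=
    sum_orthonormalBasis_eq_sum_inv_gram e v
      (β.compl₁₂ (twoFormBilin φ (e a)) (twoFormBilin φ (e a)))
  rw [normSqForm_eq_half_sum]
  congr 1
  calc ∑ a, ∑ b, β (φ ![e a, e b]) (φ ![e a, e b])
    _ = ∑ p, ∑ q, G p q * ∑ a, β (φ ![e a, v p]) (φ ![e a, v q]) := by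
        simp only [hsnd, Finset.mul_sum]
        rw [Finset.sum_comm]
        exact Finset.sum_congr rfl fun p _ ↦ Finset.sum_comm
    _ = ∑ p, ∑ q, ∑ i, ∑ j, G i j * (G p q * β (φ ![v i, v p]) (φ ![v j, v q])) := by
        simp only [hfst, Finset.mul_sum, mul_left_comm]
    _ = ∑ i, ∑ j, ∑ p, ∑ q, G i j * (G p q * β (φ ![v i, v p]) (φ ![v j, v q])) := by
        rw [Finset.sum_congr rfl fun p _ ↦ Finset.sum_comm, Finset.sum_comm]
        refine Finset.sum_congr rfl fun i _ ↦ ?_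
        rw [Finset.sum_congr rfl fun p _ ↦ Finset.sum_comm, Finset.sum_comm]

end Metric

section Trace

variable {U : Type*}

lemma trace_restrictScalars [AddCommGroup U] [Module ℂ U] [Module ℝ U] [IsScalarTower ℝ ℂ U]
    [FiniteDimensional ℂ U] (T : U →ₗ[ℂ] U) :
    LinearMap.trace ℝ U (T.restrictScalars ℝ) = 2 * (LinearMap.trace ℂ U T).re := by
  classical
  let b := Module.finBasis ℂ U
  rw [LinearMap.trace_eq_matrix_trace ℂ b, LinearMap.trace_eq_matrix_trace ℝ
    (Complex.basisOneI.smulTower b), Matrix.trace, Matrix.trace, Fintype.sum_prod_type,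
    Fin.sum_univ_two]
  simp only [LinearMap.toMatrix_apply, Module.Basis.smulTower_repr, Module.Basis.smulTower_apply,
    Matrix.diag_apply, LinearMap.coe_restrictScalars, Complex.coe_basisOneI, Matrix.cons_val_zero,
    Matrix.cons_val_one, one_smul, map_smul, Complex.coe_basisOneI_repr, Finsupp.smul_apply,
    smul_eq_mul, Complex.I_mul_im, Complex.re_sum]
  ring

variable [NormedAddCommGroup U] [InnerProductSpace ℂ U] [FiniteDimensional ℂ U]

lemma tracePairing_eq (A B : U →ₗ[ℂ] U) :
    tracePairing U A B =
      -(1 / 2) * LinearMap.trace ℝ U (A.restrictScalars ℝ ∘ₗ B.restrictScalars ℝ) := by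
  have h : LinearMap.trace ℝ U (A.restrictScalars ℝ ∘ₗ B.restrictScalars ℝ) =
      2 * (LinearMap.trace ℂ U (A ∘ₗ B)).re := trace_restrictScalars (A ∘ₗ B)
  simp [h, tracePairing]

lemma tracePairing_eq_sum_of_skew (A B : U →ₗ[ℂ] U)
    (hB : ∀ x y : U, inner ℝ (B x) y = -inner ℝ x (B y))
    {ι : Type*} [Fintype ι] (f : OrthonormalBasis ι ℝ U) :
    tracePairing U A B =
      ∑ s : ι × ι, (1 / 2) * (inner ℝ (f s.1) (A (f s.2)) * inner ℝ (f s.1) (B (f s.2))) := by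
  rw [tracePairing_eq, LinearMap.trace_eq_sum_inner _ f, Fintype.sum_prod_type, Finset.mul_sum]
  refine Finset.sum_congr rfl fun i _ ↦ ?_
  have hexpand : B (f i) = ∑ j, inner ℝ (f j) (B (f i)) • f j := (f.sum_repr' (B (f i))).symm
  have hskew (j : ι) : inner ℝ (f j) (B (f i)) = -inner ℝ (f i) (B (f j)) := by
    rw [← real_inner_comm (f i), hB, neg_neg]
  change -(1 / 2) * inner ℝ (f i) (A.restrictScalars ℝ (B (f i))) = _
  rw [hexpand, map_sum, inner_sum, Finset.mul_sum]
  refine Finset.sum_congr rfl fun j _ ↦ ?_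
  rw [map_smul, inner_smul_right, hskew j, LinearMap.restrictScalars_apply]
  ring

/-- The matrix entry `A ↦ ⟨u, A w⟩` as a linear functional. -/
def matrixEntry (u w : U) : (U →ₗ[ℂ] U) →ₗ[ℝ] ℝ where
  toFun A := inner ℝ u (A w)
  map_add' A B := by simp [inner_add_right]
  map_smul' c A := by simp [inner_smul_right]

-- In an orthonormal basis, both sides are half the sum over the matrix entries of `φ`, which are
-- real two-forms.
lemma qForm_le_normSqForm_of_skew {V : Type*} [NormedAddCommGroup V] [InnerProductSpace ℝ V]
    [Module.Finite ℝ V] {k : ℕ} [hn : Fact (Module.finrank ℝ V = k + 4)]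
    (ν : V [⋀^Fin (k + 4)]→ₗ[ℝ] ℝ) (Φ : V [⋀^Fin k]→ₗ[ℝ] ℝ)
    (h : ∀ φ : V [⋀^Fin 2]→ₗ[ℝ] ℝ,
      qForm (LinearMap.mul ℝ ℝ) ν Φ φ ≤ normSqForm (LinearMap.mul ℝ ℝ) φ)
    (φ : V [⋀^Fin 2]→ₗ[ℝ] (U →ₗ[ℂ] U))
    (hφ : ∀ v x y, inner ℝ (φ v x) y = -inner ℝ x (φ v y)) :
    qForm (tracePairing U) ν Φ φ ≤ normSqForm (tracePairing U) φ := by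
  let f := stdOrthonormalBasis ℝ U
  let φ' (s : Fin (Module.finrank ℝ U) × Fin (Module.finrank ℝ U)) : V [⋀^Fin 2]→ₗ[ℝ] ℝ :=
    (matrixEntry (f s.1) (f s.2)).compAlternatingMap φ
  have hβ (v w) : tracePairing U (φ v) (φ w) =
      ∑ s, (1 / 2) * LinearMap.mul ℝ ℝ (φ' s v) (φ' s w) :=
    tracePairing_eq_sum_of_skew _ _ (hφ w) f
  have hq : qForm (tracePairing U) ν Φ φ =
      ∑ s, (1 / 2) * qForm (LinearMap.mul ℝ ℝ) ν Φ (φ' s) := by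
    have v := Module.finBasisOfFinrankEq ℝ V hn.out
    simp only [qForm_eq_altSum _ _ _ _ v, hβ, altSum_sum, altSum_mul, Finset.sum_div,
      Finset.mul_sum]
    exact Finset.sum_congr rfl fun s _ ↦ by ring
  have hs : normSqForm (tracePairing U) φ =
      ∑ s, (1 / 2) * normSqForm (LinearMap.mul ℝ ℝ) (φ' s) := by
    simp only [normSqForm, hβ, Finset.mul_sum]
    rw [Finset.sum_comm]
    exact Finset.sum_congr rfl fun i _ ↦ Finset.sum_comm
  rw [hq, hs]
  gcongr with s
  exact h (φ' s)

end Trace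

/-! ### Chern-Simons forms and transgression -/

section ChernSimons

variable {ι : Type*} {R : Type*} [NormedRing R] [NormedAlgebra ℝ R]
  {V : Type*} [NormedAddCommGroup V] [NormedSpace ℝ V]

/-- The antisymmetrization of a three-tensor, without the factor `1 / 3!`. -/
def antisymmThree (g : ι → ι → ι → ℝ) (a b c : ι) : ℝ :=
  g a b c + g b c a + g c a b - g b a c - g a c b - g c b a

/-- The transgression three-tensor `tr(a ∧ (F + F')) - tr(a ∧ a ∧ a) / 3` of two connections that
differ by `a` and have curvatures `F` and `F'`, up to antisymmetrization. -/
def transgression (τ : R →L[ℝ] ℝ) (a : ι → R) (F F' : ι → ι → R) (i j l : ι) : ℝ :=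
  (1 / 2) * τ (a i * (F j l + F' j l)) - (1 / 3) * τ (a i * a j * a l)

/-- The components of the curvature of the connection `d + A`, where `dA i j` is `∂ᵢ Aⱼ`. -/
def curvatureComp (A : ι → R) (dA : ι → ι → R) (i j : ι) : R :=
  dA i j - dA j i + (A i * A j - A j * A i)

/-- The components of the Chern-Simons form, where `dA i j` is `∂ᵢ Aⱼ`. -/
def chernSimons (τ : R →L[ℝ] ℝ) (A : ι → R) (dA : ι → ι → R) (i j l : ι) : ℝ :=
  τ (A i * dA j l) + (2 / 3) * τ (A i * A j * A l)

-- The extra terms on the right are the components of the exact form `d tr(A ∧ a)`.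
lemma antisymmThree_transgression (τ : R →L[ℝ] ℝ) (hτ : ∀ x y, τ (x * y) = τ (y * x))
    (A a : ι → R) (dA da : ι → ι → R) (i j l : ι) :
    antisymmThree (transgression τ a (curvatureComp A dA) (curvatureComp (A + a) (dA + da)))
        i j l =
      antisymmThree (fun i j l ↦ chernSimons τ (A + a) (dA + da) i j l -
        chernSimons τ A dA i j l + (τ (dA i j * a l) + τ (A j * da i l))) i j l := by
  have hAAa (i j l) : τ (A i * A j * a l) = τ (a l * A i * A j) := by rw [hτ, mul_assoc]
  have hAaA (i j l) : τ (A i * a j * A l) = τ (a j * A l * A i) := by rw [mul_assoc, hτ]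
  have haAa (i j l) : τ (a i * A j * a l) = τ (A j * a l * a i) := by rw [mul_assoc, hτ]
  have haaA (i j l) : τ (a i * a j * A l) = τ (A l * a i * a j) := by rw [hτ, mul_assoc]
  have hdAa (i j l) : τ (dA i j * a l) = τ (a l * dA i j) := hτ _ _
  simp only [antisymmThree, transgression, curvatureComp, chernSimons, Pi.add_apply, mul_add,
    add_mul, mul_sub, map_add, map_sub, ← mul_assoc, hAAa, hAaA, haAa, haaA, hdAa]
  ring

/-- The derivative of `g` in the direction `e i`. -/
def partialDeriv (e : ι → V) {W : Type*} [NormedAddCommGroup W] [NormedSpace ℝ W] (i : ι)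
    (g : V → W) (y : V) : W :=
  fderiv ℝ g y (e i)

section PartialDeriv

variable {e : ι → V} {y : V} {W : Type*} [NormedAddCommGroup W] [NormedSpace ℝ W]

lemma partialDeriv_add {g h : V → W} (hg : DifferentiableAt ℝ g y)
    (hh : DifferentiableAt ℝ h y) (i : ι) :
    partialDeriv e i (fun y ↦ g y + h y) y = partialDeriv e i g y + partialDeriv e i h y := by
  rw [partialDeriv, fderiv_fun_add hg hh]
  rfl

lemma partialDeriv_sub {g h : V → W} (hg : DifferentiableAt ℝ g y)
    (hh : DifferentiableAt ℝ h y) (i : ι) :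
    partialDeriv e i (fun y ↦ g y - h y) y = partialDeriv e i g y - partialDeriv e i h y := by
  rw [partialDeriv, fderiv_fun_sub hg hh]
  rfl

lemma partialDeriv_mul {g h : V → R} (hg : DifferentiableAt ℝ g y)
    (hh : DifferentiableAt ℝ h y) (i : ι) :
    partialDeriv e i (fun y ↦ g y * h y) y =
      partialDeriv e i g y * h y + g y * partialDeriv e i h y := by
  rw [partialDeriv, fderiv_fun_mul' hg hh]
  simp [partialDeriv, add_comm]

lemma partialDeriv_clm_comp {W' : Type*} [NormedAddCommGroup W'] [NormedSpace ℝ W']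
    (τ : W →L[ℝ] W') {g : V → W} (hg : DifferentiableAt ℝ g y) (i : ι) :
    partialDeriv e i (fun y ↦ τ (g y)) y = τ (partialDeriv e i g y) :=
  congrArg (· (e i)) (τ.hasFDerivAt.comp y hg.hasFDerivAt).fderiv

lemma partialDeriv_const_mul {g : V → ℝ} (hg : DifferentiableAt ℝ g y) (c : ℝ) (i : ι) :
    partialDeriv e i (fun y ↦ c * g y) y = c * partialDeriv e i g y := by
  rw [partialDeriv, fderiv_const_mul hg]
  rfl

lemma differentiableAt_partialDeriv {g : V → W} (hg : ContDiffAt ℝ 2 g y) (i : ι) :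
    DifferentiableAt ℝ (partialDeriv e i g) y :=
  ((hg.fderiv_right (m := 1) (by norm_num)).differentiableAt (by norm_num)).clm_apply
    (differentiableAt_const _)

lemma partialDeriv_comm {g : V → W} (hg : ContDiffAt ℝ 2 g y) (i j : ι) :
    partialDeriv e i (partialDeriv e j g) y = partialDeriv e j (partialDeriv e i g) y := by
  have hdiff : DifferentiableAt ℝ (fderiv ℝ g) y :=
    (hg.fderiv_right (m := 1) (by norm_num)).differentiableAt (by norm_num)
  have hsecond (i j) : partialDeriv e i (partialDeriv e j g) y =
      fderiv ℝ (fderiv ℝ g) y (e i) (e j) := by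
    change fderiv ℝ (fun y ↦ fderiv ℝ g y (e j)) y (e i) = _
    rw [fderiv_clm_apply hdiff (differentiableAt_const _)]
    simp
  rw [hsecond, hsecond]
  exact (hg.isSymmSndFDerivAt (by simp)) (e i) (e j)

end PartialDeriv

variable {e : ι → V} {y : V} {k : ℕ} (v : Fin (k + 4) → ι) (f : (Fin k → ι) → ℝ)

lemma altSum_partialDeriv_antisymmThree (g : ι → ι → ι → V → ℝ)
    (hg : ∀ a b c, DifferentiableAt ℝ (g a b c) y) :
    altSum v (fun i a b c ↦
        partialDeriv e i (fun y ↦ antisymmThree (fun a b c ↦ g a b c y) a b c) y) f =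
      6 * altSum v (fun i a b c ↦ partialDeriv e i (g a b c) y) f := by
  set G : ι → ι → ι → ι → ℝ := fun i a b c ↦ partialDeriv e i (g a b c) y
  have hG (i a b c) :
      partialDeriv e i (fun y ↦ antisymmThree (fun a b c ↦ g a b c y) a b c) y =
        G i a b c + G i b c a + G i c a b - G i b a c - G i a c b - G i c b a := by
    simp only [antisymmThree, G]
    rw [partialDeriv_sub (by fun_prop) (by fun_prop), partialDeriv_sub (by fun_prop) (by fun_prop),
      partialDeriv_sub (by fun_prop) (by fun_prop), partialDeriv_add (by fun_prop) (by fun_prop),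
      partialDeriv_add (by fun_prop) (by fun_prop)]
  simp only [hG, altSum_sub, altSum_add]
  rw [altSum_rotate₁₂₃ v G f, altSum_rotate₁₃₂ v G f, altSum_swap₁₂ v G f, altSum_swap₂₃ v G f,
    altSum_swap₁₃ v G f]
  ring

/-- The curvature components at `y` of the connection `d + ∑ᵢ Aᵢ dxⁱ` with respect to the
directions `e i`. -/
def curvatureAt (e : ι → V) (A : ι → V → R) (y : V) : ι → ι → R :=
  curvatureComp (fun i ↦ A i y) (fun i j ↦ partialDeriv e i (A j) y)

/-- The Chern-Simons components at `y` of the connection `d + ∑ᵢ Aᵢ dxⁱ` with respect to the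
directions `e i`. -/
def chernSimonsAt (e : ι → V) (τ : R →L[ℝ] ℝ) (A : ι → V → R) (y : V) : ι → ι → ι → ℝ :=
  chernSimons τ (fun i ↦ A i y) (fun i j ↦ partialDeriv e i (A j) y)

variable {τ : R →L[ℝ] ℝ} {A A' : ι → V → R}

lemma differentiableAt_curvatureAt (hA : ∀ i, ContDiffAt ℝ 2 (A i) y) (a b : ι) :
    DifferentiableAt ℝ (fun y ↦ curvatureAt e A y a b) y := by
  have hd (i) : DifferentiableAt ℝ (A i) y := (hA i).differentiableAt (by norm_num)
  have hdd (i j) : DifferentiableAt ℝ (partialDeriv e i (A j)) y :=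
    differentiableAt_partialDeriv (hA j) i
  exact ((hdd a b).sub (hdd b a)).add (((hd a).mul (hd b)).sub ((hd b).mul (hd a)))

lemma differentiableAt_chernSimonsAt (hA : ∀ i, ContDiffAt ℝ 2 (A i) y) (a b c : ι) :
    DifferentiableAt ℝ (fun y ↦ chernSimonsAt e τ A y a b c) y := by
  have hd (i) : DifferentiableAt ℝ (A i) y := (hA i).differentiableAt (by norm_num)
  have hdd : DifferentiableAt ℝ (partialDeriv e b (A c)) y :=
    differentiableAt_partialDeriv (hA c) b
  exact (τ.differentiableAt.comp y ((hd a).mul hdd)).add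
    ((τ.differentiableAt.comp y (((hd a).mul (hd b)).mul (hd c))).const_mul _)

lemma differentiableAt_transgression_curvatureAt (hA : ∀ i, ContDiffAt ℝ 2 (A i) y)
    (hA' : ∀ i, ContDiffAt ℝ 2 (A' i) y) (a b c : ι) :
    DifferentiableAt ℝ (fun y ↦ transgression τ (fun i ↦ A' i y - A i y) (curvatureAt e A y)
      (curvatureAt e A' y) a b c) y := by
  have hd (i) : DifferentiableAt ℝ (fun y ↦ A' i y - A i y) y :=
    ((hA' i).sub (hA i)).differentiableAt (by norm_num)
  refine ((τ.differentiableAt.comp y ((hd a).mul ?_)).const_mul _).sub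
    ((τ.differentiableAt.comp y (((hd a).mul (hd b)).mul (hd c))).const_mul _)
  exact (differentiableAt_curvatureAt hA b c).add (differentiableAt_curvatureAt hA' b c)

lemma partialDeriv_chernSimonsAt (hτ : ∀ x y, τ (x * y) = τ (y * x))
    (hA : ∀ i, ContDiffAt ℝ 2 (A i) y) (i a b c : ι) :
    partialDeriv e i (fun y ↦ chernSimonsAt e τ A y a b c) y =
      τ (partialDeriv e i (A a) y * partialDeriv e b (A c) y) +
        τ (A a y * partialDeriv e i (partialDeriv e b (A c)) y) +
        (2 / 3) * (τ (partialDeriv e i (A a) y * A b y * A c y) +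
          τ (partialDeriv e i (A b) y * A c y * A a y) +
          τ (partialDeriv e i (A c) y * A a y * A b y)) := by
  have hd (i) : DifferentiableAt ℝ (A i) y := (hA i).differentiableAt (by norm_num)
  have hdd : DifferentiableAt ℝ (partialDeriv e b (A c)) y :=
    differentiableAt_partialDeriv (hA c) b
  have hquad : DifferentiableAt ℝ (fun y ↦ A a y * partialDeriv e b (A c) y) y :=
    (hd a).mul hdd
  have hcubic : DifferentiableAt ℝ (fun y ↦ A a y * A b y * A c y) y :=
    ((hd a).mul (hd b)).mul (hd c)
  have hcyc (x y z : R) : τ (x * y * z) = τ (y * z * x) := by rw [mul_assoc, hτ]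
  have hτquad : DifferentiableAt ℝ (fun y ↦ τ (A a y * partialDeriv e b (A c) y)) y :=
    τ.differentiableAt.comp y hquad
  have hτcubic : DifferentiableAt ℝ (fun y ↦ τ (A a y * A b y * A c y)) y :=
    τ.differentiableAt.comp y hcubic
  simp only [chernSimonsAt, chernSimons]
  rw [partialDeriv_add hτquad (hτcubic.const_mul _), partialDeriv_const_mul hτcubic,
    partialDeriv_clm_comp τ hquad, partialDeriv_clm_comp τ hcubic, partialDeriv_mul (hd a) hdd,
    partialDeriv_mul ((hd a).fun_mul (hd b)) (hd c), partialDeriv_mul (hd a) (hd b), add_mul,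
    map_add, map_add, map_add, hcyc (A a y), ← hcyc _ (A a y) (A b y)]

-- `tr(F ∧ F)` reduces to `4 tr(dA ∧ dA) + 8 tr(dA ∧ A ∧ A)`, as `tr(A ∧ A ∧ A ∧ A)` changes sign
-- under the cyclic permutation that fixes its trace.
lemma altSum_curvatureComp_mul (hτ : ∀ x y, τ (x * y) = τ (y * x)) (B : ι → R)
    (dB : ι → ι → R) :
    altSum v (fun a b c d ↦ τ (curvatureComp B dB a b * curvatureComp B dB c d)) f =
      4 * (altSum v (fun a b c d ↦ τ (dB a b * dB c d)) f +
        2 * altSum v (fun a b c d ↦ τ (dB a b * B c * B d)) f) := by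
  let G (i j : ι) : R := dB i j + B i * B j
  let Q (a b c d : ι) : ℝ := τ (G a b * G c d)
  let M (i j p q : ι) : ℝ := τ (dB i j * B p * B q)
  have hF (a b c d) : τ (curvatureComp B dB a b * curvatureComp B dB c d) =
      Q a b c d - Q b a c d - Q a b d c + Q b a d c := by
    have hG (a b) : curvatureComp B dB a b = G a b - G b a := by
      simp only [curvatureComp, G]
      abel
    rw [hG, hG]
    simp only [Q, mul_sub, sub_mul, map_sub]
    ring
  have hQ (a b c d) : Q a b c d = τ (dB a b * dB c d) + M a b c d + M c d a b +
      τ (B a * B b * B c * B d) := by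
    simp only [Q, G, M, mul_add, add_mul, map_add, ← mul_assoc]
    rw [mul_assoc (dB c d), hτ (dB c d) (B a * B b)]
    ring
  have hquartic : altSum v (fun a b c d ↦ τ (B a * B b * B c * B d)) f = 0 :=
    altSum_eq_zero_of_cyclic v f fun a b c d ↦ by
      rw [hτ _ (B d)]
      simp only [mul_assoc]
  have hQsum : altSum v Q f = altSum v (fun a b c d ↦ τ (dB a b * dB c d)) f +
      2 * altSum v M f := by
    rw [altSum_congr hQ]
    simp only [altSum_add]
    rw [altSum_swap_pairs v M f, hquartic]
    ring
  simp only [hF, altSum_sub, altSum_add]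
  rw [altSum_swap₂₃ v (fun a b c d ↦ Q b a c d) f, altSum_swap₀₁ v Q f, altSum_swap₂₃ v Q f,
    hQsum]
  ring

lemma altSum_partialDeriv_chernSimonsAt (hτ : ∀ x y, τ (x * y) = τ (y * x))
    (hA : ∀ i, ContDiffAt ℝ 2 (A i) y) :
    altSum v (fun i a b c ↦ partialDeriv e i (fun y ↦ chernSimonsAt e τ A y a b c) y) f =
      (1 / 4) * altSum v (fun a b c d ↦
        τ (curvatureAt e A y a b * curvatureAt e A y c d)) f := by
  let M (i a b c : ι) : ℝ := τ (partialDeriv e i (A a) y * A b y * A c y)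
  have hsecond : altSum v (fun i a b c ↦
      τ (A a y * partialDeriv e i (partialDeriv e b (A c)) y)) f = 0 := by
    rw [altSum_swap₁₂ v
      (fun i a b c ↦ τ (A b y * partialDeriv e i (partialDeriv e a (A c)) y)) f, neg_eq_zero]
    exact altSum_eq_zero_of_symm v f fun i a b c ↦ by rw [partialDeriv_comm (hA c)]
  simp only [partialDeriv_chernSimonsAt hτ hA, altSum_add, altSum_mul, hsecond]
  rw [altSum_rotate₁₂₃ v M f, altSum_rotate₁₃₂ v M f]
  simp only [curvatureAt, altSum_curvatureComp_mul v f hτ, M]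
  ring

lemma antisymmThree_transgression_curvatureAt (hτ : ∀ x y, τ (x * y) = τ (y * x))
    (hA : ∀ i, DifferentiableAt ℝ (A i) y) (hA' : ∀ i, DifferentiableAt ℝ (A' i) y)
    (a b c : ι) :
    antisymmThree (transgression τ (fun i ↦ A' i y - A i y) (curvatureAt e A y)
        (curvatureAt e A' y)) a b c =
      antisymmThree (fun a b c ↦ chernSimonsAt e τ A' y a b c - chernSimonsAt e τ A y a b c +
        partialDeriv e a (fun y ↦ τ (A b y * (A' c y - A c y))) y) a b c := by
  have key := antisymmThree_transgression τ hτ (fun i ↦ A i y) (fun i ↦ A' i y - A i y)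
    (fun i j ↦ partialDeriv e i (A j) y)
    (fun i j ↦ partialDeriv e i (A' j) y - partialDeriv e i (A j) y) a b c
  have hsum : ((fun i ↦ A i y) + fun i ↦ A' i y - A i y) = fun i ↦ A' i y := by
    ext i
    simp
  have hdsum : ((fun i j ↦ partialDeriv e i (A j) y) +
      fun i j ↦ partialDeriv e i (A' j) y - partialDeriv e i (A j) y) =
        fun i j ↦ partialDeriv e i (A' j) y := by
    ext i
    simp
  have hexact (a b c) : partialDeriv e a (fun y ↦ τ (A b y * (A' c y - A c y))) y =
      τ (partialDeriv e a (A b) y * (A' c y - A c y)) +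
        τ (A b y * (partialDeriv e a (A' c) y - partialDeriv e a (A c) y)) := by
    have hsub : DifferentiableAt ℝ (fun y ↦ A' c y - A c y) y := (hA' c).sub (hA c)
    rw [partialDeriv_clm_comp τ ((hA b).fun_mul hsub), partialDeriv_mul (hA b) hsub, map_add,
      partialDeriv_sub (hA' c) (hA c)]
  rw [hsum, hdsum] at key
  simp only [hexact]
  exact key

-- The transgression form differs from the difference of the Chern-Simons forms by an exact form.
lemma altSum_partialDeriv_transgression [Finite ι] (hτ : ∀ x y, τ (x * y) = τ (y * x))
    (hA : ∀ i, ContDiffAt ℝ 2 (A i) y) (hA' : ∀ i, ContDiffAt ℝ 2 (A' i) y) :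
    altSum v (fun i a b c ↦ partialDeriv e i (fun y ↦ transgression τ (fun i ↦ A' i y - A i y)
        (curvatureAt e A y) (curvatureAt e A' y) a b c) y) f =
      (1 / 4) *
        (altSum v (fun a b c d ↦ τ (curvatureAt e A' y a b * curvatureAt e A' y c d)) f -
          altSum v (fun a b c d ↦ τ (curvatureAt e A y a b * curvatureAt e A y c d)) f) := by
  let P (a b c : ι) : V → ℝ := partialDeriv e a (fun y ↦ τ (A b y * (A' c y - A c y)))
  have hprod (b c) : ContDiffAt ℝ 2 (fun y ↦ τ (A b y * (A' c y - A c y))) y :=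
    τ.contDiff.contDiffAt.comp y ((hA b).mul ((hA' c).sub (hA c)))
  have hP (a b c) : DifferentiableAt ℝ (P a b c) y := differentiableAt_partialDeriv (hprod b c) a
  have hC (a b c) : DifferentiableAt ℝ (fun y ↦ chernSimonsAt e τ A y a b c) y :=
    differentiableAt_chernSimonsAt hA a b c
  have hC' (a b c) : DifferentiableAt ℝ (fun y ↦ chernSimonsAt e τ A' y a b c) y :=
    differentiableAt_chernSimonsAt hA' a b c
  have hdiff : ∀ᶠ z in 𝓝 y, ∀ i, DifferentiableAt ℝ (A i) z ∧ DifferentiableAt ℝ (A' i) z :=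
    Filter.eventually_all.2 fun i ↦ (((hA i).eventually (by simp)).and
      ((hA' i).eventually (by simp))).mono fun z hz ↦
        ⟨hz.1.differentiableAt (by norm_num), hz.2.differentiableAt (by norm_num)⟩
  have hexact : altSum v (fun i a b c ↦ partialDeriv e i (P a b c) y) f = 0 :=
    altSum_eq_zero_of_symm v f fun i a b c ↦ partialDeriv_comm (hprod b c) _ _
  refine mul_left_cancel₀ (by norm_num : (6 : ℝ) ≠ 0) ?_
  calc
    _ = altSum v (fun i a b c ↦ partialDeriv e i (fun y ↦ antisymmThree (fun a b c ↦
          transgression τ (fun i ↦ A' i y - A i y) (curvatureAt e A y) (curvatureAt e A' y)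
            a b c) a b c) y) f :=
      (altSum_partialDeriv_antisymmThree v f _
        (differentiableAt_transgression_curvatureAt hA hA')).symm
    _ = altSum v (fun i a b c ↦ partialDeriv e i (fun y ↦ antisymmThree (fun a b c ↦
          chernSimonsAt e τ A' y a b c - chernSimonsAt e τ A y a b c + P a b c y) a b c) y) f := by
      refine altSum_congr fun i a b c ↦
        congrArg (fun L : V →L[ℝ] ℝ ↦ L (e i)) (Filter.EventuallyEq.fderiv_eq ?_)
      filter_upwards [hdiff] with z hz
      exact antisymmThree_transgression_curvatureAt hτ (fun i ↦ (hz i).1) (fun i ↦ (hz i).2) a b c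
    _ = _ := by
      rw [altSum_partialDeriv_antisymmThree v f (fun a b c y ↦
        chernSimonsAt e τ A' y a b c - chernSimonsAt e τ A y a b c + P a b c y)
        fun a b c ↦ ((hC' a b c).sub (hC a b c)).add (hP a b c)]
      simp only [partialDeriv_add ((hC' _ _ _).fun_sub (hC _ _ _)) (hP _ _ _),
        partialDeriv_sub (hC' _ _ _) (hC _ _ _), altSum_add, altSum_sub, hexact,
        altSum_partialDeriv_chernSimonsAt v f hτ hA,
        altSum_partialDeriv_chernSimonsAt v f hτ hA']
      ring

end ChernSimons

/-! ### Integration by parts against a closed form -/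

section Stokes

variable {V : Type*} [NormedAddCommGroup V] [NormedSpace ℝ V]

/-- The embedding of the indices `0, 4, 5, …, k + 3`: the direction of differentiation, followed by
the arguments of a `k`-form. -/
def zeroTail (k : ℕ) : Fin (k + 1) ↪ Fin (k + 4) where
  toFun := Fin.cons 0 fun i ↦ i.addNat 4
  inj' := by
    rw [Fin.cons_injective_iff]
    refine ⟨?_, fun i j h ↦ by simpa using h⟩
    rintro ⟨i, hi⟩
    simp [Fin.ext_iff] at hi

lemma castLE_notMem_range_zeroTail {k : ℕ} {j : Fin 4} (hj : j ≠ 0) :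
    Fin.castLE (Nat.le_add_left 4 k) j ∉ Set.range (zeroTail k) := by
  rintro ⟨i, hi⟩
  cases i using Fin.cases with
  | zero => exact hj (Fin.ext (congrArg Fin.val hi).symm)
  | succ i =>
    have hval : (i : ℕ) + 4 = j := congrArg Fin.val hi
    omega

/-- The permutation of `Fin (k + 4)` that moves the index at place `r` of `0, 4, 5, …, k + 3` to
the front and fixes `1`, `2` and `3`. -/
def zeroTailCycle {k : ℕ} (r : Fin (k + 1)) : Equiv.Perm (Fin (k + 4)) :=
  Equiv.Perm.viaFintypeEmbedding r.cycleRange.symm (zeroTail k)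

lemma zeroTailCycle_zero {k : ℕ} (r : Fin (k + 1)) : zeroTailCycle r 0 = zeroTail k r := by
  have h := Equiv.Perm.viaFintypeEmbedding_apply_image r.cycleRange.symm (zeroTail k) 0
  rwa [Fin.cycleRange_symm_zero] at h

lemma zeroTailCycle_addNat {k : ℕ} (r : Fin (k + 1)) (i : Fin k) :
    zeroTailCycle r (i.addNat 4) = zeroTail k (r.succAbove i) := by
  have h := Equiv.Perm.viaFintypeEmbedding_apply_image r.cycleRange.symm (zeroTail k) i.succ
  rwa [Fin.cycleRange_symm_succ] at h

lemma zeroTailCycle_castLE {k : ℕ} (r : Fin (k + 1)) {j : Fin 4} (hj : j ≠ 0) :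
    zeroTailCycle r (Fin.castLE (Nat.le_add_left 4 k) j) =
      Fin.castLE (Nat.le_add_left 4 k) j :=
  Equiv.Perm.viaFintypeEmbedding_apply_notMem_range _ _ (castLE_notMem_range_zeroTail hj)

lemma sign_zeroTailCycle {k : ℕ} (r : Fin (k + 1)) :
    Equiv.Perm.sign (zeroTailCycle r) = (-1) ^ (r : ℕ) := by
  rw [zeroTailCycle, Equiv.Perm.viaFintypeEmbedding_sign, Equiv.Perm.sign_symm,
    Fin.sign_cycleRange]

-- Averaging over the permutations `zeroTailCycle r` turns the derivative of `Ψ` into `extDeriv Ψ`.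
lemma sum_sign_mul_partialDeriv_eq_zero {ι : Type*} {k : ℕ} (v : Fin (k + 4) → ι) (e : ι → V)
    (T : ι → ι → ι → ℝ) {Ψ : V → V [⋀^Fin k]→L[ℝ] ℝ} {y : V} (hΨ : DifferentiableAt ℝ Ψ y)
    (hd : extDeriv Ψ y = 0) :
    ∑ σ : Equiv.Perm (Fin (k + 4)), ((Equiv.Perm.sign σ : ℤ) : ℝ) *
      (T (v (σ 1)) (v (σ 2)) (v (σ 3)) *
        partialDeriv e (v (σ 0)) (fun y ↦ Ψ y fun i ↦ e (v (σ (i.addNat 4)))) y) = 0 := by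
  set H : Equiv.Perm (Fin (k + 4)) → ℝ := fun σ ↦ T (v (σ 1)) (v (σ 2)) (v (σ 3)) *
    partialDeriv e (v (σ 0)) (fun y ↦ Ψ y fun i ↦ e (v (σ (i.addNat 4)))) y
  have hcycle (σ : Equiv.Perm (Fin (k + 4))) (r : Fin (k + 1)) : H (σ * zeroTailCycle r) =
      T (v (σ 1)) (v (σ 2)) (v (σ 3)) * fderiv ℝ
        (Ψ · (r.removeNth fun r ↦ e (v (σ (zeroTail k r))))) y (e (v (σ (zeroTail k r)))) := by
    have h1 : zeroTailCycle r 1 = 1 := zeroTailCycle_castLE r (j := 1) (by decide)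
    have h2 : zeroTailCycle r 2 = 2 := zeroTailCycle_castLE r (j := 2) (by decide)
    have h3 : zeroTailCycle r 3 = 3 := zeroTailCycle_castLE r (j := 3) (by decide)
    simp only [H, Equiv.Perm.mul_apply, zeroTailCycle_zero, zeroTailCycle_addNat, h1, h2, h3]
    rfl
  have hclosed (σ : Equiv.Perm (Fin (k + 4))) :
      ∑ r : Fin (k + 1), (-1) ^ (r : ℕ) * H (σ * zeroTailCycle r) = 0 := by
    have h := congrArg (fun L ↦ L fun r ↦ e (v (σ (zeroTail k r)))) hd
    simp only [extDeriv_apply hΨ, zsmul_eq_mul, Int.cast_pow, Int.cast_neg, Int.cast_one] at h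
    simp only [hcycle, mul_left_comm _ (T _ _ _), ← Finset.mul_sum, h]
    simp
  have hmul : ((k : ℝ) + 1) * ∑ σ, ((Equiv.Perm.sign σ : ℤ) : ℝ) * H σ = 0 := calc
    _ = ∑ r : Fin (k + 1), (-1) ^ (r : ℕ) *
        ∑ σ, ((Equiv.Perm.sign σ : ℤ) : ℝ) * H (σ * zeroTailCycle r) := by
      simp only [sum_sign_mul_comp_mul_right, sign_zeroTailCycle, ← mul_assoc]
      simp [← mul_pow]
    _ = ∑ σ, ((Equiv.Perm.sign σ : ℤ) : ℝ) *
        ∑ r : Fin (k + 1), (-1) ^ (r : ℕ) * H (σ * zeroTailCycle r) := by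
      simp only [Finset.mul_sum, mul_left_comm ((-1 : ℝ) ^ _)]
      exact Finset.sum_comm
    _ = 0 := by simp only [hclosed, mul_zero, Finset.sum_const_zero]
  exact (mul_eq_zero.1 hmul).resolve_left (by positivity)

lemma sum_sign_mul_partialDeriv_mul {ι : Type*} {k : ℕ} (v : Fin (k + 4) → ι) (e : ι → V)
    {T : ι → ι → ι → V → ℝ} {Ψ : V → V [⋀^Fin k]→L[ℝ] ℝ} {y : V}
    (hT : ∀ a b c, DifferentiableAt ℝ (T a b c) y) (hΨ : DifferentiableAt ℝ Ψ y)
    (hd : extDeriv Ψ y = 0) :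
    ∑ σ : Equiv.Perm (Fin (k + 4)), ((Equiv.Perm.sign σ : ℤ) : ℝ) *
      partialDeriv e (v (σ 0)) (fun y ↦ T (v (σ 1)) (v (σ 2)) (v (σ 3)) y *
        Ψ y fun i ↦ e (v (σ (i.addNat 4)))) y =
      altSum v (fun i a b c ↦ partialDeriv e i (T a b c) y) (fun t ↦ Ψ y fun j ↦ e (t j)) := by
  have hΨw (w : Fin k → V) : DifferentiableAt ℝ (fun y ↦ Ψ y w) y :=
    (ContinuousAlternatingMap.apply ℝ V ℝ w).differentiableAt.comp y hΨ
  simp only [partialDeriv_mul (hT _ _ _) (hΨw _), mul_add, Finset.sum_add_distrib]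
  rw [sum_sign_mul_partialDeriv_eq_zero v e (fun a b c ↦ T a b c y) hΨ hd, add_zero, altSum]

lemma partialDeriv_eq_zero_of_notMem_tsupport {ι W : Type*} [NormedAddCommGroup W]
    [NormedSpace ℝ W] {e : ι → V} {g : V → W} {y : V} (hy : y ∉ tsupport g) (i : ι) :
    partialDeriv e i g y = 0 := by
  rw [partialDeriv, fderiv_of_notMem_tsupport ℝ hy, zero_apply]

lemma contDiff_mul_of_tsupport_subset {ρ g : V → ℝ} {Ω : Set V} (hΩ : IsOpen Ω)
    {n : WithTop ℕ∞} (hρ : ContDiff ℝ n ρ) (hs : tsupport ρ ⊆ Ω) (hg : ContDiffOn ℝ n g Ω) :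
    ContDiff ℝ n fun y ↦ ρ y * g y :=
  contMDiff_iff_contDiff.1 <| contMDiff_of_tsupport fun _ hy ↦ (hρ.contDiffAt.mul
    (hg.contDiffAt (hΩ.mem_nhds (hs (tsupport_mul_subset_left hy))))).contMDiffAt

lemma integrable_of_eq_zero_off_tsupport {X : Type*} [TopologicalSpace X] [MeasurableSpace X]
    [OpensMeasurableSpace X] [T2Space X] (μ : Measure X) [IsFiniteMeasureOnCompacts μ]
    {ρ h : X → ℝ} {Ω : Set X} (hc : HasCompactSupport ρ) (hs : tsupport ρ ⊆ Ω)
    (hh : ContinuousOn h Ω) (h0 : ∀ y ∉ tsupport ρ, h y = 0) : Integrable h μ :=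
  ((hh.mono hs).integrableOn_compact hc).integrable_of_forall_notMem_eq_zero h0

variable [MeasurableSpace V] [BorelSpace V] [FiniteDimensional ℝ V] (μ : Measure V)
  [μ.IsAddHaarMeasure]

lemma integral_fderiv_eq_zero {g : V → ℝ} (hg : ContDiff ℝ 1 g) (hc : HasCompactSupport g)
    (w : V) : ∫ y, fderiv ℝ g y w ∂μ = 0 := by
  have hfderiv : Integrable (fun y ↦ fderiv ℝ g y w) μ :=
    ((hg.continuous_fderiv (by norm_num)).clm_apply
      continuous_const).integrable_of_hasCompactSupport (hc.fderiv_apply ℝ w)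
  have hparts := integral_mul_fderiv_eq_neg_fderiv_mul_of_integrable (μ := μ)
    (f := fun _ ↦ (1 : ℝ)) (g := g) (v := w) (by simp) (by simpa using hfderiv)
    (by simpa using hg.continuous.integrable_of_hasCompactSupport hc)
    (fun x _ ↦ differentiableAt_const _) (fun x _ ↦ hg.differentiable (by norm_num) x)
  simpa using hparts

lemma integral_altSum_partialDeriv_eq_zero {ι : Type*} {k : ℕ} (v : Fin (k + 4) → ι) (e : ι → V)
    {T : ι → ι → ι → V → ℝ} {Ψ : V → V [⋀^Fin k]→L[ℝ] ℝ} {Ω : Set V} (hΩ : IsOpen Ω)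
    (hT : ∀ a b c, ContDiff ℝ 1 (T a b c)) (hc : ∀ a b c, HasCompactSupport (T a b c))
    (hs : ∀ a b c, tsupport (T a b c) ⊆ Ω) (hΨ : ContDiffOn ℝ 1 Ψ Ω)
    (hd : ∀ y ∈ Ω, extDeriv Ψ y = 0) :
    ∫ y, altSum v (fun i a b c ↦ partialDeriv e i (T a b c) y)
      (fun t ↦ Ψ y fun j ↦ e (t j)) ∂μ = 0 := by
  let g (σ : Equiv.Perm (Fin (k + 4))) (y : V) : ℝ :=
    T (v (σ 1)) (v (σ 2)) (v (σ 3)) y * Ψ y fun i ↦ e (v (σ (i.addNat 4)))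
  have hΨw (w : Fin k → V) : ContDiffOn ℝ 1 (fun y ↦ Ψ y w) Ω :=
    (ContinuousAlternatingMap.apply ℝ V ℝ w).contDiff.comp_contDiffOn hΨ
  have hg (σ) : ContDiff ℝ 1 (g σ) :=
    contDiff_mul_of_tsupport_subset hΩ (hT _ _ _) (hs _ _ _) (hΨw _)
  have hgc (σ) : HasCompactSupport (g σ) := (hc _ _ _).mul_right
  have hsum (y : V) : altSum v (fun i a b c ↦ partialDeriv e i (T a b c) y)
      (fun t ↦ Ψ y fun j ↦ e (t j)) =
      ∑ σ : Equiv.Perm (Fin (k + 4)), ((Equiv.Perm.sign σ : ℤ) : ℝ) *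
        partialDeriv e (v (σ 0)) (g σ) y := by
    by_cases hy : y ∈ Ω
    · exact (sum_sign_mul_partialDeriv_mul v e
        (fun a b c ↦ (hT a b c).differentiable (by norm_num) y)
        ((hΨ.contDiffAt (hΩ.mem_nhds hy)).differentiableAt (by norm_num)) (hd y hy)).symm
    · have hTy (i a b c) : partialDeriv e i (T a b c) y = 0 :=
        partialDeriv_eq_zero_of_notMem_tsupport (fun h ↦ hy (hs a b c h)) i
      have hgy (σ) (i : ι) : partialDeriv e i (g σ) y = 0 :=
        partialDeriv_eq_zero_of_notMem_tsupport
          (fun h ↦ hy (hs _ _ _ (tsupport_mul_subset_left h))) i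
      simp only [altSum, hTy, hgy, zero_mul, mul_zero]
  have hint (σ) (i : ι) : Integrable (partialDeriv e i (g σ)) μ :=
    (((hg σ).continuous_fderiv (by norm_num)).clm_apply
      continuous_const).integrable_of_hasCompactSupport ((hgc σ).fderiv_apply ℝ (e i))
  simp only [hsum]
  rw [integral_finsetSum _ fun σ _ ↦ (hint σ _).const_mul _]
  refine Finset.sum_eq_zero fun σ _ ↦ ?_
  rw [integral_const_mul]
  simp only [partialDeriv, integral_fderiv_eq_zero μ (hg σ) (hgc σ), mul_zero]

lemma integral_mul_altSum_partialDeriv {ι : Type*} {k : ℕ} (v : Fin (k + 4) → ι) (e : ι → V)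
    {T : ι → ι → ι → V → ℝ} {Ψ : V → V [⋀^Fin k]→L[ℝ] ℝ} {Ω : Set V} (hΩ : IsOpen Ω)
    {ρ : V → ℝ} (hρ : ContDiff ℝ 1 ρ) (hc : HasCompactSupport ρ) (hs : tsupport ρ ⊆ Ω)
    (hT : ∀ a b c, ContDiffOn ℝ 1 (T a b c) Ω) (hΨ : ContDiffOn ℝ 1 Ψ Ω)
    (hd : ∀ y ∈ Ω, extDeriv Ψ y = 0) :
    ∫ y, ρ y * altSum v (fun i a b c ↦ partialDeriv e i (T a b c) y)
        (fun t ↦ Ψ y fun j ↦ e (t j)) ∂μ =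
      -∫ y, altSum v (fun i a b c ↦ partialDeriv e i ρ y * T a b c y)
        (fun t ↦ Ψ y fun j ↦ e (t j)) ∂μ := by
  have hΨv (w : Fin k → V) : ContinuousOn (fun y ↦ Ψ y w) Ω :=
    (ContinuousAlternatingMap.apply ℝ V ℝ w).continuous.comp_continuousOn hΨ.continuousOn
  have hdT (i a b c) : ContinuousOn (partialDeriv e i (T a b c)) Ω :=
    ((hT a b c).continuousOn_fderiv_of_isOpen hΩ (by norm_num)).clm_apply continuousOn_const
  have hdρ (i) : Continuous (partialDeriv e i ρ) :=
    (hρ.continuous_fderiv (by norm_num)).clm_apply continuous_const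
  have hint : Integrable (fun y ↦ ρ y * altSum v (fun i a b c ↦ partialDeriv e i (T a b c) y)
      (fun t ↦ Ψ y fun j ↦ e (t j))) μ := by
    refine integrable_of_eq_zero_off_tsupport μ hc hs ?_ fun y hy ↦ ?_
    · exact hρ.continuous.continuousOn.mul (continuousOn_finsetSum _ fun σ _ ↦
        continuousOn_const.mul ((hdT _ _ _ _).mul (hΨv _)))
    · rw [image_eq_zero_of_notMem_tsupport hy, zero_mul]
  have hint' : Integrable (fun y ↦ altSum v (fun i a b c ↦ partialDeriv e i ρ y * T a b c y)
      (fun t ↦ Ψ y fun j ↦ e (t j))) μ := by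
    refine integrable_of_eq_zero_off_tsupport μ hc hs ?_ fun y hy ↦ ?_
    · exact continuousOn_finsetSum _ fun σ _ ↦ continuousOn_const.mul
        (((hdρ _).continuousOn.mul (hT _ _ _).continuousOn).mul (hΨv _))
    · simp only [altSum, partialDeriv_eq_zero_of_notMem_tsupport hy, zero_mul, mul_zero,
        Finset.sum_const_zero]
  have hleibniz (i a b c) (y : V) : partialDeriv e i (fun y ↦ ρ y * T a b c y) y =
      partialDeriv e i ρ y * T a b c y + ρ y * partialDeriv e i (T a b c) y := by
    by_cases hy : y ∈ Ω
    · exact partialDeriv_mul (hρ.differentiable (by norm_num) y)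
        (((hT a b c).contDiffAt (hΩ.mem_nhds hy)).differentiableAt (by norm_num)) i
    · have hy' : y ∉ tsupport ρ := fun h ↦ hy (hs h)
      rw [partialDeriv_eq_zero_of_notMem_tsupport (fun h ↦ hy' (tsupport_mul_subset_left h)),
        partialDeriv_eq_zero_of_notMem_tsupport hy', image_eq_zero_of_notMem_tsupport hy']
      ring
  have hstokes := integral_altSum_partialDeriv_eq_zero μ v e hΩ
    (fun a b c ↦ contDiff_mul_of_tsupport_subset hΩ hρ hs (hT a b c))
    (fun a b c ↦ hc.mul_right) (fun a b c ↦ tsupport_mul_subset_left.trans hs) hΨ hd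
  simp only [hleibniz, altSum_add, altSum_mul] at hstokes
  rwa [integral_add hint' hint, add_comm, add_eq_zero_iff_eq_neg] at hstokes

end Stokes

/-! ### Coordinate frames and the Riemannian volume -/

section CoordinateFrame

variable {n : ℕ} {M : Type*} [TopologicalSpace M] [ChartedSpace (EuclideanSpace ℝ (Fin n)) M]
  {x₀ x₁ : M} {y : EuclideanSpace ℝ (Fin n)}

lemma isOpen_target_inter_preimage (x₀ : M) {U : Set M} (hU : IsOpen U) :
    IsOpen ((extChartAt (𝓡 n) x₀).target ∩ (extChartAt (𝓡 n) x₀).symm ⁻¹' U) :=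
  (continuousOn_extChartAt_symm x₀).isOpen_inter_preimage (isOpen_extChartAt_target x₀) hU

variable (n) in
lemma measurableSet_target_inter_preimage (x₀ : M) [MeasurableSpace M] [BorelSpace M]
    {B : Set M} (hB : MeasurableSet B) :
    MeasurableSet ((extChartAt (𝓡 n) x₀).target ∩ (extChartAt (𝓡 n) x₀).symm ⁻¹' B) := by
  have h := (continuousOn_iff_continuous_domRestrict.1
    (continuousOn_extChartAt_symm (I := 𝓡 n) x₀)).measurable hB
  rw [← Subtype.image_preimage_coe]
  exact (isOpen_extChartAt_target (I := 𝓡 n) x₀).measurableSet.subtype_image h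

lemma aemeasurable_extChartAt_symm [MeasurableSpace M] [BorelSpace M] (x₀ : M) :
    AEMeasurable (extChartAt (𝓡 n) x₀).symm
      (volume.restrict (extChartAt (𝓡 n) x₀).target) :=
  (continuousOn_extChartAt_symm x₀).aemeasurable (isOpen_extChartAt_target x₀).measurableSet

/-- The transition map from the chart at `x₀` to the chart at `x₁`; it is meaningful where the two
chart domains overlap. -/
def transition (x₀ x₁ : M) : EuclideanSpace ℝ (Fin n) → EuclideanSpace ℝ (Fin n) :=
  extChartAt (𝓡 n) x₁ ∘ (extChartAt (𝓡 n) x₀).symm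

lemma extChartAt_symm_transition
    (hy : (extChartAt (𝓡 n) x₀).symm y ∈ (extChartAt (𝓡 n) x₁).source) :
    (extChartAt (𝓡 n) x₁).symm (transition x₀ x₁ y) = (extChartAt (𝓡 n) x₀).symm y :=
  (extChartAt (𝓡 n) x₁).left_inv hy

variable [IsManifold (𝓡 n) 1 M]

lemma extChartAt_symm_mem_baseSet (hy : y ∈ (extChartAt (𝓡 n) x₀).target) :
    (extChartAt (𝓡 n) x₀).symm y ∈
      (trivializationAt (EuclideanSpace ℝ (Fin n)) (TangentSpace (𝓡 n)) x₀).baseSet := by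
  simpa using (extChartAt (𝓡 n) x₀).map_target hy

lemma coordTangent_eq_symmL (hy : y ∈ (extChartAt (𝓡 n) x₀).target) :
    coordTangent x₀ y =
      (trivializationAt (EuclideanSpace ℝ (Fin n)) (TangentSpace (𝓡 n)) x₀).symmL ℝ
        ((extChartAt (𝓡 n) x₀).symm y) := by
  have hx : (extChartAt (𝓡 n) x₀).symm y ∈ (chartAt (EuclideanSpace ℝ (Fin n)) x₀).source := by
    simpa using (extChartAt (𝓡 n) x₀).map_target hy
  rw [TangentBundle.symmL_trivializationAt hx]
  simp only [coordTangent, ModelWithCorners.range_eq_univ, mfderivWithin_univ]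
  rw [(extChartAt (𝓡 n) x₀).right_inv hy]

/-- The frame of coordinate vector fields of the chart at `x₀`, at the point with coordinates
`y`. -/
def coordBasis (hy : y ∈ (extChartAt (𝓡 n) x₀).target) :
    Module.Basis (Fin n) ℝ (TangentSpace (𝓡 n) ((extChartAt (𝓡 n) x₀).symm y)) :=
  (EuclideanSpace.basisFun (Fin n) ℝ).toBasis.map
    ((trivializationAt (EuclideanSpace ℝ (Fin n)) (TangentSpace (𝓡 n)) x₀).continuousLinearEquivAt
      ℝ _ (extChartAt_symm_mem_baseSet hy)).symm.toLinearEquiv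

lemma coordBasis_apply (hy : y ∈ (extChartAt (𝓡 n) x₀).target) (i : Fin n) :
    coordBasis hy i = coordTangent x₀ y (EuclideanSpace.single i 1) := by
  rw [coordBasis, coordTangent_eq_symmL hy, Module.Basis.map_apply, OrthonormalBasis.coe_toBasis,
    EuclideanSpace.basisFun_apply, ← Trivialization.symm_continuousLinearEquivAt_eq _
      (extChartAt_symm_mem_baseSet hy)]
  rfl

lemma mdifferentiableAt_extChartAt_symm (hy : y ∈ (extChartAt (𝓡 n) x₀).target) :
    MDifferentiableAt (𝓡 n) (𝓡 n) (extChartAt (𝓡 n) x₀).symm y := by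
  have := mdifferentiableWithinAt_extChartAt_symm (I := 𝓡 n) hy
  rwa [ModelWithCorners.range_eq_univ, mdifferentiableWithinAt_univ] at this

lemma differentiableAt_transition (hy : y ∈ (extChartAt (𝓡 n) x₀).target)
    (hy' : (extChartAt (𝓡 n) x₀).symm y ∈ (extChartAt (𝓡 n) x₁).source) :
    DifferentiableAt ℝ (transition x₀ x₁) y := by
  rw [← mdifferentiableAt_iff_differentiableAt]
  exact MDifferentiableAt.comp (I' := 𝓡 n) y (mdifferentiableAt_extChartAt (by simpa using hy'))
    (mdifferentiableAt_extChartAt_symm hy)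

lemma mfderiv_extChartAt_symm_transition (hy : y ∈ (extChartAt (𝓡 n) x₀).target)
    (hy' : (extChartAt (𝓡 n) x₀).symm y ∈ (extChartAt (𝓡 n) x₁).source) :
    mfderiv (𝓡 n) (𝓡 n) (extChartAt (𝓡 n) x₀).symm y =
      (mfderiv (𝓡 n) (𝓡 n) (extChartAt (𝓡 n) x₁).symm (transition x₀ x₁ y)).comp
        (fderiv ℝ (transition x₀ x₁) y) := by
  have hsymm : (extChartAt (𝓡 n) x₀).symm =ᶠ[𝓝 y]
      (extChartAt (𝓡 n) x₁).symm ∘ transition x₀ x₁ := by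
    filter_upwards [(isOpen_target_inter_preimage x₀
      (isOpen_extChartAt_source x₁)).mem_nhds ⟨hy, hy'⟩] with z hz
    exact (extChartAt_symm_transition hz.2).symm
  have hcomp := mfderiv_comp y
    (mdifferentiableAt_extChartAt_symm ((extChartAt (𝓡 n) x₁).map_source hy'))
    (differentiableAt_transition hy hy').mdifferentiableAt
  rw [mfderiv_eq_fderiv] at hcomp
  exact hsymm.mfderiv_eq.trans hcomp

lemma contMDiffOn_coordTangent [IsManifold (𝓡 n) ∞ M] (x₀ : M) (v : EuclideanSpace ℝ (Fin n)) :
    ContMDiffOn (𝓡 n) ((𝓡 n).prod (𝓡 n)) ∞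
      (fun y ↦ TotalSpace.mk' (EuclideanSpace ℝ (Fin n)) (E := TangentSpace (𝓡 n))
        ((extChartAt (𝓡 n) x₀).symm y) (coordTangent x₀ y v)) (extChartAt (𝓡 n) x₀).target := by
  rw [Trivialization.contMDiffOn_iff
    (e := trivializationAt (EuclideanSpace ℝ (Fin n)) (TangentSpace (𝓡 n)) x₀)]
  · refine ⟨contMDiffOn_extChartAt_symm x₀, contMDiffOn_const (c := v) |>.congr fun y hy ↦ ?_⟩
    rw [coordTangent_eq_symmL hy]
    have := Trivialization.continuousLinearMapAt_symmL (R := ℝ) (trivializationAt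
      (EuclideanSpace ℝ (Fin n)) (TangentSpace (𝓡 n)) x₀) (extChartAt_symm_mem_baseSet hy) v
    rwa [Trivialization.continuousLinearMapAt_apply, Trivialization.linearMapAt_apply,
      if_pos (extChartAt_symm_mem_baseSet hy)] at this
  · intro y hy
    rw [Trivialization.mem_source]
    exact extChartAt_symm_mem_baseSet hy

end CoordinateFrame

section Volume

lemma det_toMatrix_comp_self {ι R V : Type*} [Fintype ι] [DecidableEq ι] [CommRing R]
    [AddCommGroup V] [Module R V] (b : Module.Basis ι R V) (B : LinearMap.BilinForm R V)
    (L : V →ₗ[R] V) :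
    (LinearMap.BilinForm.toMatrix b (B.comp L L)).det =
      LinearMap.det L ^ 2 * (LinearMap.BilinForm.toMatrix b B).det := by
  rw [LinearMap.BilinForm.toMatrix_comp b b, Matrix.det_mul, Matrix.det_mul, Matrix.det_transpose,
    LinearMap.det_toMatrix]
  ring

variable {n : ℕ} {M : Type*} [TopologicalSpace M] [ChartedSpace (EuclideanSpace ℝ (Fin n)) M]
  [RiemannianBundle (fun x : M ↦ TangentSpace (𝓡 n) x)]
  {x₀ x₁ : M} {y : EuclideanSpace ℝ (Fin n)}

/-- The metric of `M` read in the chart at `x₀`, at the point with coordinates `y`. -/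
def chartMetric (x₀ : M) (y : EuclideanSpace ℝ (Fin n)) :
    LinearMap.BilinForm ℝ (EuclideanSpace ℝ (Fin n)) :=
  (innerₗ (TangentSpace (𝓡 n) ((extChartAt (𝓡 n) x₀).symm y))).compl₁₂
    (coordTangent x₀ y).toLinearMap (coordTangent x₀ y).toLinearMap

lemma chartDensity_eq_sqrt_det_toMatrix (x₀ : M) (y : EuclideanSpace ℝ (Fin n)) :
    chartDensity x₀ y = √(LinearMap.BilinForm.toMatrix
      (EuclideanSpace.basisFun (Fin n) ℝ).toBasis (chartMetric x₀ y)).det := by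
  congr 2

variable (n) in
lemma inner_tangentSpace_congr {x x' : M} (h : x = x') (v w : EuclideanSpace ℝ (Fin n)) :
    inner ℝ (show TangentSpace (𝓡 n) x from v) (show TangentSpace (𝓡 n) x from w) =
      inner ℝ (show TangentSpace (𝓡 n) x' from v) (show TangentSpace (𝓡 n) x' from w) := by
  rw [h]

lemma chartMetric_transition [IsManifold (𝓡 n) 1 M] (hy : y ∈ (extChartAt (𝓡 n) x₀).target)
    (hy' : (extChartAt (𝓡 n) x₀).symm y ∈ (extChartAt (𝓡 n) x₁).source) :
    chartMetric x₀ y = (chartMetric x₁ (transition x₀ x₁ y)).comp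
      (fderiv ℝ (transition x₀ x₁) y).toLinearMap (fderiv ℝ (transition x₀ x₁) y).toLinearMap := by
  ext v w
  have h (u : EuclideanSpace ℝ (Fin n)) : (show EuclideanSpace ℝ (Fin n) from coordTangent x₀ y u) =
      coordTangent x₁ (transition x₀ x₁ y) (fderiv ℝ (transition x₀ x₁) y u) :=
    DFunLike.congr_fun (mfderiv_extChartAt_symm_transition hy hy') u
  exact (congrArg₂ (fun a b : EuclideanSpace ℝ (Fin n) ↦
    inner ℝ (show TangentSpace (𝓡 n) ((extChartAt (𝓡 n) x₀).symm y) from a)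
      (show TangentSpace (𝓡 n) ((extChartAt (𝓡 n) x₀).symm y) from b)) (h v) (h w)).trans
    (inner_tangentSpace_congr n (extChartAt_symm_transition hy').symm _ _)

lemma chartDensity_transition [IsManifold (𝓡 n) 1 M] (hy : y ∈ (extChartAt (𝓡 n) x₀).target)
    (hy' : (extChartAt (𝓡 n) x₀).symm y ∈ (extChartAt (𝓡 n) x₁).source) :
    chartDensity x₀ y =
      |(fderiv ℝ (transition x₀ x₁) y).det| * chartDensity x₁ (transition x₀ x₁ y) := by
  rw [chartDensity_eq_sqrt_det_toMatrix, chartDensity_eq_sqrt_det_toMatrix,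
    chartMetric_transition hy hy', det_toMatrix_comp_self, Real.sqrt_mul (sq_nonneg _),
    Real.sqrt_sq_eq_abs]

lemma chartDensity_pos [IsManifold (𝓡 n) 1 M] (hy : y ∈ (extChartAt (𝓡 n) x₀).target) :
    0 < chartDensity x₀ y := by
  have hpos := (Matrix.posDef_gram_of_linearIndependent (𝕜 := ℝ)
    (coordBasis hy).linearIndependent).det_pos
  rw [funext (coordBasis_apply hy)] at hpos
  exact Real.sqrt_pos.2 hpos

lemma contDiffOn_chartMetric [IsManifold (𝓡 n) ∞ M]
    [IsContMDiffRiemannianBundle (𝓡 n) ∞ (EuclideanSpace ℝ (Fin n))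
      (fun x : M ↦ TangentSpace (𝓡 n) x)] (x₀ : M) (v w : EuclideanSpace ℝ (Fin n)) :
    ContDiffOn ℝ ∞ (fun y ↦ chartMetric x₀ y v w) (extChartAt (𝓡 n) x₀).target := by
  rw [← contMDiffOn_iff_contDiffOn]
  exact (contMDiffOn_coordTangent x₀ v).inner_bundle (contMDiffOn_coordTangent x₀ w)

lemma continuousOn_chartDensity [IsManifold (𝓡 n) ∞ M]
    [IsContMDiffRiemannianBundle (𝓡 n) ∞ (EuclideanSpace ℝ (Fin n))
      (fun x : M ↦ TangentSpace (𝓡 n) x)] (x₀ : M) :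
    ContinuousOn (chartDensity x₀) (extChartAt (𝓡 n) x₀).target := by
  rw [continuousOn_iff_continuous_domRestrict]
  refine Real.continuous_sqrt.comp (Continuous.matrix_det (continuous_matrix fun i j ↦ ?_))
  exact continuousOn_iff_continuous_domRestrict.1 (contDiffOn_chartMetric x₀ _ _).continuousOn

lemma chartVolume_le_riemannianVolume [MeasurableSpace M] (x₀ : M) (B : Set M) :
    chartVolume (n := n) x₀ B ≤ riemannianVolume n M B :=
  Measure.le_iff'.1 (le_iSup (chartVolume (n := n)) x₀) B

variable [MeasurableSpace M] [BorelSpace M]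

lemma chartVolume_apply (x₀ : M) {B : Set M} (hB : MeasurableSet B) :
    chartVolume (n := n) x₀ B =
      ∫⁻ y in (extChartAt (𝓡 n) x₀).target ∩ (extChartAt (𝓡 n) x₀).symm ⁻¹' B,
        ENNReal.ofReal (chartDensity x₀ y) := by
  rw [chartVolume, Measure.map_apply_of_aemeasurable
    ((aemeasurable_extChartAt_symm x₀).mono_ac (withDensity_absolutelyContinuous _ _)) hB,
    withDensity_apply', Measure.restrict_restrict' (isOpen_extChartAt_target x₀).measurableSet,
    inter_comm]

lemma chartVolume_inter_source (x₀ : M) {B : Set M} (hB : MeasurableSet B) :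
    chartVolume (n := n) x₀ (B ∩ (extChartAt (𝓡 n) x₀).source) = chartVolume (n := n) x₀ B := by
  rw [chartVolume_apply x₀ hB,
    chartVolume_apply x₀ (hB.inter (isOpen_extChartAt_source x₀).measurableSet)]
  congr 2
  ext y
  simp only [mem_inter_iff, mem_preimage, and_congr_right_iff, and_iff_left_iff_imp]
  exact fun hy _ ↦ (extChartAt (𝓡 n) x₀).map_target hy

lemma chartVolume_eq_of_subset [IsManifold (𝓡 n) 1 M] {B : Set M} (hB : MeasurableSet B)
    (h0 : B ⊆ (extChartAt (𝓡 n) x₀).source) (h1 : B ⊆ (extChartAt (𝓡 n) x₁).source) :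
    chartVolume (n := n) x₀ B = chartVolume (n := n) x₁ B := by
  set S := (extChartAt (𝓡 n) x₀).target ∩ (extChartAt (𝓡 n) x₀).symm ⁻¹' B with hS
  have himage : (extChartAt (𝓡 n) x₁).target ∩ (extChartAt (𝓡 n) x₁).symm ⁻¹' B =
      transition x₀ x₁ '' S := by
    rw [transition, image_comp, hS, ← (extChartAt (𝓡 n) x₀).image_eq_target_inter_inv_preimage h0,
      (extChartAt (𝓡 n) x₀).symm_image_image_of_subset_source h0,
      (extChartAt (𝓡 n) x₁).image_eq_target_inter_inv_preimage h1]
  have hinj : InjOn (transition x₀ x₁) S := fun y hy z hz h ↦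
    (extChartAt (𝓡 n) x₀).symm.injOn hy.1 hz.1
      ((extChartAt (𝓡 n) x₁).injOn (h1 hy.2) (h1 hz.2) h)
  have hSm : MeasurableSet S := measurableSet_target_inter_preimage n x₀ hB
  rw [chartVolume_apply x₀ hB, chartVolume_apply x₁ hB, himage,
    lintegral_image_eq_lintegral_abs_det_fderiv_mul volume hSm
      (fun y hy ↦ (differentiableAt_transition hy.1 (h1 hy.2)).hasFDerivAt.hasFDerivWithinAt) hinj]
  refine setLIntegral_congr_fun hSm fun y hy ↦ ?_
  rw [chartDensity_transition hy.1 (h1 hy.2), ENNReal.ofReal_mul (abs_nonneg _)]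

lemma riemannianVolume_le_chartVolume_add [IsManifold (𝓡 n) 1 M] (x₀ : M) :
    riemannianVolume n M ≤ chartVolume (n := n) x₀ +
      (riemannianVolume n M).restrict (extChartAt (𝓡 n) x₀).sourceᶜ := by
  refine iSup_le fun x ↦ Measure.le_iff.2 fun B hB ↦ ?_
  have hs := (isOpen_extChartAt_source (I := 𝓡 n) x₀).measurableSet
  have hs' := (isOpen_extChartAt_source (I := 𝓡 n) x).measurableSet
  rw [← measure_inter_add_sdiff B hs, Measure.add_apply, Measure.restrict_apply hB, ← sdiff_eq]
  refine add_le_add ?_ (chartVolume_le_riemannianVolume x _)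
  rw [← chartVolume_inter_source x (hB.inter hs),
    chartVolume_eq_of_subset ((hB.inter hs).inter hs') (x₁ := x₀) inter_subset_right
      (inter_subset_left.trans inter_subset_right)]
  exact measure_mono (inter_subset_left.trans inter_subset_left)

lemma riemannianVolume_restrict_source [IsManifold (𝓡 n) 1 M] (x₀ : M) :
    (riemannianVolume n M).restrict (extChartAt (𝓡 n) x₀).source = chartVolume (n := n) x₀ := by
  have hs := (isOpen_extChartAt_source (I := 𝓡 n) x₀).measurableSet
  refine Measure.ext fun B hB ↦ le_antisymm ?_ ?_ <;> rw [Measure.restrict_apply hB]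
  · refine (Measure.le_iff'.1 (riemannianVolume_le_chartVolume_add x₀) _).trans ?_
    rw [Measure.add_apply, Measure.restrict_apply (hB.inter hs), inter_assoc, inter_compl_self,
      inter_empty, measure_empty, add_zero]
    exact measure_mono inter_subset_left
  · rw [← chartVolume_inter_source x₀ hB]
    exact chartVolume_le_riemannianVolume x₀ _

variable [IsManifold (𝓡 n) ∞ M] [IsContMDiffRiemannianBundle (𝓡 n) ∞ (EuclideanSpace ℝ (Fin n))
      (fun x : M ↦ TangentSpace (𝓡 n) x)]

instance isLocallyFiniteMeasure_riemannianVolume :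
    IsLocallyFiniteMeasure (riemannianVolume n M) := by
  refine ⟨fun x₀ ↦ ?_⟩
  have hc := (continuousOn_chartDensity x₀).continuousAt (x := extChartAt (𝓡 n) x₀ x₀)
    (extChartAt_target_mem_nhds x₀)
  obtain ⟨r, hr, hball⟩ := Metric.mem_nhds_iff.1 (hc.eventually (gt_mem_nhds (lt_add_one _)))
  set U := (extChartAt (𝓡 n) x₀).source ∩ extChartAt (𝓡 n) x₀ ⁻¹'
    Metric.ball (extChartAt (𝓡 n) x₀ x₀) r
  have hU : IsOpen U := (continuousOn_extChartAt x₀).isOpen_inter_preimage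
    (isOpen_extChartAt_source x₀) Metric.isOpen_ball
  refine ⟨U, hU.mem_nhds ⟨mem_extChartAt_source x₀, Metric.mem_ball_self hr⟩, ?_⟩
  rw [← Measure.restrict_eq_self _ (inter_subset_left (s := (extChartAt (𝓡 n) x₀).source)),
    riemannianVolume_restrict_source x₀, chartVolume_apply x₀ hU.measurableSet]
  refine (lintegral_mono_set (t := Metric.ball (extChartAt (𝓡 n) x₀ x₀) r) ?_).trans_lt
    (setLIntegral_lt_top_of_le_nnreal measure_ball_lt_top.ne
      ⟨(chartDensity x₀ (extChartAt (𝓡 n) x₀ x₀) + 1).toNNReal, fun y hy ↦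
        ENNReal.ofReal_le_ofReal (hball hy).le⟩)
  rintro y ⟨hy, -, hyB⟩
  rwa [mem_preimage, (extChartAt (𝓡 n) x₀).right_inv hy] at hyB

instance isOpenPosMeasure_riemannianVolume : (riemannianVolume n M).IsOpenPosMeasure := by
  refine ⟨fun U hU ⟨x₀, hx₀⟩ h ↦ ?_⟩
  have hvol : chartVolume (n := n) x₀ U = 0 :=
    le_antisymm ((chartVolume_le_riemannianVolume x₀ U).trans h.le) bot_le
  have hS := measurableSet_target_inter_preimage n x₀ hU.measurableSet
  rw [chartVolume_apply x₀ hU.measurableSet, setLIntegral_eq_zero_iff' hS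
    (((continuousOn_chartDensity x₀).mono inter_subset_left).aemeasurable hS).ennreal_ofReal]
    at hvol
  have hpos := (isOpen_target_inter_preimage x₀ hU).measure_pos volume
    ⟨extChartAt (𝓡 n) x₀ x₀, mem_extChartAt_target x₀, by simpa [mem_preimage] using hx₀⟩
  refine hpos.ne' (measure_mono_null (fun y hy ↦ ?_) (ae_iff.1 hvol))
  rw [mem_ofPred_eq, Classical.not_imp]
  exact ⟨hy, by simpa using chartDensity_pos hy.1⟩

lemma integral_chartVolume (x₀ : M) {f : M → ℝ} (hf : Continuous f) :
    ∫ x, f x ∂(chartVolume (n := n) x₀) = ∫ y in (extChartAt (𝓡 n) x₀).target,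
      chartDensity x₀ y * f ((extChartAt (𝓡 n) x₀).symm y) := by
  have hm : AEMeasurable (fun y ↦ ENNReal.ofReal (chartDensity x₀ y))
      (volume.restrict (extChartAt (𝓡 n) x₀).target) :=
    ((continuousOn_chartDensity x₀).aemeasurable
      (isOpen_extChartAt_target x₀).measurableSet).ennreal_ofReal
  rw [chartVolume, integral_map ((aemeasurable_extChartAt_symm x₀).mono_ac
    (withDensity_absolutelyContinuous _ _)) hf.aestronglyMeasurable,
    integral_withDensity_eq_integral_toReal_smul₀ hm (by simp)]
  refine integral_congr_ae (.of_forall fun y ↦ ?_)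
  simp [ENNReal.toReal_ofReal (Real.sqrt_nonneg _), chartDensity]

lemma integral_riemannianVolume_eq (x₀ : M) {f : M → ℝ} (hf : Continuous f)
    (h0 : ∀ x ∉ (extChartAt (𝓡 n) x₀).source, f x = 0) :
    ∫ x, f x ∂(riemannianVolume n M) = ∫ y in (extChartAt (𝓡 n) x₀).target,
      chartDensity x₀ y * f ((extChartAt (𝓡 n) x₀).symm y) := by
  rw [← integral_chartVolume x₀ hf, ← riemannianVolume_restrict_source x₀,
    setIntegral_eq_integral_of_forall_compl_eq_zero h0]

end Volume

/-! ### Vector fields and sections in a chart -/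

section CoordinateField

variable {n : ℕ} {M : Type*} [TopologicalSpace M] [ChartedSpace (EuclideanSpace ℝ (Fin n)) M]
  [IsManifold (𝓡 n) ∞ M]

/-- The vector field with constant components `v` in the chart at `x₀`, extended by zero outside
the domain of the chart. -/
def coordField (x₀ : M) (v : EuclideanSpace ℝ (Fin n)) (x : M) : TangentSpace (𝓡 n) x :=
  (trivializationAt (EuclideanSpace ℝ (Fin n)) (TangentSpace (𝓡 n)) x₀).symmL ℝ x v

lemma coordField_symm {x₀ : M} {y : EuclideanSpace ℝ (Fin n)}
    (hy : y ∈ (extChartAt (𝓡 n) x₀).target) (v : EuclideanSpace ℝ (Fin n)) :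
    coordField x₀ v ((extChartAt (𝓡 n) x₀).symm y) = coordTangent x₀ y v := by
  rw [coordTangent_eq_symmL hy]
  rfl

lemma contMDiffAt_coordField {x₀ x : M} (hx : x ∈ (extChartAt (𝓡 n) x₀).source)
    (v : EuclideanSpace ℝ (Fin n)) :
    ContMDiffAt (𝓡 n) ((𝓡 n).prod (𝓡 n)) ∞
      (fun y ↦ TotalSpace.mk' (EuclideanSpace ℝ (Fin n)) (E := TangentSpace (𝓡 n)) y
        (coordField x₀ v y)) x := by
  have hb : x ∈ (trivializationAt (EuclideanSpace ℝ (Fin n)) (TangentSpace (𝓡 n)) x₀).baseSet := by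
    simpa using hx
  rw [Trivialization.contMDiffAt_section_iff (trivializationAt (EuclideanSpace ℝ (Fin n))
    (TangentSpace (𝓡 n)) x₀) hb]
  refine (contMDiffAt_const (c := v)).congr_of_eventuallyEq ?_
  filter_upwards [(trivializationAt (EuclideanSpace ℝ (Fin n))
    (TangentSpace (𝓡 n)) x₀).open_baseSet.mem_nhds hb] with y hy
  rw [← Trivialization.continuousLinearMapAt_apply_of_mem (R := ℝ) _ hy]
  exact Trivialization.continuousLinearMapAt_symmL _ hy v

lemma mdifferentiableAt_coordField {x₀ x : M} (hx : x ∈ (extChartAt (𝓡 n) x₀).source)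
    (v : EuclideanSpace ℝ (Fin n)) :
    MDifferentiableAt (𝓡 n) ((𝓡 n).prod (𝓡 n))
      (fun y ↦ TotalSpace.mk' (EuclideanSpace ℝ (Fin n)) (E := TangentSpace (𝓡 n)) y
        (coordField x₀ v y)) x :=
  (contMDiffAt_coordField hx v).mdifferentiableAt (by simp)

/-- The constant vector field `v` on the model space, as a section of its tangent bundle. -/
def constField (v y : EuclideanSpace ℝ (Fin n)) : TangentSpace (𝓡 n) y := v

lemma mdifferentiableAt_constField {v : EuclideanSpace ℝ (Fin n)} (y : EuclideanSpace ℝ (Fin n)) :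
    MDifferentiableAt (𝓡 n) (𝓡 n).tangent
      (fun z ↦ (constField v z : TangentBundle (𝓡 n) (EuclideanSpace ℝ (Fin n)))) y :=
  (contMDiffAt_vectorSpace_iff_contDiffAt.2 (contDiffAt_const (c := v) (n := 1))).mdifferentiableAt
    (by simp)

lemma mlieBracket_constField (v w : EuclideanSpace ℝ (Fin n)) :
    VectorField.mlieBracket (𝓡 n) (constField v) (constField w) = 0 := by
  rw [← VectorField.mlieBracketWithin_univ, VectorField.mlieBracketWithin_eq_lieBracketWithin]
  ext1 y
  have hconst : VectorField.lieBracketWithin ℝ (fun _ : EuclideanSpace ℝ (Fin n) ↦ v)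
      (fun _ ↦ w) univ y = 0 := by
    simp [VectorField.lieBracketWithin_eq]
  exact hconst

lemma coordField_eq_mpullback {x₀ x : M} (hx : x ∈ (extChartAt (𝓡 n) x₀).source)
    (v : EuclideanSpace ℝ (Fin n)) :
    coordField x₀ v x =
      VectorField.mpullback (𝓡 n) (𝓡 n) (extChartAt (𝓡 n) x₀) (constField v) x := by
  have hb : x ∈ (trivializationAt (EuclideanSpace ℝ (Fin n)) (TangentSpace (𝓡 n)) x₀).baseSet := by
    simpa using hx
  have hmfderiv : (mfderiv (𝓡 n) (𝓡 n) (extChartAt (𝓡 n) x₀) x) =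
      ((trivializationAt (EuclideanSpace ℝ (Fin n)) (TangentSpace (𝓡 n)) x₀).continuousLinearEquivAt
        ℝ x hb : TangentSpace (𝓡 n) x →L[ℝ] EuclideanSpace ℝ (Fin n)) := by
    rw [← TangentBundle.continuousLinearMapAt_trivializationAt (by simpa using hx)]
    exact (Trivialization.coe_continuousLinearEquivAt_eq' _ hb).symm
  have hinverse := (congrArg ContinuousLinearMap.inverse hmfderiv).trans
    (ContinuousLinearMap.inverse_equiv _)
  refine Eq.trans ?_ (DFunLike.congr_fun hinverse v).symm
  rw [coordField, ← Trivialization.symm_continuousLinearEquivAt_eq _ hb]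
  rfl

lemma mlieBracket_coordField {x₀ x : M} (hx : x ∈ (extChartAt (𝓡 n) x₀).source)
    (v w : EuclideanSpace ℝ (Fin n)) :
    VectorField.mlieBracket (𝓡 n) (coordField x₀ v) (coordField x₀ w) x = 0 := by
  have heq (v : EuclideanSpace ℝ (Fin n)) : coordField x₀ v =ᶠ[𝓝 x]
      VectorField.mpullback (𝓡 n) (𝓡 n) (extChartAt (𝓡 n) x₀) (constField v) := by
    filter_upwards [(isOpen_extChartAt_source x₀).mem_nhds hx] with y hy
    exact coordField_eq_mpullback hy v
  have hle : minSmoothness ℝ 2 ≤ ∞ := by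
    rw [minSmoothness_of_isRCLikeNormedField]
    exact ENat.LEInfty.out
  have : IsManifold (𝓡 n) (minSmoothness ℝ 2) M := IsManifold.of_le hle
  rw [(heq v).mlieBracket_vectorField_eq (heq w), ← VectorField.mpullback_mlieBracket (n := ∞)
    (V := constField v) (W := constField w) (mdifferentiableAt_constField _)
    (mdifferentiableAt_constField _) (contMDiffAt_extChartAt' (by simpa using hx)) hle,
    mlieBracket_constField, VectorField.mpullback_apply]
  exact map_zero _

lemma mvfderiv_coordTangent {W : Type*} [NormedAddCommGroup W] [NormedSpace ℝ W] {g : M → W}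
    {x₀ : M} {y : EuclideanSpace ℝ (Fin n)} (hy : y ∈ (extChartAt (𝓡 n) x₀).target)
    (hg : MDifferentiableAt (𝓡 n) 𝓘(ℝ, W) g ((extChartAt (𝓡 n) x₀).symm y))
    (v : EuclideanSpace ℝ (Fin n)) :
    mvfderiv (𝓡 n) g ((extChartAt (𝓡 n) x₀).symm y) (coordTangent x₀ y v) =
      fderiv ℝ (g ∘ (extChartAt (𝓡 n) x₀).symm) y v := by
  have h := mfderiv_comp y hg (mdifferentiableAt_extChartAt_symm hy)
  rw [mfderiv_eq_fderiv] at h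
  exact (DFunLike.congr_fun h v).symm

end CoordinateField

section FrameDomain

variable {n : ℕ} {M : Type*} [TopologicalSpace M] [ChartedSpace (EuclideanSpace ℝ (Fin n)) M]
  (F : Type*) [NormedAddCommGroup F]
  (E : M → Type*) [TopologicalSpace (TotalSpace F E)] [∀ x, NormedAddCommGroup (E x)]
  [FiberBundle F E]

/-- The domain, in the chart at `x₀`, of the trivialization of `E` at `x₀`. -/
def frameDomain (x₀ : M) : Set (EuclideanSpace ℝ (Fin n)) :=
  (extChartAt (𝓡 n) x₀).target ∩
    (extChartAt (𝓡 n) x₀).symm ⁻¹' (trivializationAt F E x₀).baseSet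

lemma isOpen_frameDomain (x₀ : M) : IsOpen (frameDomain (n := n) F E x₀) :=
  isOpen_target_inter_preimage x₀ (trivializationAt F E x₀).open_baseSet

lemma mem_frameDomain (x₀ : M) : extChartAt (𝓡 n) x₀ x₀ ∈ frameDomain (n := n) F E x₀ :=
  ⟨mem_extChartAt_target x₀, by
    simpa using FiberBundle.mem_baseSet_trivializationAt' (F := F) (E := E) x₀⟩

end FrameDomain

section LocalForm

variable {n : ℕ} {M : Type*} [TopologicalSpace M] [ChartedSpace (EuclideanSpace ℝ (Fin n)) M]
  {F : Type*} [NormedAddCommGroup F] [NormedSpace ℂ F]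
  {E : M → Type*} [TopologicalSpace (TotalSpace F E)]
  [∀ x, NormedAddCommGroup (E x)] [∀ x, InnerProductSpace ℂ (E x)]
  [FiberBundle F E] [VectorBundle ℝ F E]

variable (F E) in
/-- The coordinates of vectors of `E` in the frame at `x₀`. -/
def frameMap (x₀ x : M) : E x →L[ℝ] F :=
  (trivializationAt F E x₀).continuousLinearMapAt ℝ x

/-- A section of `E` read in the chart and the frame at `x₀`. -/
def readSection (x₀ : M) (σ : ∀ x, E x) (y : EuclideanSpace ℝ (Fin n)) : F :=
  frameMap F E x₀ ((extChartAt (𝓡 n) x₀).symm y) (σ ((extChartAt (𝓡 n) x₀).symm y))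

lemma frameMap_eventuallyEq {x₀ : M} (σ : ∀ x, E x) {x : M}
    (hx : x ∈ (trivializationAt F E x₀).baseSet) :
    (fun z ↦ frameMap F E x₀ z (σ z)) =ᶠ[𝓝 x] fun z ↦ (trivializationAt F E x₀ ⟨z, σ z⟩).2 := by
  filter_upwards [(trivializationAt F E x₀).open_baseSet.mem_nhds hx] with z hz
  exact Trivialization.continuousLinearMapAt_apply_of_mem (R := ℝ) _ hz _

/-- The frame at `x₀` as a linear equivalence. -/
def frameEquiv {x₀ x : M} (hx : x ∈ (trivializationAt F E x₀).baseSet) : E x ≃ₗ[ℝ] F :=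
  ((trivializationAt F E x₀).continuousLinearEquivAt ℝ x hx).toLinearEquiv

lemma frameEquiv_apply {x₀ x : M} (hx : x ∈ (trivializationAt F E x₀).baseSet) (s : E x) :
    frameEquiv hx s = frameMap F E x₀ x s :=
  congrFun (Trivialization.coe_continuousLinearEquivAt_eq (R := ℝ) _ hx) s

variable [ContMDiffVectorBundle ∞ F E (𝓡 n)]

lemma contMDiffAt_frameMap {x₀ : M} {σ : ∀ x, E x} {x : M}
    (hx : x ∈ (trivializationAt F E x₀).baseSet) {m : ℕ∞}
    (hσ : ContMDiffAt (𝓡 n) ((𝓡 n).prod 𝓘(ℝ, F)) m (fun z ↦ TotalSpace.mk' F z (σ z)) x) :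
    ContMDiffAt (𝓡 n) 𝓘(ℝ, F) m (fun z ↦ frameMap F E x₀ z (σ z)) x := by
  have : ContMDiffVectorBundle m F E (𝓡 n) :=
    ContMDiffVectorBundle.of_le (n := ∞) (by exact_mod_cast le_top)
  exact ((Trivialization.contMDiffAt_section_iff _ hx).1 hσ).congr_of_eventuallyEq
    (frameMap_eventuallyEq σ hx)

lemma mdifferentiableAt_frameMap {x₀ : M} {σ : ∀ x, E x} {x : M}
    (hx : x ∈ (trivializationAt F E x₀).baseSet)
    (hσ : MDifferentiableAt (𝓡 n) ((𝓡 n).prod 𝓘(ℝ, F)) (fun z ↦ TotalSpace.mk' F z (σ z)) x) :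
    MDifferentiableAt (𝓡 n) 𝓘(ℝ, F) (fun z ↦ frameMap F E x₀ z (σ z)) x := by
  have : ContMDiffVectorBundle 1 F E (𝓡 n) :=
    ContMDiffVectorBundle.of_le (n := ∞) (by simp)
  exact ((Trivialization.mdifferentiableAt_section_iff _ _ _ hx).1 hσ).congr_of_eventuallyEq
    (frameMap_eventuallyEq σ hx)

/-- The section of `E` with constant coordinates `w` in the frame at `x₀`. -/
def constSection (x₀ : M) (w : F) (x : M) : E x := (trivializationAt F E x₀).symmL ℝ x w

lemma frameMap_constSection {x₀ x : M} (hx : x ∈ (trivializationAt F E x₀).baseSet) (w : F) :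
    frameMap F E x₀ x (constSection x₀ w x) = w :=
  Trivialization.continuousLinearMapAt_symmL _ hx w

lemma contMDiffOn_constSection (x₀ : M) (w : F) :
    ContMDiffOn (𝓡 n) ((𝓡 n).prod 𝓘(ℝ, F)) ∞
      (fun y ↦ TotalSpace.mk' F (E := E) y (constSection x₀ w y))
      (trivializationAt F E x₀).baseSet := by
  rw [Trivialization.contMDiffOn_section_baseSet_iff]
  refine (contMDiffOn_const (c := w)).congr fun x hx ↦ ?_
  exact ((frameMap_eventuallyEq (constSection x₀ w) hx).self_of_nhds).symm.trans
    (frameMap_constSection hx w)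

variable [IsManifold (𝓡 n) ∞ M]

lemma differentiableAt_readSection {x₀ : M} {y : EuclideanSpace ℝ (Fin n)}
    (hy : y ∈ frameDomain F E x₀) {σ : ∀ x, E x}
    (hσ : MDifferentiableAt (𝓡 n) ((𝓡 n).prod 𝓘(ℝ, F)) (fun z ↦ TotalSpace.mk' F z (σ z))
      ((extChartAt (𝓡 n) x₀).symm y)) :
    DifferentiableAt ℝ (readSection (F := F) x₀ σ) y :=
  ((mdifferentiableAt_frameMap hy.2 hσ).comp y
    (mdifferentiableAt_extChartAt_symm hy.1)).differentiableAt

lemma contDiffAt_readSection {x₀ : M} {σ : ∀ x, E x} {y : EuclideanSpace ℝ (Fin n)}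
    (hy : y ∈ frameDomain F E x₀) {m : ℕ∞}
    (hσ : ContMDiffAt (𝓡 n) ((𝓡 n).prod 𝓘(ℝ, F)) m (fun z ↦ TotalSpace.mk' F z (σ z))
      ((extChartAt (𝓡 n) x₀).symm y)) :
    ContDiffAt ℝ m (readSection (F := F) x₀ σ) y := by
  rw [← contMDiffAt_iff_contDiffAt]
  refine ContMDiffAt.comp y (contMDiffAt_frameMap hy.2 hσ) ?_
  exact ((contMDiffOn_extChartAt_symm (n := m) x₀).contMDiffAt
    ((isOpen_extChartAt_target x₀).mem_nhds hy.1))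

end LocalForm

/-! ### Connection and curvature forms -/

section ConnectionForm

variable {n : ℕ} {M : Type*} [TopologicalSpace M]
  [ChartedSpace (EuclideanSpace ℝ (Fin n)) M] [IsManifold (𝓡 n) ∞ M]
  {F : Type*} [NormedAddCommGroup F] [NormedSpace ℂ F]
  {E : M → Type*} [TopologicalSpace (TotalSpace F E)]
  [∀ x, NormedAddCommGroup (E x)] [∀ x, InnerProductSpace ℂ (E x)]
  [FiberBundle F E] [VectorBundle ℝ F E] [ContMDiffVectorBundle ∞ F E (𝓡 n)]

namespace HermitianConnection

variable [FiniteDimensional ℂ F] [IsContMDiffRiemannianBundle (𝓡 n) ∞ F E]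
  (D : HermitianConnection n F E)

lemma fderiv_inner {x₀ : M} {y : EuclideanSpace ℝ (Fin n)} {σ τ : ∀ x, E x}
    (hy : y ∈ (extChartAt (𝓡 n) x₀).target)
    (hσ : MDifferentiableAt (𝓡 n) ((𝓡 n).prod 𝓘(ℝ, F)) (fun z ↦ TotalSpace.mk' F z (σ z))
      ((extChartAt (𝓡 n) x₀).symm y))
    (hτ : MDifferentiableAt (𝓡 n) ((𝓡 n).prod 𝓘(ℝ, F)) (fun z ↦ TotalSpace.mk' F z (τ z))
      ((extChartAt (𝓡 n) x₀).symm y)) (v : EuclideanSpace ℝ (Fin n)) :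
    fderiv ℝ ((fun z ↦ (inner ℝ (σ z) (τ z) : ℝ)) ∘ (extChartAt (𝓡 n) x₀).symm) y v =
      inner ℝ (D.toFun σ _ (coordTangent x₀ y v)) (τ ((extChartAt (𝓡 n) x₀).symm y)) +
        inner ℝ (σ _) (D.toFun τ _ (coordTangent x₀ y v)) := by
  have hmetric := D.metric.mvfderiv_inner_eq (coordField x₀ v) hσ hτ
  simp only [coordField_symm hy] at hmetric
  exact (mvfderiv_coordTangent hy (hσ.inner_bundle hτ) v).symm.trans hmetric

section LocalSections

variable [T2Space M]

lemma contMDiffAt_cov {x : M} {σ : ∀ x, E x} {u : Set M} (hu : IsOpen u) (hxu : x ∈ u)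
    (hσ : ContMDiffOn (𝓡 n) ((𝓡 n).prod 𝓘(ℝ, F)) ∞ (fun y ↦ TotalSpace.mk' F y (σ y)) u) :
    ContMDiffAt (𝓡 n) ((𝓡 n).prod 𝓘(ℝ, EuclideanSpace ℝ (Fin n) →L[ℝ] F)) ∞
      (fun y ↦ TotalSpace.mk' (EuclideanSpace ℝ (Fin n) →L[ℝ] F)
        (E := fun y ↦ TangentSpace (𝓡 n) y →L[ℝ] E y) y (D.toFun σ y)) x := by
  -- Smoothness of `D` is only about global sections, so `σ` is cut off by a bump function `f`.
  obtain ⟨f, hf, -⟩ := (SmoothBumpFunction.nhds_basis_support (I := 𝓡 n)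
    (hu.mem_nhds hxu)).mem_iff.1 (hu.mem_nhds hxu)
  have hfσ := ContMDiffOn.smul_section_of_tsupport (n := ∞) (ψ := f)
    f.contMDiff.contMDiffOn hu hf hσ
  have hD := D.smooth.contMDiff.contMDiff (σ := (f : M → ℝ) • σ)
    (by simpa using hfσ.contMDiffOn)
  refine (hD.contMDiffAt Filter.univ_mem).congr_of_eventuallyEq ?_
  have hf1 : ∀ᶠ y in 𝓝 x, f =ᶠ[𝓝 y] 1 := eventually_eventually_nhds.2 f.eventuallyEq_one
  filter_upwards [hu.mem_nhds hxu, hf1] with y hy hfy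
  congr 1
  refine D.isCovariantDerivativeOnUniv.congr_of_eventuallyEq (s := univ)
    ((hσ.contMDiffAt (hu.mem_nhds hy)).mdifferentiableAt (by simp))
    (hfσ.contMDiffAt.mdifferentiableAt (by simp)) Filter.univ_mem ?_
  filter_upwards [hfy] with z hz
  simp [hz]

lemma mdifferentiableAt_cov_coordField {x₀ x : M} (hx : x ∈ (extChartAt (𝓡 n) x₀).source)
    {σ : ∀ x, E x} {u : Set M} (hu : IsOpen u) (hxu : x ∈ u)
    (hσ : ContMDiffOn (𝓡 n) ((𝓡 n).prod 𝓘(ℝ, F)) ∞ (fun y ↦ TotalSpace.mk' F y (σ y)) u)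
    (v : EuclideanSpace ℝ (Fin n)) :
    MDifferentiableAt (𝓡 n) ((𝓡 n).prod 𝓘(ℝ, F))
      (fun z ↦ TotalSpace.mk' F z (D.toFun σ z (coordField x₀ v z))) x :=
  ((D.contMDiffAt_cov hu hxu hσ).clm_bundle_apply
    (contMDiffAt_coordField hx v)).mdifferentiableAt (by simp)

lemma partialDeriv_partialDeriv_inner_self {x₀ : M} {y : EuclideanSpace ℝ (Fin n)}
    {σ : ∀ x, E x} {u : Set M} (hy : y ∈ (extChartAt (𝓡 n) x₀).target)
    (hu : IsOpen u) (hyu : (extChartAt (𝓡 n) x₀).symm y ∈ u)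
    (hσ : ContMDiffOn (𝓡 n) ((𝓡 n).prod 𝓘(ℝ, F)) ∞ (fun z ↦ TotalSpace.mk' F z (σ z)) u)
    (v w : EuclideanSpace ℝ (Fin n)) :
    partialDeriv id v (partialDeriv id w
        ((fun z ↦ (inner ℝ (σ z) (σ z) : ℝ)) ∘ (extChartAt (𝓡 n) x₀).symm)) y =
      2 * (inner ℝ (D.toFun (fun z ↦ D.toFun σ z (coordField x₀ w z)) _ (coordTangent x₀ y v))
          (σ ((extChartAt (𝓡 n) x₀).symm y)) +
        inner ℝ (D.toFun σ _ (coordTangent x₀ y w)) (D.toFun σ _ (coordTangent x₀ y v))) := by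
  have hσz {z} (hz : z ∈ u) := (hσ.contMDiffAt (hu.mem_nhds hz)).mdifferentiableAt (by simp)
  have hcov := D.mdifferentiableAt_cov_coordField ((extChartAt (𝓡 n) x₀).map_target hy) hu hyu hσ w
  have hinner : MDifferentiableAt (𝓡 n) 𝓘(ℝ, ℝ)
      (fun z ↦ (inner ℝ (D.toFun σ z (coordField x₀ w z)) (σ z) : ℝ))
      ((extChartAt (𝓡 n) x₀).symm y) := hcov.inner_bundle (hσz hyu)
  have hfirst : partialDeriv id w ((fun z ↦ (inner ℝ (σ z) (σ z) : ℝ)) ∘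
        (extChartAt (𝓡 n) x₀).symm) =ᶠ[𝓝 y] fun z ↦ 2 *
      ((fun z ↦ (inner ℝ (D.toFun σ z (coordField x₀ w z)) (σ z) : ℝ)) ∘
        (extChartAt (𝓡 n) x₀).symm) z := by
    filter_upwards [(isOpen_target_inter_preimage x₀ hu).mem_nhds ⟨hy, hyu⟩] with z ⟨hz, hzu⟩
    refine (D.fderiv_inner hz (hσz hzu) (hσz hzu) w).trans ?_
    rw [Function.comp_apply, coordField_symm hz, real_inner_comm, two_mul]
  calc partialDeriv id v (partialDeriv id w _) y
      = partialDeriv id v (fun z ↦ 2 *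
          ((fun z ↦ (inner ℝ (D.toFun σ z (coordField x₀ w z)) (σ z) : ℝ)) ∘
            (extChartAt (𝓡 n) x₀).symm) z) y :=
        congrArg (fun L : EuclideanSpace ℝ (Fin n) →L[ℝ] ℝ ↦ L v) hfirst.fderiv_eq
    _ = 2 * fderiv ℝ ((fun z ↦ (inner ℝ (D.toFun σ z (coordField x₀ w z)) (σ z) : ℝ)) ∘
          (extChartAt (𝓡 n) x₀).symm) y v :=
        partialDeriv_const_mul
          (hinner.comp y (mdifferentiableAt_extChartAt_symm hy)).differentiableAt 2 v
    _ = _ := by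
        rw [D.fderiv_inner hy hcov (hσz hyu) v, coordField_symm hy]

end LocalSections

variable (x₀ : M)

lemma tensorialAt_cov_sub_fderiv {y : EuclideanSpace ℝ (Fin n)} (hy : y ∈ frameDomain F E x₀) :
    TensorialAt (𝓡 n) F (fun σ : ∀ x, E x ↦
      (frameMap F E x₀ ((extChartAt (𝓡 n) x₀).symm y)).comp
        ((D.toFun σ ((extChartAt (𝓡 n) x₀).symm y)).comp (coordTangent x₀ y)) -
      fderiv ℝ (readSection (F := F) x₀ σ) y) ((extChartAt (𝓡 n) x₀).symm y) where
  smul {f σ} hf hσ := by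
    have hread : readSection (F := F) x₀ (f • σ) =
        fun z ↦ (f ∘ (extChartAt (𝓡 n) x₀).symm) z • readSection x₀ σ z :=
      funext fun _ ↦ map_smul (frameMap F E x₀ _) _ _
    have hf' : DifferentiableAt ℝ (f ∘ (extChartAt (𝓡 n) x₀).symm) y :=
      (hf.comp y (mdifferentiableAt_extChartAt_symm hy.1)).differentiableAt
    rw [hread, fderiv_fun_smul hf' (differentiableAt_readSection hy hσ),
      D.isCovariantDerivativeOnUniv.leibniz hσ hf]
    ext v
    have hleibniz {G : Type _} [AddCommGroup G] [Module ℝ G] [TopologicalSpace G] (L : G →L[ℝ] F)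
        (a : ℝ) {c c' : ℝ} (hc : c = c') (d s : G) (p : F) :
        L (a • d + c • s) - (a • p + c' • L s) = a • (L d - p) := by
      rw [map_add, map_smul, map_smul, hc]
      module
    exact hleibniz (frameMap F E x₀ _) _ (mvfderiv_coordTangent hy.1 hf v) _ _ _
  add {σ σ'} hσ hσ' := by
    have hread : readSection (n := n) (F := F) x₀ (σ + σ') =
        fun z ↦ readSection (n := n) x₀ σ z + readSection x₀ σ' z :=
      funext fun _ ↦ map_add (frameMap F E x₀ _) _ _
    rw [hread, fderiv_fun_add (differentiableAt_readSection hy hσ)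
      (differentiableAt_readSection hy hσ'), D.isCovariantDerivativeOnUniv.add hσ hσ']
    ext v
    have hadd {G : Type _} [AddCommGroup G] [Module ℝ G] [TopologicalSpace G] (L : G →L[ℝ] F)
        (d d' : G) (p p' : F) : L (d + d') - (p + p') = L d - p + (L d' - p') := by
      rw [map_add, add_sub_add_comm]
    exact hadd (frameMap F E x₀ _) _ _ _ _

open Classical in
/-- The connection form of `D` in the chart and the frame at `x₀`: the endomorphism valued one-form
`A` with `D = d + A`, evaluated on the constant vector `v` at the point with coordinates `y` (and
zero outside `frameDomain`). -/
def connectionForm (v y : EuclideanSpace ℝ (Fin n)) : F →L[ℝ] F :=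
  if hy : y ∈ frameDomain F E x₀ then
    (ContinuousLinearMap.apply ℝ F v).comp ((TensorialAt.mkHom _ _
      (D.tensorialAt_cov_sub_fderiv x₀ hy)).comp ((trivializationAt F E x₀).symmL ℝ _))
  else 0

lemma frameMap_cov {y : EuclideanSpace ℝ (Fin n)} (hy : y ∈ frameDomain F E x₀) {σ : ∀ x, E x}
    (hσ : MDifferentiableAt (𝓡 n) ((𝓡 n).prod 𝓘(ℝ, F)) (fun z ↦ TotalSpace.mk' F z (σ z))
      ((extChartAt (𝓡 n) x₀).symm y)) (v : EuclideanSpace ℝ (Fin n)) :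
    frameMap F E x₀ _ (D.toFun σ ((extChartAt (𝓡 n) x₀).symm y) (coordTangent x₀ y v)) =
      fderiv ℝ (readSection (F := F) x₀ σ) y v +
        D.connectionForm x₀ v y (readSection (F := F) x₀ σ y) := by
  have hform : D.connectionForm x₀ v y (readSection (F := F) x₀ σ y) =
      frameMap F E x₀ _ (D.toFun σ ((extChartAt (𝓡 n) x₀).symm y) (coordTangent x₀ y v)) -
        fderiv ℝ (readSection (F := F) x₀ σ) y v := by
    rw [connectionForm, dif_pos hy]
    have hsymm := Trivialization.symmL_continuousLinearMapAt (R := ℝ) (trivializationAt F E x₀)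
      hy.2 (σ ((extChartAt (𝓡 n) x₀).symm y))
    refine (congrArg (fun s ↦ TensorialAt.mkHom _ _ (D.tensorialAt_cov_sub_fderiv x₀ hy) s v)
      hsymm).trans ?_
    rw [TensorialAt.mkHom_apply (D.tensorialAt_cov_sub_fderiv x₀ hy) hσ]
    rfl
  rw [hform, add_sub_cancel]

lemma readSection_cov {y : EuclideanSpace ℝ (Fin n)} {σ : ∀ x, E x} {u : Set M}
    (hy : y ∈ frameDomain F E x₀) (hu : IsOpen u)
    (hyu : (extChartAt (𝓡 n) x₀).symm y ∈ u)
    (hσ : ContMDiffOn (𝓡 n) ((𝓡 n).prod 𝓘(ℝ, F)) ∞ (fun z ↦ TotalSpace.mk' F z (σ z)) u)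
    (w : EuclideanSpace ℝ (Fin n)) :
    readSection (F := F) x₀ (fun z ↦ D.toFun σ z (coordField x₀ w z)) =ᶠ[𝓝 y]
      fun z ↦ partialDeriv id w (readSection (F := F) x₀ σ) z +
        D.connectionForm x₀ w z (readSection (F := F) x₀ σ z) := by
  filter_upwards [(isOpen_frameDomain F E x₀).mem_nhds hy,
    (isOpen_target_inter_preimage x₀ hu).mem_nhds ⟨hy.1, hyu⟩] with z hz ⟨_, hzu⟩
  rw [readSection, coordField_symm hz.1,
    D.frameMap_cov x₀ hz ((hσ.contMDiffAt (hu.mem_nhds hzu)).mdifferentiableAt (by simp)) w]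
  rfl

lemma contDiffOn_connectionForm [T2Space M] (v : EuclideanSpace ℝ (Fin n)) :
    ContDiffOn ℝ ∞ (D.connectionForm x₀ v) (frameDomain F E x₀) := by
  rw [contDiffOn_clm_apply]
  intro w y hy
  have hB := (trivializationAt F E x₀).open_baseSet
  have hw := contMDiffOn_constSection (n := n) (E := E) x₀ w
  have hcov := (D.contMDiffAt_cov hB hy.2 hw).clm_bundle_apply
    (contMDiffAt_coordField ((extChartAt (𝓡 n) x₀).map_target hy.1) v)
  -- On constant sections `D` is multiplication by the connection form.
  refine ((contDiffAt_readSection (m := ⊤) hy hcov).congr_of_eventuallyEq ?_).contDiffWithinAt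
  filter_upwards [(isOpen_frameDomain F E x₀).mem_nhds hy] with z hz
  have hread : readSection (F := F) (E := E) x₀ (constSection x₀ w) =ᶠ[𝓝 z] fun _ ↦ w := by
    filter_upwards [(isOpen_frameDomain F E x₀).mem_nhds hz] with t ht
    exact frameMap_constSection ht.2 w
  have hform := D.frameMap_cov x₀ hz
    ((hw.contMDiffAt (hB.mem_nhds hz.2)).mdifferentiableAt (by simp)) v
  rw [hread.fderiv_eq, hread.self_of_nhds] at hform
  rw [readSection, coordField_symm hz.1, hform]
  simp

lemma frameMap_cov_cov [T2Space M] {y : EuclideanSpace ℝ (Fin n)} {σ : ∀ x, E x} {u : Set M}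
    (hy : y ∈ frameDomain F E x₀) (hu : IsOpen u)
    (hyu : (extChartAt (𝓡 n) x₀).symm y ∈ u)
    (hσ : ContMDiffOn (𝓡 n) ((𝓡 n).prod 𝓘(ℝ, F)) ∞ (fun z ↦ TotalSpace.mk' F z (σ z)) u)
    (v w : EuclideanSpace ℝ (Fin n)) :
    frameMap F E x₀ _ (D.toFun (fun z ↦ D.toFun σ z (coordField x₀ w z))
        ((extChartAt (𝓡 n) x₀).symm y) (coordTangent x₀ y v)) =
      partialDeriv id v (partialDeriv id w (readSection (F := F) x₀ σ)) y +
        (partialDeriv id v (D.connectionForm x₀ w) y (readSection (F := F) x₀ σ y) +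
          D.connectionForm x₀ w y (partialDeriv id v (readSection (F := F) x₀ σ) y)) +
        (D.connectionForm x₀ v y (partialDeriv id w (readSection (F := F) x₀ σ) y) +
          (D.connectionForm x₀ v y * D.connectionForm x₀ w y)
            (readSection (F := F) x₀ σ y)) := by
  have hread : ContDiffAt ℝ 2 (readSection (F := F) x₀ σ) y :=
    contDiffAt_readSection (m := 2) hy
      ((hσ.contMDiffAt (hu.mem_nhds hyu)).of_le ENat.LEInfty.out)
  have hread' := hread.differentiableAt (by simp)
  have hform : DifferentiableAt ℝ (D.connectionForm x₀ w) y :=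
    ((D.contDiffOn_connectionForm x₀ w).contDiffAt
      ((isOpen_frameDomain F E x₀).mem_nhds hy)).differentiableAt (by simp)
  have hcov := D.readSection_cov x₀ hy hu hyu hσ w
  rw [D.frameMap_cov x₀ hy (D.mdifferentiableAt_cov_coordField
      ((extChartAt (𝓡 n) x₀).map_target hy.1) hu hyu hσ w), hcov.fderiv_eq, hcov.self_of_nhds,
    fderiv_fun_add (differentiableAt_partialDeriv hread w) (hform.clm_apply hread'),
    fderiv_clm_apply hform hread']
  simp [partialDeriv]
  abel

/-- The curvature form of `D` in the chart and the frame at `x₀`, evaluated on the constant vectors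
`v`, `w` at the point with coordinates `y`. -/
def curvatureForm (v w y : EuclideanSpace ℝ (Fin n)) : F →L[ℝ] F :=
  curvatureAt id (D.connectionForm x₀) y v w

lemma contDiffOn_curvatureForm [T2Space M] (v w : EuclideanSpace ℝ (Fin n)) :
    ContDiffOn ℝ ∞ (D.curvatureForm x₀ v w) (frameDomain F E x₀) := by
  have h (v w) : ContDiffOn ℝ ∞ (partialDeriv id v (D.connectionForm x₀ w)) (frameDomain F E x₀) :=
    ((D.contDiffOn_connectionForm x₀ w).fderiv_of_isOpen (isOpen_frameDomain F E x₀)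
      (by simp)).clm_apply contDiffOn_const
  exact ((h v w).sub (h w v)).add
    (((D.contDiffOn_connectionForm x₀ v).mul (D.contDiffOn_connectionForm x₀ w)).sub
      ((D.contDiffOn_connectionForm x₀ w).mul (D.contDiffOn_connectionForm x₀ v)))

/-- The difference of two connections, as a one-form with values in the endomorphisms of `E`. -/
def diffForm (D' : HermitianConnection n F E) (x : M) :
    TangentSpace (𝓡 n) x →ₗ[ℝ] Module.End ℝ (E x) :=
  (D'.toCovariantDerivative.difference D.toCovariantDerivative x).toLinearMap₁₂.flip

lemma frameMap_diffForm (D' : HermitianConnection n F E) {y : EuclideanSpace ℝ (Fin n)}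
    (hy : y ∈ frameDomain F E x₀) (v : EuclideanSpace ℝ (Fin n))
    (s : E ((extChartAt (𝓡 n) x₀).symm y)) :
    frameMap F E x₀ _ (diffForm D D' _ (coordTangent x₀ y v) s) =
      (D'.connectionForm x₀ v y - D.connectionForm x₀ v y) (frameMap F E x₀ _ s) := by
  have hσ := FiberBundle.mdifferentiableAt_extend (𝓡 n) F s
  have hdiff := IsCovariantDerivativeOn.difference_apply D'.isCovariantDerivativeOnUniv
    D.isCovariantDerivativeOnUniv (mem_univ _) hσ
  rw [FiberBundle.extend_apply_self] at hdiff
  have happly : diffForm D D' _ (coordTangent x₀ y v) s =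
      D'.toFun (FiberBundle.extend F s) _ (coordTangent x₀ y v) -
        D.toFun (FiberBundle.extend F s) _ (coordTangent x₀ y v) :=
    DFunLike.congr_fun hdiff (coordTangent x₀ y v)
  rw [happly, map_sub, D.frameMap_cov x₀ hy hσ, D'.frameMap_cov x₀ hy hσ, readSection,
    FiberBundle.extend_apply_self]
  simp

end HermitianConnection

end ConnectionForm

section CurvatureForm

variable {n : ℕ} {M : Type*} [TopologicalSpace M] [T2Space M]
  [ChartedSpace (EuclideanSpace ℝ (Fin n)) M] [IsManifold (𝓡 n) ∞ M]
  {F : Type*} [NormedAddCommGroup F] [NormedSpace ℂ F] [FiniteDimensional ℂ F]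
  {E : M → Type*} [TopologicalSpace (TotalSpace F E)]
  [∀ x, NormedAddCommGroup (E x)] [∀ x, InnerProductSpace ℂ (E x)]
  [FiberBundle F E] [VectorBundle ℂ F E] [VectorBundle ℝ F E]
  [ContMDiffVectorBundle ∞ F E (𝓡 n)] [IsContMDiffRiemannianBundle (𝓡 n) ∞ F E]

namespace HermitianConnection

variable (D : HermitianConnection n F E)

lemma curvature_eq_curvatureOp {x : M} {X Y : ∀ x : M, TangentSpace (𝓡 n) x}
    (hX : MDifferentiableAt (𝓡 n) ((𝓡 n).prod (𝓡 n))
      (fun y ↦ TotalSpace.mk' (EuclideanSpace ℝ (Fin n)) y (X y)) x)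
    (hY : MDifferentiableAt (𝓡 n) ((𝓡 n).prod (𝓡 n))
      (fun y ↦ TotalSpace.mk' (EuclideanSpace ℝ (Fin n)) y (Y y)) x) (s : E x) :
    D.curvature x ![X x, Y x] s = D.curvatureOp X Y (FiberBundle.extend F s) x :=
  TensorialAt.mkHom₂_apply (fun _ hY ↦ D.curvatureOp_tensorial₁ s hY)
    (fun _ hX ↦ D.curvatureOp_tensorial₂ s hX) hX hY

lemma curvature_coordTangent {x₀ : M} {y : EuclideanSpace ℝ (Fin n)}
    (hy : y ∈ (extChartAt (𝓡 n) x₀).target) (v w : EuclideanSpace ℝ (Fin n))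
    (s : E ((extChartAt (𝓡 n) x₀).symm y)) :
    D.curvature _ ![coordTangent x₀ y v, coordTangent x₀ y w] s =
      D.toFun (fun z ↦ D.toFun (FiberBundle.extend F s) z (coordField x₀ w z)) _
          (coordTangent x₀ y v) -
        D.toFun (fun z ↦ D.toFun (FiberBundle.extend F s) z (coordField x₀ v z)) _
          (coordTangent x₀ y w) := by
  have hx := (extChartAt (𝓡 n) x₀).map_target hy
  have h := D.curvature_eq_curvatureOp (mdifferentiableAt_coordField hx v)
    (mdifferentiableAt_coordField hx w) s
  rwa [curvatureOp, mlieBracket_coordField hx, map_zero, sub_zero, coordField_symm hy,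
    coordField_symm hy] at h

lemma frameMap_curvature {x₀ : M} {y : EuclideanSpace ℝ (Fin n)} (hy : y ∈ frameDomain F E x₀)
    (v w : EuclideanSpace ℝ (Fin n)) (s : E ((extChartAt (𝓡 n) x₀).symm y)) :
    frameMap F E x₀ _ (D.curvature _ ![coordTangent x₀ y v, coordTangent x₀ y w] s) =
      D.curvatureForm x₀ v w y (frameMap F E x₀ _ s) := by
  obtain ⟨t, ht, hσ⟩ := FiberBundle.exists_contMDiffOn_extend (k := ∞) (𝓡 n) F s
  obtain ⟨u, hut, hu, hyu⟩ := mem_nhds_iff.1 ht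
  replace hσ := hσ.mono hut
  have hread : ContDiffAt ℝ 2 (readSection (F := F) x₀ (FiberBundle.extend F s)) y :=
    contDiffAt_readSection (m := 2) hy
      ((hσ.contMDiffAt (hu.mem_nhds hyu)).of_le ENat.LEInfty.out)
  have hs : readSection (F := F) x₀ (FiberBundle.extend F s) y = frameMap F E x₀ _ s := by
    rw [readSection, FiberBundle.extend_apply_self]
  rw [D.curvature_coordTangent hy.1, map_sub, D.frameMap_cov_cov x₀ hy hu hyu hσ,
    D.frameMap_cov_cov x₀ hy hu hyu hσ, hs, partialDeriv_comm hread v w, curvatureForm, curvatureAt,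
    curvatureComp]
  simp
  abel

end HermitianConnection

end CurvatureForm

section Skew

variable {n : ℕ} {M : Type*} [TopologicalSpace M]
  [ChartedSpace (EuclideanSpace ℝ (Fin n)) M] [IsManifold (𝓡 n) ∞ M]

lemma exists_coordTangent_eq {x₀ : M} {y : EuclideanSpace ℝ (Fin n)}
    (hy : y ∈ (extChartAt (𝓡 n) x₀).target)
    (u : TangentSpace (𝓡 n) ((extChartAt (𝓡 n) x₀).symm y)) : ∃ v, u = coordTangent x₀ y v := by
  refine ⟨(trivializationAt (EuclideanSpace ℝ (Fin n))
    (TangentSpace (𝓡 n)) x₀).continuousLinearMapAt ℝ _ u, ?_⟩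
  rw [coordTangent_eq_symmL hy,
    Trivialization.symmL_continuousLinearMapAt _ (extChartAt_symm_mem_baseSet hy)]

variable [T2Space M]
  {F : Type*} [NormedAddCommGroup F] [NormedSpace ℂ F] [FiniteDimensional ℂ F]
  {E : M → Type*} [TopologicalSpace (TotalSpace F E)]
  [∀ x, NormedAddCommGroup (E x)] [∀ x, InnerProductSpace ℂ (E x)]
  [FiberBundle F E] [VectorBundle ℂ F E] [VectorBundle ℝ F E]
  [ContMDiffVectorBundle ∞ F E (𝓡 n)] [IsContMDiffRiemannianBundle (𝓡 n) ∞ F E]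

namespace HermitianConnection

variable (D : HermitianConnection n F E)

/-- Metric compatibility turns `⟨F(v, w) s, s⟩` into the antisymmetrized second derivative of
`|σ|² / 2`, where `σ` extends `s`. -/
lemma inner_curvature_coordTangent_self {x₀ : M} {y : EuclideanSpace ℝ (Fin n)}
    (hy : y ∈ (extChartAt (𝓡 n) x₀).target) (v w : EuclideanSpace ℝ (Fin n))
    (s : E ((extChartAt (𝓡 n) x₀).symm y)) :
    (inner ℝ (D.curvature _ ![coordTangent x₀ y v, coordTangent x₀ y w] s) s : ℝ) = 0 := by
  obtain ⟨t, ht, hσ⟩ := FiberBundle.exists_contMDiffOn_extend (k := ∞) (𝓡 n) F s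
  obtain ⟨u, hut, hu, hyu⟩ := mem_nhds_iff.1 ht
  replace hσ := hσ.mono hut
  have hnormSq : ContMDiffOn (𝓡 n) 𝓘(ℝ, ℝ) ∞
      (fun z ↦ (inner ℝ (FiberBundle.extend F s z) (FiberBundle.extend F s z) : ℝ)) u :=
    hσ.inner_bundle hσ
  have hsmooth : ContDiffAt ℝ 2
      ((fun z ↦ (inner ℝ (FiberBundle.extend F s z) (FiberBundle.extend F s z) : ℝ)) ∘
        (extChartAt (𝓡 n) x₀).symm) y := by
    rw [← contMDiffAt_iff_contDiffAt]
    exact ((hnormSq.contMDiffAt (hu.mem_nhds hyu)).of_le ENat.LEInfty.out).comp y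
      ((contMDiffOn_extChartAt_symm (n := 2) x₀).contMDiffAt
        ((isOpen_extChartAt_target x₀).mem_nhds hy))
  have hcomm := partialDeriv_comm (e := id) hsmooth v w
  rw [D.partialDeriv_partialDeriv_inner_self hy hu hyu hσ,
    D.partialDeriv_partialDeriv_inner_self hy hu hyu hσ, FiberBundle.extend_apply_self,
    real_inner_comm (D.toFun _ _ (coordTangent x₀ y v))] at hcomm
  rw [D.curvature_coordTangent hy, inner_sub_left]
  linarith

lemma inner_curvature_self (x : M) (v : Fin 2 → TangentSpace (𝓡 n) x) (s : E x) :
    (inner ℝ (D.curvature x v s) s : ℝ) = 0 := by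
  obtain ⟨x₀, y, hy, rfl⟩ : ∃ x₀, ∃ y ∈ (extChartAt (𝓡 n) x₀).target,
      (extChartAt (𝓡 n) x₀).symm y = x := ⟨x, _, mem_extChartAt_target x, extChartAt_to_inv x⟩
  obtain ⟨a, ha⟩ := exists_coordTangent_eq hy (v 0)
  obtain ⟨b, hb⟩ := exists_coordTangent_eq hy (v 1)
  have hv : v = ![coordTangent x₀ y a, coordTangent x₀ y b] := by
    rw [← ha, ← hb]
    ext i
    fin_cases i <;> rfl
  rw [hv]
  exact D.inner_curvature_coordTangent_self hy a b s

lemma curvature_skew (x : M) (v : Fin 2 → TangentSpace (𝓡 n) x) (s t : E x) :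
    (inner ℝ (D.curvature x v s) t : ℝ) = -inner ℝ s (D.curvature x v t) := by
  have hpolar := D.inner_curvature_self x v (s + t)
  rw [map_add, inner_add_left, inner_add_right, inner_add_right, D.inner_curvature_self,
    D.inner_curvature_self] at hpolar
  rw [real_inner_comm _ s]
  linarith

/-- The curvature as a bilinear map with values in the real endomorphisms. -/
def curvatureEnd (x : M) :
    TangentSpace (𝓡 n) x →ₗ[ℝ] TangentSpace (𝓡 n) x →ₗ[ℝ] Module.End ℝ (E x) :=
  (twoFormBilin (D.curvature x)).compr₂ (LinearMap.restrictScalarsₗ ℝ ℂ (E x) (E x) ℝ)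

lemma frameMap_curvatureEnd {x₀ : M} {y : EuclideanSpace ℝ (Fin n)}
    (hy : y ∈ frameDomain F E x₀) (v w : EuclideanSpace ℝ (Fin n))
    (s : E ((extChartAt (𝓡 n) x₀).symm y)) :
    frameMap F E x₀ _ (curvatureEnd D _ (coordTangent x₀ y v) (coordTangent x₀ y w) s) =
      D.curvatureForm x₀ v w y (frameMap F E x₀ _ s) :=
  D.frameMap_curvature hy v w s

end HermitianConnection

end Skew

/-! ### The transgression in a local frame -/

section Trace

variable {F : Type*} [NormedAddCommGroup F] [NormedSpace ℝ F] [FiniteDimensional ℝ F]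

variable (F) in
/-- The functional `-tr / 2` on the real endomorphisms of `F`. For a complex linear endomorphism it
is `-Re tr`, as the real trace is twice the real part of the complex trace. -/
def halfTrace : (F →L[ℝ] F) →L[ℝ] ℝ :=
  LinearMap.toContinuousLinearMap
    ((-(1 / 2 : ℝ)) • (LinearMap.trace ℝ F ∘ₗ ContinuousLinearMap.coeLM ℝ))

lemma halfTrace_apply (P : F →L[ℝ] F) :
    halfTrace F P = -(1 / 2) * LinearMap.trace ℝ F (P : F →ₗ[ℝ] F) := rfl

lemma halfTrace_mul_comm (P Q : F →L[ℝ] F) : halfTrace F (P * Q) = halfTrace F (Q * P) := by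
  rw [halfTrace_apply, halfTrace_apply]
  congr 1
  exact LinearMap.trace_mul_comm ℝ (P : Module.End ℝ F) (Q : Module.End ℝ F)

lemma neg_half_trace_eq_halfTrace_of_intertwine {G : Type*} [AddCommGroup G] [Module ℝ G]
    (L : G ≃ₗ[ℝ] F) (A : Module.End ℝ G) (P : F →L[ℝ] F) (h : ∀ s, L (A s) = P (L s)) :
    -(1 / 2) * LinearMap.trace ℝ G A = halfTrace F P := by
  rw [halfTrace_apply, ← LinearMap.trace_conj' A L]
  congr 2
  ext w
  simp [LinearEquiv.conj_apply, h]

end Trace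

section MulTransgression

variable {V G : Type*} [AddCommGroup V] [Module ℝ V] [AddCommGroup G] [Module ℝ G]

/-- The tensor `ℓ ⊗ (tr(a ⊗ K) - 2 tr(a ⊗ a ⊗ a) / 3) / 2`, with `tr` standing for `-tr / 2`. For
`a` the difference and `K` the sum of the curvatures of two connections, the second factor is
`transgression` in any frame. -/
def mulTransgression (ℓ : V →ₗ[ℝ] ℝ) (a : V →ₗ[ℝ] Module.End ℝ G)
    (K : V →ₗ[ℝ] V →ₗ[ℝ] Module.End ℝ G) : MultilinearMap ℝ (fun _ : Fin 4 ↦ V) ℝ :=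
  MultilinearMap.mk' (fun v ↦ ℓ (v 0) *
      ((1 / 2) * (-(1 / 2) * LinearMap.trace ℝ G (a (v 1) * K (v 2) (v 3))) -
        (1 / 3) * (-(1 / 2) * LinearMap.trace ℝ G (a (v 1) * a (v 2) * a (v 3)))))
    (fun v i u w ↦ by
      fin_cases i <;> simp [mul_add, add_mul] <;> ring)
    (fun v i c u ↦ by
      fin_cases i <;> simp <;> ring)

end MulTransgression

section LocalExpressions

variable {n : ℕ} {M : Type*} [TopologicalSpace M]
  [ChartedSpace (EuclideanSpace ℝ (Fin n)) M] [IsManifold (𝓡 n) ∞ M]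
  {F : Type*} [NormedAddCommGroup F] [NormedSpace ℂ F] [FiniteDimensional ℂ F]
  {E : M → Type*} [TopologicalSpace (TotalSpace F E)]
  [∀ x, NormedAddCommGroup (E x)] [∀ x, InnerProductSpace ℂ (E x)]
  [FiberBundle F E] [VectorBundle ℝ F E]
  [ContMDiffVectorBundle ∞ F E (𝓡 n)] [IsContMDiffRiemannianBundle (𝓡 n) ∞ F E]

namespace HermitianConnection

variable (D D' : HermitianConnection n F E) {x₀ : M} {y : EuclideanSpace ℝ (Fin n)}

lemma trace_diffForm_cube (hy : y ∈ frameDomain F E x₀) (a b c : EuclideanSpace ℝ (Fin n)) :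
    -(1 / 2) * LinearMap.trace ℝ (E ((extChartAt (𝓡 n) x₀).symm y))
      (diffForm D D' _ (coordTangent x₀ y a) * diffForm D D' _ (coordTangent x₀ y b) *
        diffForm D D' _ (coordTangent x₀ y c)) =
    halfTrace F ((D'.connectionForm x₀ a y - D.connectionForm x₀ a y) *
      (D'.connectionForm x₀ b y - D.connectionForm x₀ b y) *
        (D'.connectionForm x₀ c y - D.connectionForm x₀ c y)) := by
  refine neg_half_trace_eq_halfTrace_of_intertwine (frameEquiv hy.2) _ _ fun s ↦ ?_
  rw [frameEquiv_apply, frameEquiv_apply]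
  refine (D.frameMap_diffForm x₀ D' hy a _).trans (congrArg _ ?_)
  refine (D.frameMap_diffForm x₀ D' hy b _).trans (congrArg _ ?_)
  exact D.frameMap_diffForm x₀ D' hy c _

variable [T2Space M]

/-- The transgression tensor in the chart and the frame at `x₀`. -/
def transgressionComp (x₀ : M) (a b c y : EuclideanSpace ℝ (Fin n)) : ℝ :=
  transgression (halfTrace F) (fun v ↦ D'.connectionForm x₀ v y - D.connectionForm x₀ v y)
    (fun v w ↦ D.curvatureForm x₀ v w y) (fun v w ↦ D'.curvatureForm x₀ v w y) a b c

lemma contDiffOn_transgressionComp (x₀ : M) (a b c : EuclideanSpace ℝ (Fin n)) :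
    ContDiffOn ℝ ∞ (transgressionComp D D' x₀ a b c) (frameDomain F E x₀) := by
  have h (v) := (D'.contDiffOn_connectionForm x₀ v).sub (D.contDiffOn_connectionForm x₀ v)
  have hτ {P : EuclideanSpace ℝ (Fin n) → F →L[ℝ] F} (hP : ContDiffOn ℝ ∞ P (frameDomain F E x₀)) :
      ContDiffOn ℝ ∞ (fun y ↦ halfTrace F (P y)) (frameDomain F E x₀) :=
    (halfTrace F).contDiff.comp_contDiffOn hP
  exact (contDiffOn_const.mul (hτ ((h a).mul
      ((D.contDiffOn_curvatureForm x₀ b c).add (D'.contDiffOn_curvatureForm x₀ b c))))).sub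
    (contDiffOn_const.mul (hτ (((h a).mul (h b)).mul (h c))))

variable [VectorBundle ℂ F E]

lemma tracePairing_curvature (hy : y ∈ frameDomain F E x₀) (a b c d : EuclideanSpace ℝ (Fin n)) :
    tracePairing (E ((extChartAt (𝓡 n) x₀).symm y))
      (D.curvature _ ![coordTangent x₀ y a, coordTangent x₀ y b])
      (D.curvature _ ![coordTangent x₀ y c, coordTangent x₀ y d]) =
    halfTrace F (D.curvatureForm x₀ a b y * D.curvatureForm x₀ c d y) := by
  have : FiniteDimensional ℂ (E ((extChartAt (𝓡 n) x₀).symm y)) :=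
    ((trivializationAt F E x₀).linearEquivAt ℂ _ hy.2).symm.finiteDimensional
  rw [tracePairing_eq]
  refine neg_half_trace_eq_halfTrace_of_intertwine (frameEquiv hy.2) _ _ fun s ↦ ?_
  rw [frameEquiv_apply, frameEquiv_apply]
  refine (D.frameMap_curvature hy a b _).trans ?_
  exact congrArg _ (D.frameMap_curvature hy c d s)

/-- The sum of the curvatures of two connections. -/
def curvatureEndSum (x : M) :
    TangentSpace (𝓡 n) x →ₗ[ℝ] TangentSpace (𝓡 n) x →ₗ[ℝ] Module.End ℝ (E x) :=
  curvatureEnd D x + curvatureEnd D' x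

lemma trace_diffForm_mul_curvatureEndSum (hy : y ∈ frameDomain F E x₀)
    (a b c : EuclideanSpace ℝ (Fin n)) :
    -(1 / 2) * LinearMap.trace ℝ (E ((extChartAt (𝓡 n) x₀).symm y))
      (diffForm D D' _ (coordTangent x₀ y a) *
        curvatureEndSum D D' _ (coordTangent x₀ y b) (coordTangent x₀ y c)) =
    halfTrace F ((D'.connectionForm x₀ a y - D.connectionForm x₀ a y) *
      (D.curvatureForm x₀ b c y + D'.curvatureForm x₀ b c y)) := by
  refine neg_half_trace_eq_halfTrace_of_intertwine (frameEquiv hy.2) _ _ fun s ↦ ?_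
  rw [frameEquiv_apply, frameEquiv_apply]
  refine (D.frameMap_diffForm x₀ D' hy a _).trans (congrArg _ ?_)
  refine (map_add (frameMap F E x₀ _) _ _).trans ?_
  exact congrArg₂ (· + ·) (frameMap_curvatureEnd D hy b c s) (frameMap_curvatureEnd D' hy b c s)

lemma mulTransgression_coordTangent (hy : y ∈ frameDomain F E x₀)
    (ℓ : TangentSpace (𝓡 n) ((extChartAt (𝓡 n) x₀).symm y) →ₗ[ℝ] ℝ)
    (a b c d : EuclideanSpace ℝ (Fin n)) :
    mulTransgression ℓ (diffForm D D' _) (curvatureEndSum D D' _)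
      ![coordTangent x₀ y a, coordTangent x₀ y b, coordTangent x₀ y c, coordTangent x₀ y d] =
    ℓ (coordTangent x₀ y a) * transgressionComp D D' x₀ b c d y := by
  rw [transgressionComp, transgression, ← trace_diffForm_mul_curvatureEndSum D D' hy,
    ← trace_diffForm_cube D D' hy]
  rfl

end HermitianConnection

end LocalExpressions

section Sign

lemma sqrt_det_gram_eq_abs_volumeForm {V : Type*} [NormedAddCommGroup V] [InnerProductSpace ℝ V]
    {n : ℕ} [hn : Fact (Module.finrank ℝ V = n)] [Module.Finite ℝ V]
    (o : Orientation ℝ V (Fin n)) (v : Fin n → V) : √(Matrix.gram ℝ v).det = |o.volumeForm v| := by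
  have e : OrthonormalBasis (Fin n) ℝ V := (stdOrthonormalBasis ℝ V).reindex (finCongr hn.out)
  rw [o.volumeForm_robust' e, Matrix.gram_eq_conjTranspose_mul e v, Matrix.det_mul,
    Matrix.conjTranspose_eq_transpose_of_trivial, Matrix.det_transpose, Real.sqrt_mul_self_eq_abs,
    Module.Basis.det_apply]
  rfl

lemma volumeForm_basis_eq {V : Type*} [NormedAddCommGroup V] [InnerProductSpace ℝ V] {n : ℕ}
    [Nonempty (Fin n)] [hn : Fact (Module.finrank ℝ V = n)] [Module.Finite ℝ V]
    (o : Orientation ℝ V (Fin n)) (b : Module.Basis (Fin n) ℝ V) [Decidable (b.orientation = o)] :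
    o.volumeForm b = (if b.orientation = o then 1 else -1) * |o.volumeForm b| := by
  let e₀ : OrthonormalBasis (Fin n) ℝ V := (stdOrthonormalBasis ℝ V).reindex (finCongr hn.out)
  let e := e₀.adjustToOrientation o
  have he : e.toBasis.orientation = o := e₀.orientation_adjustToOrientation o
  rw [o.volumeForm_robust e he]
  have h := e.toBasis.orientation_eq_iff_det_pos b
  rw [he, eq_comm] at h
  split_ifs with hb
  · rw [one_mul, abs_of_pos (h.1 hb)]
  · rw [abs_of_nonpos (not_lt.1 (mt h.2 hb))]
    ring

variable {n : ℕ} {M : Type*} [TopologicalSpace M]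
  [ChartedSpace (EuclideanSpace ℝ (Fin n)) M] [IsManifold (𝓡 n) ∞ M]
  [RiemannianBundle (fun x : M ↦ TangentSpace (𝓡 n) x)]

/-- The set of points of the chart at `x₀` where the orientation of the coordinate frame agrees, up
to the sign `s`, with the orientation of the manifold. -/
def signDomain (o : ManifoldOrientation n M) (x₀ : M) (s : ℝ) : Set (EuclideanSpace ℝ (Fin n)) :=
  interior {y | ∃ hy : y ∈ (extChartAt (𝓡 n) x₀).target,
    o.volumeForm ((extChartAt (𝓡 n) x₀).symm y) (coordBasis hy) = s * chartDensity x₀ y}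

lemma chartDensity_eq_abs_volumeForm (o : ManifoldOrientation n M) {x₀ : M}
    {y : EuclideanSpace ℝ (Fin n)} (hy : y ∈ (extChartAt (𝓡 n) x₀).target) :
    chartDensity x₀ y = |o.volumeForm ((extChartAt (𝓡 n) x₀).symm y) (coordBasis hy)| := by
  rw [ManifoldOrientation.volumeForm, ← sqrt_det_gram_eq_abs_volumeForm,
    funext (coordBasis_apply hy)]
  rfl

lemma exists_mem_signDomain [Nonempty (Fin n)] (o : ManifoldOrientation n M) (x₀ : M) :
    ∃ s : ℝ, s * s = 1 ∧ extChartAt (𝓡 n) x₀ x₀ ∈ signDomain o x₀ s := by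
  classical
  obtain ⟨o₀, ho⟩ := o.locallyConstant x₀
  refine ⟨if (EuclideanSpace.basisFun (Fin n) ℝ).toBasis.orientation = o₀ then 1 else -1,
    by split_ifs <;> norm_num, mem_interior_iff_mem_nhds.2 ?_⟩
  have hcont := (continuousOn_extChartAt_symm x₀).continuousAt
    ((isOpen_extChartAt_target (I := 𝓡 n) x₀).mem_nhds (mem_extChartAt_target x₀))
  rw [ContinuousAt, extChartAt_to_inv] at hcont
  filter_upwards [hcont.eventually ho,
    (isOpen_extChartAt_target (I := 𝓡 n) x₀).mem_nhds (mem_extChartAt_target x₀)] with y hy hyt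
  refine ⟨hyt, ?_⟩
  have horient := hy (extChartAt_symm_mem_baseSet hyt)
  rw [chartDensity_eq_abs_volumeForm o hyt]
  refine (volumeForm_basis_eq (o.at' _) (coordBasis hyt)).trans ?_
  congr 2
  rw [eq_iff_iff, ← horient, coordBasis, Module.Basis.orientation_map]
  have hmap := DFunLike.congr_fun (Orientation.map_symm (Fin n)
    ((trivializationAt (EuclideanSpace ℝ (Fin n)) (TangentSpace (𝓡 n)) x₀).linearEquivAt ℝ _
      (extChartAt_symm_mem_baseSet hyt))) (EuclideanSpace.basisFun (Fin n) ℝ).toBasis.orientation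
  exact ((congrArg (· = o.at' _) hmap).symm.to_iff).trans (Equiv.symm_apply_eq _)

end Sign

section ChartComponents

lemma continuous_of_continuousAt_extChartAt_symm {𝕜 V H M X : Type*} [NontriviallyNormedField 𝕜]
    [NormedAddCommGroup V] [NormedSpace 𝕜 V] [TopologicalSpace H] (I : ModelWithCorners 𝕜 V H)
    [TopologicalSpace M] [ChartedSpace H M] [TopologicalSpace X] {f : M → X}
    (h : ∀ x₀ : M, ContinuousAt (fun y ↦ f ((extChartAt I x₀).symm y)) (extChartAt I x₀ x₀)) :
    Continuous f := by
  refine continuous_iff_continuousAt.2 fun x₀ ↦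
    ((h x₀).comp (continuousAt_extChartAt x₀)).congr ?_
  filter_upwards [extChartAt_source_mem_nhds (I := I) x₀] with x hx
  exact congrArg f ((extChartAt I x₀).left_inv hx)

lemma continuousOn_altSum {X ι : Type*} [TopologicalSpace X] {k : ℕ} (v : Fin (k + 4) → ι)
    {g : X → ι → ι → ι → ι → ℝ} {f : X → (Fin k → ι) → ℝ} {S : Set X}
    (hg : ∀ a b c d, ContinuousOn (fun y ↦ g y a b c d) S)
    (hf : ∀ t, ContinuousOn (fun y ↦ f y t) S) :
    ContinuousOn (fun y ↦ altSum v (g y) (f y)) S :=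
  continuousOn_finsetSum _ fun _ _ ↦ continuousOn_const.mul ((hg _ _ _ _).mul (hf _))

lemma continuousOn_matrix_inv {X ι K : Type*} [TopologicalSpace X] [Fintype ι] [DecidableEq ι]
    [Field K] [TopologicalSpace K] [IsTopologicalRing K] [ContinuousInv₀ K] {G : X → Matrix ι ι K}
    {S : Set X} (hG : ContinuousOn G S) (h : ∀ y ∈ S, (G y).det ≠ 0) :
    ContinuousOn (fun y ↦ (G y)⁻¹) S := fun y hy ↦ by
  have hinv : ContinuousAt Ring.inverse (G y).det := by
    rw [Ring.inverse_eq_inv']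
    exact continuousAt_inv₀ (h y hy)
  exact (continuousAt_matrix_inv _ hinv).comp_continuousWithinAt (hG y hy)

variable {n k : ℕ} {M : Type*} [TopologicalSpace M] [ChartedSpace (EuclideanSpace ℝ (Fin n)) M]

/-- The components of a differential form in the chart at `x₀`. -/
def DForm.comp (Φ : DForm n M k) (x₀ : M) (y : EuclideanSpace ℝ (Fin n)) (t : Fin k → Fin n) : ℝ :=
  Φ.inChart x₀ y fun j ↦ EuclideanSpace.single (t j) (1 : ℝ)

lemma DForm.continuousOn_comp {Φ : DForm n M k} (hΦ : Φ.IsSmooth) (x₀ : M) (t : Fin k → Fin n) :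
    ContinuousOn (fun y ↦ Φ.comp x₀ y t) (extChartAt (𝓡 n) x₀).target :=
  ((ContinuousAlternatingMap.apply ℝ _ ℝ
    (fun j ↦ EuclideanSpace.single (t j) (1 : ℝ))).contDiff.comp_contDiffOn (hΦ x₀)).continuousOn

variable {x₀ : M} {y : EuclideanSpace ℝ (Fin n)}

lemma DForm.comp_eq [IsManifold (𝓡 n) 1 M] (Φ : DForm n M k)
    (hy : y ∈ (extChartAt (𝓡 n) x₀).target) (t : Fin k → Fin n) :
    Φ.comp x₀ y t = (Φ ((extChartAt (𝓡 n) x₀).symm y)) fun j ↦ coordBasis hy (t j) := by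
  simp only [coordBasis_apply]
  rfl

lemma continuousOn_partialDeriv_comp_extChartAt_symm {ι : Type*} [IsManifold (𝓡 n) ∞ M]
    (x₀ : M) (e : ι → EuclideanSpace ℝ (Fin n)) (i : ι) {ρ : M → ℝ}
    (hρ : ContMDiff (𝓡 n) 𝓘(ℝ, ℝ) ∞ ρ) :
    ContinuousOn (partialDeriv e i (ρ ∘ (extChartAt (𝓡 n) x₀).symm))
      (extChartAt (𝓡 n) x₀).target := by
  have hchart : ContDiffOn ℝ ∞ (ρ ∘ (extChartAt (𝓡 n) x₀).symm) (extChartAt (𝓡 n) x₀).target :=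
    contMDiffOn_iff_contDiffOn.1 (hρ.comp_contMDiffOn (contMDiffOn_extChartAt_symm x₀))
  exact (hchart.continuousOn_fderiv_of_isOpen (isOpen_extChartAt_target x₀) (by simp)).clm_apply
    continuousOn_const

variable [RiemannianBundle (fun x : M ↦ TangentSpace (𝓡 n) x)]

/-- The Gram matrix of the coordinate frame of the chart at `x₀`. -/
def coordGram (x₀ : M) (y : EuclideanSpace ℝ (Fin n)) : Matrix (Fin n) (Fin n) ℝ :=
  Matrix.gram ℝ fun i ↦ coordTangent x₀ y (EuclideanSpace.single i (1 : ℝ))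

lemma chartDensity_mul_div_volumeForm [IsManifold (𝓡 n) ∞ M] {o : ManifoldOrientation n M} {s : ℝ}
    (hs : s * s = 1) (hy : y ∈ signDomain o x₀ s) (hyt : y ∈ (extChartAt (𝓡 n) x₀).target)
    (a : ℝ) : chartDensity x₀ y *
      (a / o.volumeForm ((extChartAt (𝓡 n) x₀).symm y) (coordBasis hyt)) = s * a := by
  obtain ⟨_, hvol⟩ := interior_subset hy
  have hdensity : chartDensity x₀ y ≠ 0 := (chartDensity_pos hyt).ne'
  have hs0 : s ≠ 0 := left_ne_zero_of_mul_eq_one hs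
  rw [hvol]
  field_simp
  linear_combination -a * hs

variable [IsManifold (𝓡 n) ∞ M]
  [IsContMDiffRiemannianBundle (𝓡 n) ∞ (EuclideanSpace ℝ (Fin n))
      (fun x : M ↦ TangentSpace (𝓡 n) x)]

lemma continuousOn_coordGram_inv (x₀ : M) (i j : Fin n) :
    ContinuousOn (fun y ↦ (coordGram x₀ y)⁻¹ i j) (extChartAt (𝓡 n) x₀).target := by
  have hgram : ContinuousOn (coordGram x₀) (extChartAt (𝓡 n) x₀).target :=
    continuousOn_pi.2 fun i ↦ continuousOn_pi.2 fun j ↦ (contDiffOn_chartMetric x₀ _ _).continuousOn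
  have hinv := continuousOn_matrix_inv hgram fun y hy ↦ (Real.sqrt_pos.1 (chartDensity_pos hy)).ne'
  exact continuousOn_pi.1 (continuousOn_pi.1 hinv i) j

lemma continuous_of_continuousAt_chartDensity_mul {f : M → ℝ}
    (h : ∀ x₀, ContinuousAt (fun y ↦ chartDensity x₀ y * f ((extChartAt (𝓡 n) x₀).symm y))
      (extChartAt (𝓡 n) x₀ x₀)) : Continuous f := by
  refine continuous_of_continuousAt_extChartAt_symm (𝓡 n) fun x₀ ↦ ?_
  have htarget := (isOpen_extChartAt_target (I := 𝓡 n) x₀).mem_nhds (mem_extChartAt_target x₀)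
  have hdensity := (continuousOn_chartDensity x₀).continuousAt htarget
  refine ((hdensity.inv₀ (chartDensity_pos (mem_extChartAt_target x₀)).ne').mul (h x₀)).congr ?_
  filter_upwards [htarget] with y hy
  exact inv_mul_cancel_left₀ (chartDensity_pos hy).ne' _

end ChartComponents

section LocalDomain

variable {n : ℕ} {M : Type*} [TopologicalSpace M]
  [ChartedSpace (EuclideanSpace ℝ (Fin n)) M] [IsManifold (𝓡 n) ∞ M]
  [RiemannianBundle (fun x : M ↦ TangentSpace (𝓡 n) x)]
  (F : Type*) [NormedAddCommGroup F]
  (E : M → Type*) [TopologicalSpace (TotalSpace F E)] [∀ x, NormedAddCommGroup (E x)]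
  [FiberBundle F E]

/-- A domain in the chart at `x₀` where `E` is trivialized and the orientation of the coordinate
frame is, up to the sign `s`, that of the manifold. -/
def localDomain (o : ManifoldOrientation n M) (x₀ : M) (s : ℝ) : Set (EuclideanSpace ℝ (Fin n)) :=
  frameDomain F E x₀ ∩ signDomain o x₀ s

lemma localDomain_subset_target (o : ManifoldOrientation n M) (x₀ : M) (s : ℝ) :
    localDomain F E o x₀ s ⊆ (extChartAt (𝓡 n) x₀).target := fun _ hy ↦ hy.1.1

lemma isOpen_localDomain (o : ManifoldOrientation n M) (x₀ : M) (s : ℝ) :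
    IsOpen (localDomain F E o x₀ s) :=
  (isOpen_frameDomain F E x₀).inter isOpen_interior

lemma exists_mem_localDomain [Nonempty (Fin n)] (o : ManifoldOrientation n M) (x₀ : M) :
    ∃ s : ℝ, s * s = 1 ∧ extChartAt (𝓡 n) x₀ x₀ ∈ localDomain F E o x₀ s := by
  obtain ⟨s, hs, hx⟩ := exists_mem_signDomain o x₀
  exact ⟨s, hs, mem_frameDomain F E x₀, hx⟩

end LocalDomain

section Densities

variable {k : ℕ} {M : Type*} [TopologicalSpace M] [T2Space M]
  [ChartedSpace (EuclideanSpace ℝ (Fin (k + 4))) M] [IsManifold (𝓡 (k + 4)) ∞ M]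
  {F : Type*} [NormedAddCommGroup F] [NormedSpace ℂ F] [FiniteDimensional ℂ F]
  {E : M → Type*} [TopologicalSpace (TotalSpace F E)]
  [∀ x, NormedAddCommGroup (E x)] [∀ x, InnerProductSpace ℂ (E x)]
  [FiberBundle F E] [VectorBundle ℝ F E]
  [ContMDiffVectorBundle ∞ F E (𝓡 (k + 4))] [IsContMDiffRiemannianBundle (𝓡 (k + 4)) ∞ F E]

namespace HermitianConnection

variable (D D' : HermitianConnection (k + 4) F E)

/-- The products of the components of the curvature in the chart and the frame at `x₀`, paired by
`halfTrace`. -/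
def curvaturePairing (x₀ : M) (y : EuclideanSpace ℝ (Fin (k + 4))) (a b c d : Fin (k + 4)) : ℝ :=
  halfTrace F
    (D.curvatureForm x₀ (EuclideanSpace.single a 1) (EuclideanSpace.single b 1) y *
      D.curvatureForm x₀ (EuclideanSpace.single c 1) (EuclideanSpace.single d 1) y)

/-- The components of the transgression tensor in the chart and the frame at `x₀`, with respect to
the standard basis. -/
def transgressionCoord (x₀ : M) (a b c : Fin (k + 4)) : EuclideanSpace ℝ (Fin (k + 4)) → ℝ :=
  transgressionComp D D' x₀ (EuclideanSpace.single a 1) (EuclideanSpace.single b 1)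
    (EuclideanSpace.single c 1)

variable {D} in
lemma continuousOn_curvaturePairing (x₀ : M) (a b c d : Fin (k + 4)) :
    ContinuousOn (fun y ↦ D.curvaturePairing x₀ y a b c d) (frameDomain F E x₀) :=
  (halfTrace F).continuous.comp_continuousOn ((D.contDiffOn_curvatureForm x₀ _ _).continuousOn.mul
    (D.contDiffOn_curvatureForm x₀ _ _).continuousOn)

lemma altSum_partialDeriv_transgressionCoord {x₀ : M} {y : EuclideanSpace ℝ (Fin (k + 4))}
    (hy : y ∈ frameDomain F E x₀) (f : (Fin k → Fin (k + 4)) → ℝ) :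
    altSum id (fun i a b c ↦ partialDeriv (fun i ↦ EuclideanSpace.single i (1 : ℝ)) i
      (transgressionCoord D D' x₀ a b c) y) f = (1 / 4) *
        (altSum id (D'.curvaturePairing x₀ y) f - altSum id (D.curvaturePairing x₀ y) f) := by
  have hA (D : HermitianConnection (k + 4) F E) (i : Fin (k + 4)) :
      ContDiffAt ℝ 2 (D.connectionForm x₀ (EuclideanSpace.single i 1)) y :=
    ((D.contDiffOn_connectionForm x₀ _).contDiffAt
      ((isOpen_frameDomain F E x₀).mem_nhds hy)).of_le ENat.LEInfty.out
  exact altSum_partialDeriv_transgression (e := fun i ↦ EuclideanSpace.single i (1 : ℝ)) id f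
    halfTrace_mul_comm (hA D) (hA D')

variable [VectorBundle ℂ F E] [RiemannianBundle (fun x : M ↦ TangentSpace (𝓡 (k + 4)) x)]
  (o : ManifoldOrientation (k + 4) M) (Φ : DForm (k + 4) M k)

/-- The function `q_Φ(F_A)`. -/
def calibDensity (x : M) : ℝ :=
  qForm (tracePairing (E x)) (o.volumeForm x) (Φ x).toAlternatingMap (D.curvature x)

/-- The quotient of `ℓ ∧ T ∧ Φ` by the volume form, where `T` is the transgression form, up to a
constant factor. -/
def transgressionDensity (x : M) (ℓ : TangentSpace (𝓡 (k + 4)) x →ₗ[ℝ] ℝ) : ℝ :=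
  topQuotient (MultilinearMap.alternatization (mulTensorFour
    (mulTransgression ℓ (diffForm D D' x) (curvatureEndSum D D' x))
    (Φ x).toAlternatingMap.toMultilinearMap)) (o.volumeForm x)

lemma transgressionDensity_sum {κ : Type*} [Fintype κ] (x : M)
    (ℓ : κ → TangentSpace (𝓡 (k + 4)) x →ₗ[ℝ] ℝ) :
    transgressionDensity D D' o Φ x (∑ j, ℓ j) = ∑ j, transgressionDensity D D' o Φ x (ℓ j) := by
  let v : Module.Basis (Fin (k + 4)) ℝ (TangentSpace (𝓡 (k + 4)) x) :=
    Module.finBasisOfFinrankEq ℝ _ Fact.out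
  simp only [transgressionDensity, topQuotient_alternatization_mulTensorFour _ _ _ v]
  rw [← Finset.sum_div, ← altSum_sum]
  exact congrArg (· / _) (altSum_congr fun a b c d ↦
    (congrArg (· * _) (LinearMap.sum_apply _ _ _)).trans (Finset.sum_mul _ _ _))

lemma transgressionDensity_zero (x : M) : transgressionDensity D D' o Φ x 0 = 0 := by
  simpa using transgressionDensity_sum D D' o Φ (κ := Empty) x Empty.elim

variable {x₀ : M} {y : EuclideanSpace ℝ (Fin (k + 4))}

lemma curvatureNormSq_symm (hy : y ∈ frameDomain F E x₀) :
    D.curvatureNormSq ((extChartAt (𝓡 (k + 4)) x₀).symm y) =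
      (1 / 2) * ∑ i, ∑ j, ∑ p, ∑ q, (coordGram x₀ y)⁻¹ i j *
        ((coordGram x₀ y)⁻¹ p q * D.curvaturePairing x₀ y i p j q) := by
  rw [curvatureNormSq, normSqForm_eq_sum_inv_gram _ _ (coordBasis hy.1)]
  simp only [coordBasis_apply, D.tracePairing_curvature hy, funext (coordBasis_apply hy.1)]
  rfl

variable {o Φ} {s : ℝ}

lemma chartDensity_mul_calibDensity_symm (hs : s * s = 1) (hy : y ∈ localDomain F E o x₀ s) :
    chartDensity x₀ y * D.calibDensity o Φ ((extChartAt (𝓡 (k + 4)) x₀).symm y) =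
      s * (4 * (k.factorial : ℝ))⁻¹ * altSum id (D.curvaturePairing x₀ y) (Φ.comp x₀ y) := by
  rw [calibDensity, qForm_eq_altSum _ _ _ _ (coordBasis hy.1.1), mul_left_comm,
    chartDensity_mul_div_volumeForm hs hy.2, mul_left_comm, mul_assoc]
  refine congrArg _ (congrArg _ (Finset.sum_congr rfl fun σ _ ↦
    congrArg _ (congrArg₂ _ ?_ (Φ.comp_eq hy.1.1 _).symm)))
  simp only [coordBasis_apply]
  exact D.tracePairing_curvature hy.1 _ _ _ _

lemma chartDensity_mul_transgressionDensity_symm (hs : s * s = 1)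
    (hy : y ∈ localDomain F E o x₀ s)
    (ℓ : TangentSpace (𝓡 (k + 4)) ((extChartAt (𝓡 (k + 4)) x₀).symm y) →ₗ[ℝ] ℝ) :
    chartDensity x₀ y * transgressionDensity D D' o Φ _ ℓ =
      s * altSum id (fun i a b c ↦ ℓ (coordTangent x₀ y (EuclideanSpace.single i 1)) *
        transgressionCoord D D' x₀ a b c y) (Φ.comp x₀ y) := by
  rw [transgressionDensity,
    topQuotient_alternatization_mulTensorFour _ _ _ (coordBasis hy.1.1),
    chartDensity_mul_div_volumeForm hs hy.2]
  refine congrArg _ (Finset.sum_congr rfl fun σ _ ↦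
    congrArg _ (congrArg₂ _ ?_ (Φ.comp_eq hy.1.1 _).symm))
  simp only [coordBasis_apply]
  exact mulTransgression_coordTangent D D' hy.1 ℓ _ _ _ _

lemma chartDensity_mul_transgressionDensity_mvfderiv (hs : s * s = 1)
    (hy : y ∈ localDomain F E o x₀ s) {ρ : M → ℝ} (hρ : ContMDiff (𝓡 (k + 4)) 𝓘(ℝ, ℝ) ∞ ρ) :
    chartDensity x₀ y * transgressionDensity D D' o Φ ((extChartAt (𝓡 (k + 4)) x₀).symm y)
        (mvfderiv (𝓡 (k + 4)) ρ ((extChartAt (𝓡 (k + 4)) x₀).symm y)).toLinearMap =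
      s * altSum id (fun i a b c ↦
        partialDeriv (fun i ↦ EuclideanSpace.single i 1) i
          (ρ ∘ (extChartAt (𝓡 (k + 4)) x₀).symm) y * transgressionCoord D D' x₀ a b c y)
        (Φ.comp x₀ y) := by
  rw [chartDensity_mul_transgressionDensity_symm D D' hs hy]
  refine congrArg _ (Finset.sum_congr rfl fun σ _ ↦ congrArg _ (congrArg₂ _ ?_ rfl))
  exact congrArg₂ _ (mvfderiv_coordTangent hy.1.1 (hρ.mdifferentiableAt (by simp)) _) rfl

variable [IsContMDiffRiemannianBundle (𝓡 (k + 4)) ∞ (EuclideanSpace ℝ (Fin (k + 4)))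
      (fun x : M ↦ TangentSpace (𝓡 (k + 4)) x)]

lemma continuous_curvatureNormSq : Continuous D.curvatureNormSq := by
  refine continuous_of_continuousAt_extChartAt_symm (𝓡 (k + 4)) fun x₀ ↦
    ContinuousOn.continuousAt (ContinuousOn.congr ?_ fun y hy ↦ D.curvatureNormSq_symm hy)
      ((isOpen_frameDomain F E x₀).mem_nhds (mem_frameDomain F E x₀))
  have hG (i j) := (continuousOn_coordGram_inv (n := k + 4) x₀ i j).mono
    (inter_subset_left : frameDomain F E x₀ ⊆ _)
  exact continuousOn_const.mul (continuousOn_finsetSum _ fun i _ ↦ continuousOn_finsetSum _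
    fun j _ ↦ continuousOn_finsetSum _ fun p _ ↦ continuousOn_finsetSum _ fun q _ ↦
    (hG i j).mul ((hG p q).mul (continuousOn_curvaturePairing x₀ i p j q)))

lemma continuous_calibDensity (hΦ : Φ.IsSmooth) : Continuous (D.calibDensity o Φ) := by
  refine continuous_of_continuousAt_chartDensity_mul (n := k + 4) fun x₀ ↦ ?_
  obtain ⟨s, hs, hx⟩ := exists_mem_localDomain F E o x₀
  refine (ContinuousOn.congr (continuousOn_const.mul ?_) fun y hy ↦
    D.chartDensity_mul_calibDensity_symm hs hy).continuousAt
      ((isOpen_localDomain F E o x₀ s).mem_nhds hx)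
  exact continuousOn_altSum _
    (fun a b c d ↦ (continuousOn_curvaturePairing x₀ a b c d).mono inter_subset_left)
    fun t ↦ (DForm.continuousOn_comp hΦ x₀ t).mono (localDomain_subset_target F E o x₀ s)

lemma continuous_transgressionDensity_mvfderiv (hΦ : Φ.IsSmooth) {ρ : M → ℝ}
    (hρ : ContMDiff (𝓡 (k + 4)) 𝓘(ℝ, ℝ) ∞ ρ) :
    Continuous fun x ↦
      transgressionDensity D D' o Φ x (mvfderiv (𝓡 (k + 4)) ρ x).toLinearMap := by
  refine continuous_of_continuousAt_chartDensity_mul (n := k + 4) fun x₀ ↦ ?_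
  obtain ⟨s, hs, hx⟩ := exists_mem_localDomain F E o x₀
  refine (ContinuousOn.congr (continuousOn_const.mul ?_) fun y hy ↦
    chartDensity_mul_transgressionDensity_mvfderiv D D' hs hy hρ).continuousAt
      ((isOpen_localDomain F E o x₀ s).mem_nhds hx)
  have htarget := localDomain_subset_target F E o x₀ s
  exact continuousOn_altSum _ (fun i a b c ↦
    ((continuousOn_partialDeriv_comp_extChartAt_symm x₀ _ i hρ).mono htarget).mul
      ((contDiffOn_transgressionComp D D' x₀ _ _ _).continuousOn.mono inter_subset_left))
    fun t ↦ (DForm.continuousOn_comp hΦ x₀ t).mono htarget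

end HermitianConnection

end Densities

/-! ### Independence of the connection -/

section Derivative

variable {𝕜 V H M W : Type*} [NontriviallyNormedField 𝕜] [NormedAddCommGroup V] [NormedSpace 𝕜 V]
  [TopologicalSpace H] {I : ModelWithCorners 𝕜 V H} [TopologicalSpace M] [ChartedSpace H M]
  [NormedAddCommGroup W] [NormedSpace 𝕜 W]

lemma mvfderiv_eq_zero_of_notMem_tsupport {ρ : M → W} {x : M} (hx : x ∉ tsupport ρ) :
    mvfderiv I ρ x = 0 := by
  have hzero : ρ =ᶠ[𝓝 x] fun _ ↦ 0 := notMem_tsupport_iff_eventuallyEq.1 hx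
  ext v
  rw [mvfderiv, hzero.mfderiv_eq, mfderiv_const]
  exact (NormedSpace.fromTangentSpace (𝕜 := 𝕜) (ρ x)).map_zero

lemma mvfderiv_finsetSum {κ : Type*} {ρ : κ → M → W} {x : M}
    (hρ : ∀ j, MDifferentiableAt I 𝓘(𝕜, W) (ρ j) x) (t : Finset κ) :
    mvfderiv I (∑ j ∈ t, ρ j) x = ∑ j ∈ t, mvfderiv I (ρ j) x := by
  classical
  induction t using Finset.induction_on with
  | empty => exact mvfderiv_zero
  | insert a t ha ih =>
    rw [Finset.sum_insert ha, Finset.sum_insert ha, ← ih]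
    exact mvfderiv_add (hρ a) (Finset.sum_induction ρ (MDifferentiableAt I 𝓘(𝕜, W) · x)
      (fun _ _ ↦ .add) mdifferentiableAt_const fun j _ ↦ hρ j)

lemma sum_mvfderiv_eq_zero_of_sum_eq_one {κ : Type*} [Fintype κ] {ρ : κ → M → 𝕜}
    (hρ : ∀ j, MDifferentiable I 𝓘(𝕜, 𝕜) (ρ j)) (hsum : ∀ x, ∑ j, ρ j x = 1) (x : M) :
    ∑ j, (mvfderiv I (ρ j) x).toLinearMap = 0 := by
  have hone : ∑ j, ρ j = fun _ ↦ 1 := by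
    ext x
    rw [Finset.sum_apply, hsum]
  have hderiv := mvfderiv_finsetSum (fun j ↦ hρ j x) Finset.univ
  rw [hone, mvfderiv_const] at hderiv
  rw [← ContinuousLinearMap.toLinearMap_sum, ← hderiv]
  rfl

end Derivative

section ChartExtend

variable {n : ℕ} {M : Type*} [TopologicalSpace M] [ChartedSpace (EuclideanSpace ℝ (Fin n)) M]

/-- A function on a manifold read in the chart at `x₀`, extended by zero. -/
def chartExtend (x₀ : M) (ρ : M → ℝ) : EuclideanSpace ℝ (Fin n) → ℝ :=
  (extChartAt (𝓡 n) x₀).target.indicator (ρ ∘ (extChartAt (𝓡 n) x₀).symm)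

variable {x₀ : M} {ρ : M → ℝ} {y : EuclideanSpace ℝ (Fin n)}

lemma chartExtend_eq (hy : y ∈ (extChartAt (𝓡 n) x₀).target) :
    chartExtend x₀ ρ y = ρ ((extChartAt (𝓡 n) x₀).symm y) :=
  indicator_of_mem hy _

lemma chartExtend_eventuallyEq (hy : y ∈ (extChartAt (𝓡 n) x₀).target) :
    chartExtend x₀ ρ =ᶠ[𝓝 y] ρ ∘ (extChartAt (𝓡 n) x₀).symm := by
  filter_upwards [(isOpen_extChartAt_target x₀).mem_nhds hy] with z hz using chartExtend_eq hz

variable [CompactSpace M]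

lemma isCompact_image_tsupport (hsupp : tsupport ρ ⊆ (extChartAt (𝓡 n) x₀).source) :
    IsCompact (extChartAt (𝓡 n) x₀ '' tsupport ρ) :=
  (isClosed_tsupport ρ).isCompact.image_of_continuousOn ((continuousOn_extChartAt x₀).mono hsupp)

lemma tsupport_chartExtend_subset (hsupp : tsupport ρ ⊆ (extChartAt (𝓡 n) x₀).source) :
    tsupport (chartExtend x₀ ρ) ⊆ extChartAt (𝓡 n) x₀ '' tsupport ρ := by
  refine closure_minimal (fun y hy ↦ ?_) (isCompact_image_tsupport hsupp).isClosed
  have hyt : y ∈ (extChartAt (𝓡 n) x₀).target := mem_of_indicator_ne_zero hy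
  refine ⟨(extChartAt (𝓡 n) x₀).symm y, subset_tsupport ρ ?_,
    (extChartAt (𝓡 n) x₀).right_inv hyt⟩
  rwa [Function.mem_support, chartExtend_eq hyt] at hy

lemma hasCompactSupport_chartExtend (hsupp : tsupport ρ ⊆ (extChartAt (𝓡 n) x₀).source) :
    HasCompactSupport (chartExtend (n := n) x₀ ρ) :=
  (isCompact_image_tsupport hsupp).of_isClosed_subset (isClosed_tsupport _)
    (tsupport_chartExtend_subset hsupp)

lemma contDiff_chartExtend [IsManifold (𝓡 n) ∞ M] (hρ : ContMDiff (𝓡 n) 𝓘(ℝ, ℝ) ∞ ρ)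
    (hsupp : tsupport ρ ⊆ (extChartAt (𝓡 n) x₀).source) :
    ContDiff ℝ ∞ (chartExtend (n := n) x₀ ρ) := by
  refine contMDiff_iff_contDiff.1 (contMDiff_of_tsupport fun y hy ↦ ContDiffAt.contMDiffAt ?_)
  obtain ⟨x, hx, rfl⟩ := tsupport_chartExtend_subset hsupp hy
  have hyt := (extChartAt (𝓡 n) x₀).map_source (hsupp hx)
  have hchart : ContDiffOn ℝ ∞ (ρ ∘ (extChartAt (𝓡 n) x₀).symm) (extChartAt (𝓡 n) x₀).target :=
    contMDiffOn_iff_contDiffOn.1 (hρ.comp_contMDiffOn (contMDiffOn_extChartAt_symm x₀))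
  exact (hchart.contDiffAt ((isOpen_extChartAt_target x₀).mem_nhds hyt)).congr_of_eventuallyEq
    (chartExtend_eventuallyEq hyt)

end ChartExtend

section Integration

variable {n : ℕ} {M : Type*} [TopologicalSpace M]
  [ChartedSpace (EuclideanSpace ℝ (Fin n)) M] [IsManifold (𝓡 n) ∞ M]
  [MeasurableSpace M] [BorelSpace M]
  [RiemannianBundle (fun x : M ↦ TangentSpace (𝓡 n) x)]
  [IsContMDiffRiemannianBundle (𝓡 n) ∞ (EuclideanSpace ℝ (Fin n))
      (fun x : M ↦ TangentSpace (𝓡 n) x)]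

lemma integrable_riemannianVolume [CompactSpace M] {f : M → ℝ} (hf : Continuous f) :
    Integrable f (riemannianVolume n M) :=
  hf.integrable_of_hasCompactSupport (HasCompactSupport.of_compactSpace f)

lemma integral_riemannianVolume_eq_integral {x₀ : M} {Ω : Set (EuclideanSpace ℝ (Fin n))}
    (hΩ : Ω ⊆ (extChartAt (𝓡 n) x₀).target) {f : M → ℝ} (hf : Continuous f)
    (hf0 : ∀ x ∉ (extChartAt (𝓡 n) x₀).source ∩ extChartAt (𝓡 n) x₀ ⁻¹' Ω, f x = 0)
    {g : EuclideanSpace ℝ (Fin n) → ℝ} (hg0 : ∀ y ∉ Ω, g y = 0)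
    (hfg : ∀ y ∈ Ω, chartDensity x₀ y * f ((extChartAt (𝓡 n) x₀).symm y) = g y) :
    ∫ x, f x ∂(riemannianVolume n M) = ∫ y, g y := by
  rw [integral_riemannianVolume_eq x₀ hf fun x hx ↦ hf0 x fun h ↦ hx h.1,
    ← setIntegral_eq_integral_of_forall_compl_eq_zero fun y hy ↦ hg0 y fun h ↦ hy (hΩ h)]
  refine setIntegral_congr_fun (isOpen_extChartAt_target x₀).measurableSet fun y hy ↦ ?_
  by_cases hyΩ : y ∈ Ω
  · exact hfg y hyΩ
  · have hsymm : (extChartAt (𝓡 n) x₀).symm y ∉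
        (extChartAt (𝓡 n) x₀).source ∩ extChartAt (𝓡 n) x₀ ⁻¹' Ω := fun h ↦ hyΩ <| by
      simpa only [mem_preimage, (extChartAt (𝓡 n) x₀).right_inv hy] using h.2
    simp only [hf0 _ hsymm, hg0 y hyΩ, mul_zero]

end Integration

section ChernWeil

variable {k : ℕ} {M : Type*} [TopologicalSpace M] [T2Space M] [CompactSpace M]
  [ChartedSpace (EuclideanSpace ℝ (Fin (k + 4))) M] [IsManifold (𝓡 (k + 4)) ∞ M]
  [RiemannianBundle (fun x : M ↦ TangentSpace (𝓡 (k + 4)) x)]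
  {F : Type*} [NormedAddCommGroup F]
  {E : M → Type*} [TopologicalSpace (TotalSpace F E)] [∀ x, NormedAddCommGroup (E x)]
  [FiberBundle F E]

lemma exists_partitionOfUnity_localDomain (o : ManifoldOrientation (k + 4) M) :
    ∃ (t : Finset M) (s : M → ℝ) (ρ : t → M → ℝ), (∀ x₀, s x₀ * s x₀ = 1) ∧
      (∀ j, ContMDiff (𝓡 (k + 4)) 𝓘(ℝ, ℝ) ∞ (ρ j)) ∧ (∀ x, ∑ j, ρ j x = 1) ∧
      ∀ j : t, tsupport (ρ j) ⊆ (extChartAt (𝓡 (k + 4)) (j : M)).source ∩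
        extChartAt (𝓡 (k + 4)) (j : M) ⁻¹' localDomain F E o j (s j) := by
  choose s hs hx using exists_mem_localDomain (n := k + 4) F E o
  let N (x₀ : M) : Set M := (extChartAt (𝓡 (k + 4)) x₀).source ∩
    extChartAt (𝓡 (k + 4)) x₀ ⁻¹' localDomain F E o x₀ (s x₀)
  have hN (x₀) : IsOpen (N x₀) := (continuousOn_extChartAt x₀).isOpen_inter_preimage
    (isOpen_extChartAt_source x₀) (isOpen_localDomain F E o x₀ (s x₀))
  obtain ⟨t, -, ht⟩ := isCompact_univ.elim_nhds_subcover N fun x₀ _ ↦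
    (hN x₀).mem_nhds ⟨mem_extChartAt_source x₀, hx x₀⟩
  obtain ⟨ρ, hρN⟩ := SmoothPartitionOfUnity.exists_isSubordinate (𝓡 (k + 4)) isClosed_univ
    (fun j : t ↦ N j) (fun j ↦ hN j) fun x hx ↦ by simpa using ht hx
  refine ⟨t, s, fun j ↦ ρ j, hs, fun j ↦ (ρ j).contMDiff, fun x ↦ ?_, hρN⟩
  rw [← finsum_eq_sum_of_fintype]
  exact ρ.sum_eq_one (mem_univ x)

variable [MeasurableSpace M] [BorelSpace M]
  [IsContMDiffRiemannianBundle (𝓡 (k + 4)) ∞ (EuclideanSpace ℝ (Fin (k + 4)))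
      (fun x : M ↦ TangentSpace (𝓡 (k + 4)) x)]
  [NormedSpace ℂ F] [FiniteDimensional ℂ F] [∀ x, InnerProductSpace ℂ (E x)]
  [VectorBundle ℂ F E] [VectorBundle ℝ F E]
  [ContMDiffVectorBundle ∞ F E (𝓡 (k + 4))] [IsContMDiffRiemannianBundle (𝓡 (k + 4)) ∞ F E]

namespace HermitianConnection

variable (D D' : HermitianConnection (k + 4) F E) {o : ManifoldOrientation (k + 4) M}
  {Φ : DForm (k + 4) M k} {s : ℝ} {x₀ : M} {ρ : M → ℝ}

lemma integral_mul_calibDensity_sub_eq_integral (hΦ : Φ.IsSmooth) (hs : s * s = 1)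
    (hρ : Continuous ρ)
    (hsupp : tsupport ρ ⊆ (extChartAt (𝓡 (k + 4)) x₀).source ∩
      extChartAt (𝓡 (k + 4)) x₀ ⁻¹' localDomain F E o x₀ s) :
    ∫ x, ρ x * (D'.calibDensity o Φ x - D.calibDensity o Φ x) ∂(riemannianVolume (k + 4) M) =
      s * (k.factorial : ℝ)⁻¹ * ∫ y, chartExtend x₀ ρ y *
        altSum id (fun i a b c ↦ partialDeriv (fun i ↦ EuclideanSpace.single i (1 : ℝ)) i
          (transgressionCoord D D' x₀ a b c) y) (Φ.comp x₀ y) := by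
  have hcont : Continuous fun x ↦ ρ x * (D'.calibDensity o Φ x - D.calibDensity o Φ x) :=
    hρ.mul ((D'.continuous_calibDensity hΦ).sub (D.continuous_calibDensity hΦ))
  rw [← integral_const_mul]
  refine integral_riemannianVolume_eq_integral (localDomain_subset_target F E o x₀ s) hcont
    (fun x hx ↦ ?_) (fun y hy ↦ ?_) fun y hy ↦ ?_
  · rw [image_eq_zero_of_notMem_tsupport fun h ↦ hx (hsupp h), zero_mul]
  · have hy' : y ∉ tsupport (chartExtend x₀ ρ) := fun h ↦ hy <| image_subset_iff.2
      (hsupp.trans inter_subset_right)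
      (tsupport_chartExtend_subset (hsupp.trans inter_subset_left) h)
    rw [image_eq_zero_of_notMem_tsupport hy', zero_mul, mul_zero]
  · rw [chartExtend_eq hy.1.1, altSum_partialDeriv_transgressionCoord D D' hy.1]
    have hdensity := D.chartDensity_mul_calibDensity_symm (Φ := Φ) hs hy
    have hdensity' := D'.chartDensity_mul_calibDensity_symm (Φ := Φ) hs hy
    rw [mul_inv] at hdensity hdensity'
    linear_combination ρ ((extChartAt (𝓡 (k + 4)) x₀).symm y) * (hdensity' - hdensity)

lemma integral_transgressionDensity_mvfderiv_eq_integral (hΦ : Φ.IsSmooth) (hs : s * s = 1)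
    (hρ : ContMDiff (𝓡 (k + 4)) 𝓘(ℝ, ℝ) ∞ ρ)
    (hsupp : tsupport ρ ⊆ (extChartAt (𝓡 (k + 4)) x₀).source ∩
      extChartAt (𝓡 (k + 4)) x₀ ⁻¹' localDomain F E o x₀ s) :
    ∫ x, transgressionDensity D D' o Φ x (mvfderiv (𝓡 (k + 4)) ρ x).toLinearMap
        ∂(riemannianVolume (k + 4) M) =
      s * ∫ y, altSum id (fun i a b c ↦
        partialDeriv (fun i ↦ EuclideanSpace.single i (1 : ℝ)) i (chartExtend x₀ ρ) y *
          transgressionCoord D D' x₀ a b c y) (Φ.comp x₀ y) := by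
  rw [← integral_const_mul]
  refine integral_riemannianVolume_eq_integral (localDomain_subset_target F E o x₀ s)
    (continuous_transgressionDensity_mvfderiv D D' hΦ hρ) (fun x hx ↦ ?_) (fun y hy ↦ ?_)
    fun y hy ↦ ?_
  · rw [mvfderiv_eq_zero_of_notMem_tsupport fun h ↦ hx (hsupp h)]
    exact transgressionDensity_zero D D' o Φ x
  · have hy' : y ∉ tsupport (chartExtend x₀ ρ) := fun h ↦ hy <| image_subset_iff.2
      (hsupp.trans inter_subset_right)
      (tsupport_chartExtend_subset (hsupp.trans inter_subset_left) h)
    simp only [altSum, partialDeriv_eq_zero_of_notMem_tsupport hy', zero_mul, mul_zero,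
      Finset.sum_const_zero]
  · rw [chartDensity_mul_transgressionDensity_mvfderiv D D' hs hy hρ]
    refine congrArg _ (altSum_congr fun i a b c ↦ congrArg (· * _) ?_)
    exact DFunLike.congr_fun (chartExtend_eventuallyEq hy.1.1).fderiv_eq.symm _

lemma integral_mul_calibDensity_sub (hΦ : Φ.IsSmooth) (hd : Φ.IsClosed) (hs : s * s = 1)
    (hρ : ContMDiff (𝓡 (k + 4)) 𝓘(ℝ, ℝ) ∞ ρ)
    (hsupp : tsupport ρ ⊆ (extChartAt (𝓡 (k + 4)) x₀).source ∩
      extChartAt (𝓡 (k + 4)) x₀ ⁻¹' localDomain F E o x₀ s) :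
    ∫ x, ρ x * (D'.calibDensity o Φ x - D.calibDensity o Φ x) ∂(riemannianVolume (k + 4) M) =
      -(k.factorial : ℝ)⁻¹ * ∫ x, transgressionDensity D D' o Φ x
        (mvfderiv (𝓡 (k + 4)) ρ x).toLinearMap ∂(riemannianVolume (k + 4) M) := by
  have hsource := hsupp.trans inter_subset_left
  have hstokes : ∫ y, chartExtend x₀ ρ y * altSum id (fun i a b c ↦
        partialDeriv (fun i ↦ EuclideanSpace.single i (1 : ℝ)) i
          (transgressionCoord D D' x₀ a b c) y) (Φ.comp x₀ y) =
      -∫ y, altSum id (fun i a b c ↦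
        partialDeriv (fun i ↦ EuclideanSpace.single i (1 : ℝ)) i (chartExtend x₀ ρ) y *
          transgressionCoord D D' x₀ a b c y) (Φ.comp x₀ y) :=
    integral_mul_altSum_partialDeriv volume id
    (fun i ↦ EuclideanSpace.single i (1 : ℝ)) (isOpen_localDomain F E o x₀ s)
    ((contDiff_chartExtend hρ hsource).of_le (by simp)) (hasCompactSupport_chartExtend hsource)
    ((tsupport_chartExtend_subset hsource).trans
      (image_subset_iff.2 (hsupp.trans inter_subset_right)))
    (T := transgressionCoord D D' x₀)
    (fun a b c ↦ ((contDiffOn_transgressionComp D D' x₀ _ _ _).mono inter_subset_left).of_le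
      (by simp))
    (((hΦ x₀).mono (localDomain_subset_target F E o x₀ s)).of_le (by simp))
    fun y hy ↦ hd x₀ y hy.1.1
  rw [integral_mul_calibDensity_sub_eq_integral D D' hΦ hs hρ.continuous hsupp,
    integral_transgressionDensity_mvfderiv_eq_integral D D' hΦ hs hρ hsupp]
  linear_combination s * (k.factorial : ℝ)⁻¹ * hstokes

theorem integral_calibDensity_eq (hΦ : Φ.IsSmooth) (hd : Φ.IsClosed) :
    ∫ x, D'.calibDensity o Φ x ∂(riemannianVolume (k + 4) M) =
      ∫ x, D.calibDensity o Φ x ∂(riemannianVolume (k + 4) M) := by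
  obtain ⟨t, s, ρ, hs, hρ, hsum, hsupp⟩ := exists_partitionOfUnity_localDomain (F := F) (E := E) o
  have hq (D : HermitianConnection (k + 4) F E) := D.continuous_calibDensity (o := o) hΦ
  have hdρ := sum_mvfderiv_eq_zero_of_sum_eq_one (fun j ↦ (hρ j).mdifferentiable (by simp)) hsum
  rw [← sub_eq_zero, ← integral_sub (integrable_riemannianVolume (hq D'))
    (integrable_riemannianVolume (hq D))]
  calc
    _ = ∫ x, ∑ j, ρ j x * (D'.calibDensity o Φ x - D.calibDensity o Φ x)
        ∂(riemannianVolume (k + 4) M) := by simp only [← Finset.sum_mul, hsum, one_mul]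
    _ = ∑ j, -(k.factorial : ℝ)⁻¹ * ∫ x, transgressionDensity D D' o Φ x
        (mvfderiv (𝓡 (k + 4)) (ρ j) x).toLinearMap ∂(riemannianVolume (k + 4) M) := by
      refine (integral_finsetSum _ fun j _ ↦ integrable_riemannianVolume
        ((hρ j).continuous.mul ((hq D').sub (hq D)))).trans ?_
      exact Finset.sum_congr rfl fun j _ ↦
        integral_mul_calibDensity_sub D D' hΦ hd (hs j) (hρ j) (hsupp j)
    _ = 0 := by
      rw [← Finset.mul_sum, ← integral_finsetSum _ fun j _ ↦
        integrable_riemannianVolume (continuous_transgressionDensity_mvfderiv D D' hΦ (hρ j))]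
      simp only [← transgressionDensity_sum, hdρ, transgressionDensity_zero, integral_zero,
        mul_zero]

end HermitianConnection

end ChernWeil

section Calibration

variable {k : ℕ} {M : Type*} [TopologicalSpace M] [T2Space M]
  [ChartedSpace (EuclideanSpace ℝ (Fin (k + 4))) M] [IsManifold (𝓡 (k + 4)) ∞ M]
  [RiemannianBundle (fun x : M ↦ TangentSpace (𝓡 (k + 4)) x)]
  {F : Type*} [NormedAddCommGroup F] [NormedSpace ℂ F] [FiniteDimensional ℂ F]
  {E : M → Type*} [TopologicalSpace (TotalSpace F E)]
  [∀ x, NormedAddCommGroup (E x)] [∀ x, InnerProductSpace ℂ (E x)]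
  [FiberBundle F E] [VectorBundle ℂ F E] [VectorBundle ℝ F E]
  [ContMDiffVectorBundle ∞ F E (𝓡 (k + 4))] [IsContMDiffRiemannianBundle (𝓡 (k + 4)) ∞ F E]
  (D : HermitianConnection (k + 4) F E) {o : ManifoldOrientation (k + 4) M}
  {Φ : DForm (k + 4) M k}

namespace HermitianConnection

lemma calibDensity_le_curvatureNormSq (hΦ : IsYangMillsCalibratingForm o Φ) (x : M) :
    D.calibDensity o Φ x ≤ D.curvatureNormSq x := by
  have : FiniteDimensional ℂ (E x) :=
    ((trivializationAt F E x).continuousLinearEquivAt ℂ x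
      (FiberBundle.mem_baseSet_trivializationAt' x)).toLinearEquiv.symm.finiteDimensional
  exact qForm_le_normSqForm_of_skew _ _ (hΦ.le_normSq x) _ fun v s t ↦ D.curvature_skew x v s t

variable [CompactSpace M] [MeasurableSpace M] [BorelSpace M]
  [IsContMDiffRiemannianBundle (𝓡 (k + 4)) ∞ (EuclideanSpace ℝ (Fin (k + 4)))
      (fun x : M ↦ TangentSpace (𝓡 (k + 4)) x)]

variable {D} in
lemma IsCalibrated.yangMills_eq_integral (hD : D.IsCalibrated o Φ) (hΦ : Φ.IsSmooth)
    (hd : Φ.IsClosed) (D' : HermitianConnection (k + 4) F E) :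
    D.yangMills = ∫ x, D'.calibDensity o Φ x ∂(riemannianVolume (k + 4) M) := by
  rw [integral_calibDensity_eq D D' hΦ hd]
  exact integral_congr_ae (.of_forall fun x ↦ (hD x).symm)

lemma integral_calibDensity_le_yangMills (hΦ : IsYangMillsCalibratingForm o Φ) :
    ∫ x, D.calibDensity o Φ x ∂(riemannianVolume (k + 4) M) ≤ D.yangMills :=
  integral_mono (integrable_riemannianVolume (D.continuous_calibDensity hΦ.smooth))
    (integrable_riemannianVolume D.continuous_curvatureNormSq)
    (D.calibDensity_le_curvatureNormSq hΦ)

lemma isCalibrated_of_integral_calibDensity_eq (hΦ : IsYangMillsCalibratingForm o Φ)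
    (h : ∫ x, D.calibDensity o Φ x ∂(riemannianVolume (k + 4) M) = D.yangMills) :
    D.IsCalibrated o Φ := by
  have hq := D.continuous_calibDensity (o := o) hΦ.smooth
  have hF := D.continuous_curvatureNormSq
  have hae := (integral_eq_iff_of_ae_le (integrable_riemannianVolume hq)
    (integrable_riemannianVolume hF) (.of_forall (D.calibDensity_le_curvatureNormSq hΦ))).1 h
  exact congrFun ((hq.ae_eq_iff_eq _ hF).1 hae)

end HermitianConnection

end Calibration

end YMCalib

end

theorem mainTheorem7 {k : ℕ} {M : Type*} [TopologicalSpace M] [T2Space M] [CompactSpace M]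
    [ChartedSpace (EuclideanSpace ℝ (Fin (k + 4))) M] [IsManifold (𝓡 (k + 4)) ∞ M]
    [MeasurableSpace M] [BorelSpace M]
    [RiemannianBundle (fun x : M ↦ TangentSpace (𝓡 (k + 4)) x)]
    [IsContMDiffRiemannianBundle (𝓡 (k + 4)) ∞ (EuclideanSpace ℝ (Fin (k + 4)))
      (fun x : M ↦ TangentSpace (𝓡 (k + 4)) x)]
    (o : YMCalib.ManifoldOrientation (k + 4) M)
    {F : Type*} [NormedAddCommGroup F] [NormedSpace ℂ F] [FiniteDimensional ℂ F]
    {E : M → Type*} [TopologicalSpace (TotalSpace F E)]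
    [∀ x, NormedAddCommGroup (E x)] [∀ x, InnerProductSpace ℂ (E x)]
    [FiberBundle F E] [VectorBundle ℂ F E] [VectorBundle ℝ F E]
    [ContMDiffVectorBundle ∞ F E (𝓡 (k + 4))] [IsContMDiffRiemannianBundle (𝓡 (k + 4)) ∞ F E]
    (Φ : YMCalib.DForm (k + 4) M k) (hΦ : YMCalib.IsYangMillsCalibratingForm o Φ)
    (D : YMCalib.HermitianConnection (k + 4) F E) (hD : D.IsCalibrated o Φ)
    (D' : YMCalib.HermitianConnection (k + 4) F E) :
    D.yangMills ≤ D'.yangMills ∧ (D'.yangMills = D.yangMills → D'.IsCalibrated o Φ) := by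
  have henergy := hD.yangMills_eq_integral hΦ.smooth hΦ.closed D'
  refine ⟨henergy.trans_le (D'.integral_calibDensity_le_yangMills hΦ), fun h ↦ ?_⟩
  exact D'.isCalibrated_of_integral_calibDensity_eq hΦ (henergy.symm.trans h.symm)
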